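/- Let $d\ge 4$ and let $\Delta$ be a finite, connected, pure simplicial complex of dimension $d-1$ that is \emph{semi-Eulerian}: for every nonempty face $\rho$ of $\Delta$, the Euler characteristic of the link of $\rho$ equals $\chi(S^{d-|\rho|-1})=1+(-1)^{d-|\rho|-1}$. Let $\mathbf a=(a_1,\dots,a_m)$ be a sequence of positive integers with $|\mathbf a|=a_1+\dots+a_m=d$. A \emph{balanced complex of type $\mathbf a$} is a finite simplicial complex $\Delta'$ together with a surjective colouring $\phi$ of its vertices by $\{1,\dots,m\}$ such that every facet has exactly $a_j$ vertices of colour $j$, for each $j$. For a sequence of nonnegative integers $\mathbf b=(b_1,\dots,b_m)$ with $b_j\le a_j$ for all $j$ (written $\mathbf b\le\mathbf a$), let $f_{\mathbf b}(\Delta')$ be the number of faces of $\Delta'$ (including the empty face) having exactly $b_j$ vertices of colour $j$ for every $j$, and define the fine $h$-vector $(h_{\mathbf b}(\Delta'))_{\mathbf b\le\mathbf a}$ by $$h_{\mathbf b}=\sum_{\mathbf c\le\mathbf b} f_{\mathbf c}\prod_{i=1}^m(-1)^{b_i-c_i}\binom{a_i-c_i}{b_i-c_i}.$$ Let $H_\Delta$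 be the affine span, in the real vector space of families indexed by $\{\mathbf b:\mathbf b\le\mathbf a\}$, of the fine $h$-vectors of all balanced complexes $\Delta'$ of type $\mathbf a$ whose geometric realization is homeomorphic to that of $\Delta$. Put $n(\mathbf a)=\prod_{j=1}^m(a_j+1)$. Then $$\dim H_\Delta=\begin{cases}\tfrac12\,(n(\mathbf a)-1)&\text{if every } a_i \text{ is even},\\[2pt] \tfrac12\,(n(\mathbf a)-2)&\text{otherwise.}\end{cases}$$ -/

import Mathlib

noncomputable section

namespace BalancedComplex

open scoped Classical in
/-- The Euler characteristic `∑ (-1) ^ dim s` of a finite simplicial complex, the sum being over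
its nonempty faces `s` (the faces of a `PreAbstractSimplicialComplex` are nonempty by definition),
with `dim s = #s - 1`. -/
def eulerChar {V : Type*} [Fintype V] (K : PreAbstractSimplicialComplex V) : ℤ :=
  ∑ s : Finset V with s ∈ K.faces, (-1) ^ (s.card - 1)

/-- The Euler characteristic of the sphere of dimension `k ≥ -1` (the sphere of dimension `-1`
is empty, with Euler characteristic `0`). -/
def sphereEulerChar (k : ℤ) : ℤ := 1 + (k.negOnePow : ℤ)

open scoped Classical in
/-- The link of `ρ`: the faces disjoint from `ρ` whose union with `ρ` is a face. As everywhere in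
this representation, only nonempty faces are recorded. -/
def link {V : Type*} (K : AbstractSimplicialComplex V) (ρ : Finset V) :
    PreAbstractSimplicialComplex V where
  faces := {τ | τ.Nonempty ∧ Disjoint τ ρ ∧ τ ∪ ρ ∈ K.faces}
  isRelLowerSet_faces := by
    rintro τ ⟨hτ, hd, hu⟩
    refine ⟨hτ, fun σ hσ hne => ⟨hne, Finset.disjoint_of_subset_left hσ hd, ?_⟩⟩
    exact (K.isRelLowerSet_faces hu).2 (Finset.union_subset_union_left hσ)
      (hne.mono Finset.subset_union_left)

/-- A facet is a face that is maximal under inclusion. -/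
def IsFacet {V : Type*} (K : AbstractSimplicialComplex V) (σ : Finset V) : Prop :=
  Maximal (fun s => s ∈ K.faces) σ

/-- `K` is pure of dimension `d - 1`: all facets have `d` vertices. -/
def IsPure {V : Type*} (K : AbstractSimplicialComplex V) (d : ℕ) : Prop :=
  ∀ σ, IsFacet K σ → σ.card = d

/-- A `(d - 1)`-dimensional complex is semi-Eulerian if the link of every nonempty face `ρ` has
the Euler characteristic of the sphere of dimension `d - #ρ - 1`. -/
def IsSemiEulerian {V : Type*} [Fintype V] (K : AbstractSimplicialComplex V) (d : ℕ) : Prop :=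
  ∀ ρ ∈ K.faces, eulerChar (link K ρ) = sphereEulerChar ((d : ℤ) - ρ.card - 1)

open scoped Classical in
/-- The geometric realization, in the real vector space with basis the vertex set: the union
over the faces `s` of the convex hull of the standard basis vectors labelled by `s`. -/
def realization {V : Type*} (K : AbstractSimplicialComplex V) : Set (V → ℝ) :=
  ⋃ s ∈ K.faces, convexHull ℝ ((fun v : V => (Pi.single v 1 : V → ℝ)) '' (s : Set V))

/-- Two complexes are homeomorphic if their geometric realizations are. -/
def Homeomorphic {V W : Type*} (K : AbstractSimplicialComplex V)
    (L : AbstractSimplicialComplex W) : Prop :=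
  Nonempty (realization K ≃ₜ realization L)

/-- The number of vertices of colour `j` in `ρ`. -/
def colorCount {V : Type*} {m : ℕ} (φ : V → Fin m) (ρ : Finset V) (j : Fin m) : ℕ :=
  (ρ.filter (fun v => φ v = j)).card

/-- `(K, φ)` is a balanced complex of type `a`: `φ` is a surjective colouring of the vertices
for which every facet has exactly `a j` vertices of colour `j`. -/
def IsBalanced {V : Type*} {m : ℕ} (K : AbstractSimplicialComplex V) (φ : V → Fin m)
    (a : Fin m → ℕ) : Prop :=
  Function.Surjective φ ∧ ∀ σ, IsFacet K σ → ∀ j, colorCount φ σ j = a j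

/-- The entry `f_c` of the fine `f`-vector: the number of faces, the empty face included, that
have exactly `c j` vertices of each colour `j`. -/
def fineF {V : Type*} {m : ℕ} (K : AbstractSimplicialComplex V) (φ : V → Fin m)
    (c : Fin m → ℕ) : ℕ :=
  Set.ncard {ρ : Finset V | (ρ = ∅ ∨ ρ ∈ K.faces) ∧ ∀ j, colorCount φ ρ j = c j}

/-- The fine `h`-vector of `(K, φ)` with respect to the type `a`, indexed by the `b ≤ a`. -/
def fineH {V : Type*} {m : ℕ} (K : AbstractSimplicialComplex V) (φ : V → Fin m)
    (a : Fin m → ℕ) : Set.Iic a → ℝ :=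
  fun b => ∑ c ∈ Finset.Iic (b : Fin m → ℕ), (fineF K φ c : ℝ) *
    ∏ i, ((-1 : ℝ) ^ (b.1 i - c i) * ((a i - c i).choose (b.1 i - c i) : ℝ))

/-- The fine `h`-vectors of all balanced complexes of type `a` homeomorphic to `K`. Every finite
complex is isomorphic to one with vertex set `Fin n`. -/
def fineHVectors {V : Type*} {m : ℕ} (K : AbstractSimplicialComplex V) (a : Fin m → ℕ) :
    Set (Set.Iic a → ℝ) :=
  {h | ∃ (n : ℕ) (L : AbstractSimplicialComplex (Fin n)) (φ : Fin n → Fin m),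
    IsBalanced L φ a ∧ Homeomorphic L K ∧ h = fineH L φ a}

end BalancedComplex

end

/-! Let `U` be the space of vectors `h` indexed by `b ≤ a` with `h 0 = 0` and `h (a - b) = h b`; it
is `invariantVanishing (reverse a) (zeroType a)`. Its dimension is the number of orbits of `b ↦ a -
b` minus one, for the orbit of `0`. As the involution has one fixed point if all `a i` are even and
none otherwise, this is the stated number. So the theorem says that the direction of the affine span
is `U`.

Upper bound. In a complex homeomorphic to `Δ`, the sum of `(-1) ^ #τ` over the faces `τ ⊇ ρ` is
`(-1) ^ d` for every nonempty face `ρ`. Counting pairs `ρ ⊆ τ` in two ways gives the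
Dehn–Sommerville relations `fineH_reverse`: the defect `h (a - b) - h b` depends only on `a`, `b`,
`d` and the Euler characteristic. Hence differences of fine `h`-vectors lie in `U`. This requires
star sums and the Euler characteristic to be topological (`starCount_of_homeomorphic`). For that,
rational homology is computed by chains of lists of points lying in a common simplex;
`Chain.exists_sub_bd_mem` compares these with simplicial chains and with lists of small diameter, on
which continuous maps act after a correction by `shrink`. Locally, the realization minus a point `x`
retracts onto the complement of the open star of the face carrying `x`, so the Euler characteristic
of that complement, and with it the star sum, is invariant.

Lower bound. The barycentric subdivision of `Δ`, coloured by dimension, has one vertex of each of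
`d` colours in each facet; merging colours along a map `Fin d → Fin m` with fibres of sizes `a j`
makes it balanced of type `a`. Replacing a face by a Schlegel diagram of a cross-polytope, opposite
vertices having equal colours, keeps both the homeomorphism type and this property. Subdividing a
facet `σ` in this way produces an opposite simplex whose surroundings do not depend on `Δ`. A second
subdivision at the face of colour set `C` of that simplex changes the fine `h`-vector by the sum
over colour sets `S` of `crossWeight C S` times the unit vector of the type of `S`
(`colorSum_crossSubdivision_crossSubdivision`, `sum_prod_hCoeff`). Möbius inversion over `C`
(`sum_crossWeight_compl`) extracts the sum of the unit vectors at `b` and `a - b` for every `b`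
other than `0` and `a`; these sums span `U`. -/

noncomputable section

namespace BalancedComplex

/-! ### Augmented ordered chains: cones, induced maps and prisms. -/

section

/-- Ordered chains: formal rational combinations of lists of points, the empty list included. -/
abbrev Chain (α : Type*) := List α →₀ ℚ

namespace Chain

variable {α β : Type*}

/-- The cone operator putting `x` in front of every list. -/
def cons (x : α) : Chain α →ₗ[ℚ] Chain α := Finsupp.lmapDomain ℚ ℚ (List.cons x)

/-- The boundary of a list. -/
def bdList : List α → Chain α
  | [] => 0
  | x :: l => Finsupp.single l 1 - cons x (bdList l)

/-- The boundary operator of the augmented ordered chain complex. -/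
def bd : Chain α →ₗ[ℚ] Chain α := Finsupp.linearCombination ℚ bdList

/-- The chain map induced by a map of points. -/
def map (f : α → β) : Chain α →ₗ[ℚ] Chain β := Finsupp.lmapDomain ℚ ℚ (List.map f)

@[simp] lemma cons_single (x : α) (l : List α) (r : ℚ) :
    cons x (Finsupp.single l r) = Finsupp.single (x :: l) r := by
  simp [cons]

@[simp] lemma map_single (f : α → β) (l : List α) (r : ℚ) :
    map f (Finsupp.single l r) = Finsupp.single (l.map f) r := by
  simp [map]

@[simp] lemma bd_single_one (l : List α) : bd (Finsupp.single l 1) = bdList l := by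
  simp [bd]

lemma bdList_cons (x : α) (l : List α) :
    bdList (x :: l) = Finsupp.single l 1 - cons x (bdList l) := rfl

lemma hom_ext {M : Type*} [AddCommGroup M] [Module ℚ M] {f g : Chain α →ₗ[ℚ] M}
    (h : ∀ l, f (Finsupp.single l 1) = g (Finsupp.single l 1)) : f = g := by
  ext l
  simpa using h l

/-- The cone is a contracting homotopy in all degrees, since the empty list is a basis element; the
acyclicity arguments below rest on this. -/
lemma bd_cons (x : α) (z : Chain α) : bd (cons x z) = z - cons x (bd z) := by
  have : bd ∘ₗ cons x = LinearMap.id - cons x ∘ₗ bd := hom_ext fun l => by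
    simp [bdList_cons]
  exact LinearMap.congr_fun this z

lemma bd_bd (z : Chain α) : bd (bd z) = 0 := by
  have : (bd : Chain α →ₗ[ℚ] Chain α) ∘ₗ bd = 0 := hom_ext fun l => by
    induction l with
    | nil => simp [bdList]
    | cons x l ih =>
      have ih' : bd (bdList l) = 0 := by simpa using ih
      simp [bdList_cons, bd_cons, ih']
  exact LinearMap.congr_fun this z

lemma map_cons (f : α → β) (x : α) (z : Chain α) :
    map f (cons x z) = cons (f x) (map f z) := by
  have : map f ∘ₗ cons x = cons (f x) ∘ₗ map f := hom_ext fun l => by simp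
  exact LinearMap.congr_fun this z

lemma bd_map (f : α → β) (z : Chain α) : bd (map f z) = map f (bd z) := by
  have : bd ∘ₗ map f = map f ∘ₗ bd := hom_ext fun l => by
    induction l with
    | nil => simp [bdList]
    | cons x l ih =>
      have ih' : bdList (l.map f) = map f (bdList l) := by simpa using ih
      simp [bdList_cons, map_cons, ih']
  exact LinearMap.congr_fun this z

/-- The prism over a list, between its images under two maps. -/
def prismList (f g : α → β) : List α → Chain β
  | [] => 0
  | x :: l => Finsupp.single (f x :: g x :: l.map g) 1 - cons (f x) (prismList f g l)

/-- The prism operator, a chain homotopy between the chain maps induced by two maps. -/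
def prism (f g : α → β) : Chain α →ₗ[ℚ] Chain β := Finsupp.linearCombination ℚ (prismList f g)

@[simp] lemma prism_single_one (f g : α → β) (l : List α) :
    prism f g (Finsupp.single l 1) = prismList f g l := by
  simp [prism]

lemma prismList_cons (f g : α → β) (x : α) (l : List α) :
    prismList f g (x :: l) =
      Finsupp.single (f x :: g x :: l.map g) 1 - cons (f x) (prismList f g l) := rfl

lemma prism_cons (f g : α → β) (x : α) (z : Chain α) :
    prism f g (cons x z) = cons (f x) (cons (g x) (map g z)) - cons (f x) (prism f g z) := by
  have : prism f g ∘ₗ cons x =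
      cons (f x) ∘ₗ cons (g x) ∘ₗ map g - cons (f x) ∘ₗ prism f g := hom_ext fun l => by
    simp [prismList_cons]
  exact LinearMap.congr_fun this z

/-- All maps agree on the empty list, so its prism can be `0` and the formula needs no correction at
the augmentation. -/
lemma bd_prism (f g : α → β) (z : Chain α) :
    bd (prism f g z) = map g z - map f z - prism f g (bd z) := by
  have : bd ∘ₗ prism f g = map g - map f - prism f g ∘ₗ bd := hom_ext fun l => by
    induction l with
    | nil => simp [bdList, prismList]
    | cons x l ih =>
      have ih' : bd (prismList f g l) =
          Finsupp.single (l.map g) 1 - Finsupp.single (l.map f) 1 - prism f g (bdList l) := by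
        simpa using ih
      have hg : bdList (l.map g) = map g (bdList l) := by
        simpa using bd_map g (Finsupp.single l 1)
      simp only [LinearMap.comp_apply, LinearMap.sub_apply, prism_single_one, prismList_cons,
        map_sub, bd_single_one, bdList_cons, bd_cons, ih', hg, prism_cons, map_single,
        List.map_cons, cons_single]
      abel
  exact LinearMap.congr_fun this z

/-- The chains supported on a set of lists. -/
abbrev on (S : Set (List α)) : Submodule ℚ (Chain α) := Finsupp.supported ℚ ℚ S

lemma on_mono {S T : Set (List α)} (h : S ⊆ T) : on S ≤ on T := Finsupp.supported_mono h

lemma mem_mono {S T : Set (List α)} {z : Chain α} (hz : z ∈ on S) (h : ∀ l ∈ S, l ∈ T) :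
    z ∈ on T :=
  on_mono h hz

lemma single_mem_on {S : Set (List α)} {l : List α} (h : l ∈ S) (r : ℚ) :
    Finsupp.single l r ∈ on S := Finsupp.single_mem_supported ℚ r h

/-- A linear map sends chains on `S` to a submodule as soon as it does so for every list. -/
lemma apply_mem_of_list {M : Type*} [AddCommGroup M] [Module ℚ M] (φ : Chain α →ₗ[ℚ] M)
    {S : Set (List α)} {N : Submodule ℚ M} (h : ∀ l ∈ S, φ (Finsupp.single l 1) ∈ N)
    {z : Chain α} (hz : z ∈ on S) : φ z ∈ N := by
  have : on S ≤ N.comap φ := by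
    rw [on, Finsupp.supported_eq_span_single, Submodule.span_le]
    rintro _ ⟨l, hl, rfl⟩
    exact h l hl
  exact this hz

lemma cons_mem {x : α} {S T : Set (List α)} (h : ∀ l ∈ S, x :: l ∈ T) {z : Chain α}
    (hz : z ∈ on S) : cons x z ∈ on T :=
  apply_mem_of_list _ (fun l hl => by simpa using single_mem_on (h l hl) 1) hz

lemma map_mem {f : α → β} {S : Set (List α)} {T : Set (List β)} (h : ∀ l ∈ S, l.map f ∈ T)
    {z : Chain α} (hz : z ∈ on S) : map f z ∈ on T :=
  apply_mem_of_list _ (fun l hl => by simpa using single_mem_on (h l hl) 1) hz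

lemma bdList_mem (l : List α) :
    bdList l ∈ on {l' : List α | l'.Sublist l ∧ l'.length + 1 = l.length} := by
  induction l with
  | nil => simp [bdList]
  | cons x l ih =>
    refine Submodule.sub_mem _ (single_mem_on (by simp) 1) (cons_mem ?_ ih)
    rintro l' ⟨h1, h2⟩
    exact ⟨h1.cons_cons x, by simp [h2]⟩

lemma bd_mem {S T : Set (List α)}
    (h : ∀ l ∈ S, ∀ l' : List α, l'.Sublist l → l'.length + 1 = l.length → l' ∈ T)
    {z : Chain α} (hz : z ∈ on S) : bd z ∈ on T :=
  apply_mem_of_list _ (fun l hl => by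
    rw [bd_single_one]
    exact on_mono (fun l' hl' => h l hl l' hl'.1 hl'.2) (bdList_mem l)) hz

/-- The order of the entries is not recorded: prisms are only used in sets of lists described by
their entries. -/
lemma prismList_mem (f g : α → β) (l : List α) :
    prismList f g l ∈ on {l' : List β | (∀ y ∈ l', y ∈ l.map f ++ l.map g) ∧
      l'.length = l.length + 1} := by
  induction l with
  | nil => simp [prismList]
  | cons x l ih =>
    refine Submodule.sub_mem _ (single_mem_on ?_ 1) (cons_mem ?_ ih)
    · refine ⟨fun y hy => ?_, by simp⟩
      simp only [List.mem_cons, List.map_cons, List.mem_append] at hy ⊢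
      tauto
    · rintro l' ⟨h1, h2⟩
      refine ⟨fun y hy => ?_, by simp [h2]⟩
      rcases List.mem_cons.1 hy with rfl | hy
      · simp
      · have := h1 y hy
        simp only [List.map_cons, List.mem_append, List.mem_cons] at this ⊢
        tauto

lemma prism_mem {f g : α → β} {S : Set (List α)} {T : Set (List β)}
    (h : ∀ l ∈ S, ∀ l' : List β, (∀ y ∈ l', y ∈ l.map f ++ l.map g) →
      l'.length = l.length + 1 → l' ∈ T)
    {z : Chain α} (hz : z ∈ on S) : prism f g z ∈ on T :=
  apply_mem_of_list _ (fun l hl => by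
    rw [prism_single_one]
    exact on_mono (fun l' hl' => h l hl l' hl'.1 hl'.2) (prismList_mem f g l)) hz

/-- Every cycle on `S` bounds on `S`. -/
def Acyclic (S : Set (List α)) : Prop := ∀ z ∈ on S, bd z = 0 → ∃ w ∈ on S, bd w = z

/-- A set of lists closed under passing to sublists. -/
def Closed (S : Set (List α)) : Prop := ∀ l ∈ S, ∀ l' : List α, l'.Sublist l → l' ∈ S

lemma Closed.bd_mem {S : Set (List α)} (h : Closed S) {z : Chain α} (hz : z ∈ on S) :
    bd z ∈ on S :=
  Chain.bd_mem (fun l hl l' hl' _ => h l hl l' hl') hz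

lemma Closed.inter {S T : Set (List α)} (hS : Closed S) (hT : Closed T) : Closed (S ∩ T) :=
  fun l hl l' h => ⟨hS l hl.1 l' h, hT l hl.2 l' h⟩

lemma filter_mem {S : Set (List α)} {z : Chain α} (hz : z ∈ on S) (p : List α → Prop)
    [DecidablePred p] :
    z.filter p ∈ on (S ∩ {l | p l}) := by
  rw [on, Finsupp.mem_supported] at *
  intro l hl
  simp only [Finsupp.support_filter, Finset.coe_filter, Set.mem_ofPred_eq] at hl
  exact ⟨hz hl.1, hl.2⟩

end Chain

end

/-! ### Comparing two chain complexes simplex by simplex. -/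

section
namespace Chain

variable {α : Type*} {V : Type*}

/-- The lists of `S` whose carrier belongs to `K`. -/
abbrev carried (c : List α → Finset V) (S : Set (List α)) (K : Set (Finset V)) : Set (List α) :=
  S ∩ {l | c l ∈ K}

lemma Closed.carried {c : List α → Finset V} (hc : ∀ l l' : List α, l'.Sublist l → c l' ⊆ c l)
    {S : Set (List α)} (hS : Closed S) {K : Set (Finset V)} (hK : IsLowerSet K) :
    Closed (carried c S K) :=
  hS.inter fun l hl l' h => hK (hc l l' h) hl

open scoped Classical in
/-- If two closed sets of lists `A ⊆ B` are acyclic over every simplex, then `A` and `B` have the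
same relative cycles modulo boundaries over every simplicial complex. -/
theorem exists_sub_bd_mem [Finite V] {c : List α → Finset V}
    (hc : ∀ l l' : List α, l'.Sublist l → c l' ⊆ c l) {A B : Set (List α)} (hAB : A ⊆ B)
    (hA : Closed A) (hB : Closed B) (h0 : ∀ l ∈ B, c l = ∅ → l ∈ A)
    (hAac : ∀ σ : Finset V, σ.Nonempty → Acyclic (carried c A (Set.Iic σ)))
    (hBac : ∀ σ : Finset V, σ.Nonempty → Acyclic (carried c B (Set.Iic σ)))
    {K : Set (Finset V)} (hK : IsLowerSet K) (hne : ∅ ∈ K) {z : Chain α}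
    (hz : z ∈ on (carried c B K)) (hdz : bd z ∈ on A) :
    ∃ w ∈ on (carried c B K), z - bd w ∈ on (carried c A K) := by
  induction K using WellFoundedLT.induction generalizing z with
  | ind K ih =>
    by_cases hK0 : ∀ σ ∈ K, σ = ∅
    · refine ⟨0, zero_mem _, ?_⟩
      rw [map_zero, sub_zero]
      exact mem_mono hz (fun l hl => ⟨h0 l hl.1 (hK0 _ hl.2), hl.2⟩)
    push Not at hK0
    obtain ⟨σ₀, hσ₀, hσ₀'⟩ := hK0
    -- The induction removes a maximal face `σ`. It is applied both to the rest `K'` and to the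
    -- boundary `D` of `σ`; lists over `K` but not over `K'` have carrier exactly `σ`.
    obtain ⟨σ, hσ₀σ, hσ⟩ := (Set.toFinite K).exists_le_maximal hσ₀
    have hσne : σ.Nonempty := hσ₀'.mono hσ₀σ
    set K' : Set (Finset V) := K \ {σ} with hK'def
    have hK' : IsLowerSet K' := fun s t hts hs => ⟨hK hts hs.1, fun h => hs.2 <| by
      rw [Set.mem_singleton_iff] at h ⊢
      subst h
      exact le_antisymm (hσ.2 hs.1 hts) hts⟩
    have hK'0 : ∅ ∈ K' := ⟨hne, fun h => hσne.ne_empty h.symm⟩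
    have hK'lt : K' < K := by
      refine lt_of_le_of_ne Set.sdiff_subset fun h => ?_
      have : σ ∈ K' := h ▸ hσ.1
      exact this.2 rfl
    set D : Set (Finset V) := Set.Iio σ with hDdef
    have hDK' : D ⊆ K' := fun s hs => ⟨hK (le_of_lt hs) hσ.1, fun h => (ne_of_lt hs) h⟩
    have hD : IsLowerSet D := isLowerSet_Iio σ
    have hD0 : ∅ ∈ D := by
      simpa [hDdef, Finset.ssubset_iff_subset_ne] using hσne.ne_empty.symm
    set zσ := z.filter (fun l => c l = σ) with hzσ
    set z' := z.filter (fun l => ¬ c l = σ) with hz'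
    have hzz : zσ + z' = z := Finsupp.filter_add_filter_not z _
    have hIic : IsLowerSet (Set.Iic σ) := isLowerSet_Iic σ
    have hzσm : zσ ∈ on (carried c B (Set.Iic σ)) :=
      mem_mono (filter_mem hz _) (fun l hl => ⟨hl.1.1, le_of_eq hl.2⟩)
    have hz'm : z' ∈ on (carried c B K') :=
      mem_mono (filter_mem hz _) (fun l hl => ⟨hl.1.1, hl.1.2, hl.2⟩)
    have hdz' := (hB.carried hc hK').bd_mem hz'm
    have hdzσ := (hB.carried hc hIic).bd_mem hzσm
    set s := (bd zσ).filter (fun l => c l = σ) with hs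
    set u := (bd zσ).filter (fun l => ¬ c l = σ) with hu
    have hsu : s + u = bd zσ := Finsupp.filter_add_filter_not _ _
    -- A list with carrier `σ` does not occur in `bd z'`, so its coefficient in `bd zσ` is the one
    -- in `bd z`, which lies on `A`.
    have hsA : s ∈ on (carried c A (Set.Iic σ)) := by
      rw [on, Finsupp.mem_supported]
      intro l hl
      simp only [hs, Finsupp.support_filter, Finset.coe_filter, Set.mem_ofPred_eq] at hl
      refine ⟨?_, le_of_eq hl.2⟩
      by_contra hlA
      have h1 : (bd z) l = 0 := by
        by_contra h
        exact hlA (hdz (Finsupp.mem_support_iff.2 h))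
      have h2 : (bd z') l = 0 := by
        by_contra h
        exact (hdz' (Finsupp.mem_support_iff.2 h)).2.2 hl.2
      rw [← hzz, map_add, Finsupp.add_apply, h2, add_zero] at h1
      exact Finsupp.mem_support_iff.1 hl.1 h1
    have huB : u ∈ on (carried c B D) :=
      mem_mono (filter_mem hdzσ _) (fun l hl => ⟨hl.1.1, lt_of_le_of_ne hl.1.2 hl.2⟩)
    -- From `bd (bd zσ) = 0`, the part `u` over the boundary of `σ` is again a relative cycle.
    have hdu : bd u ∈ on A := by
      have : bd u = - bd s := by
        have h := bd_bd zσ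
        rw [← hsu, map_add] at h
        exact eq_neg_of_add_eq_zero_right h
      rw [this]
      exact Submodule.neg_mem _
        (mem_mono ((hA.carried hc hIic).bd_mem hsA) fun _ h => h.1)
    obtain ⟨w₁, hw₁, hw₁u⟩ := ih D (lt_of_le_of_lt hDK' hK'lt) hD hD0 huB hdu
    have hDIic : D ⊆ Set.Iic σ := fun x (hx : x < σ) => le_of_lt hx
    have hD_on : ∀ S : Set (List α), on (carried c S D) ≤ on (carried c S (Set.Iic σ)) :=
      fun S => on_mono fun l hl => ⟨hl.1, hDIic hl.2⟩
    have hs' : bd (zσ - w₁) ∈ on (carried c A (Set.Iic σ)) := by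
      have : bd (zσ - w₁) = s + (u - bd w₁) := by rw [map_sub, ← hsu]; abel
      rw [this]
      exact Submodule.add_mem _ hsA (hD_on A hw₁u)
    -- Acyclicity of `A` over `σ` completes `zσ - w₁` to a cycle, and acyclicity of `B` bounds that
    -- cycle. What remains, `w₁ + z'`, lives over `K'`.
    obtain ⟨t, ht, hdt⟩ := hAac σ hσne _ hs' (bd_bd _)
    have hAB_on : ∀ L : Set (Finset V), on (carried c A L) ≤ on (carried c B L) :=
      fun L => on_mono fun l hl => ⟨hAB hl.1, hl.2⟩
    obtain ⟨r, hr, hdr⟩ := hBac σ hσne (zσ - w₁ - t)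
      (Submodule.sub_mem _ (Submodule.sub_mem _ hzσm (hD_on B hw₁)) (hAB_on _ ht))
      (by rw [map_sub, hdt, sub_self])
    have hy : w₁ + z' ∈ on (carried c B K') :=
      Submodule.add_mem _ (mem_mono hw₁ (fun l hl => ⟨hl.1, hDK' hl.2⟩)) hz'm
    have hdy : bd (w₁ + z') ∈ on A := by
      have : bd (w₁ + z') = bd z - bd t := by rw [hdt, ← hzz]; simp only [map_sub, map_add]; abel
      rw [this]
      exact Submodule.sub_mem _ hdz
        (mem_mono ((hA.carried hc hIic).bd_mem ht) fun _ h => h.1)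
    obtain ⟨w₂, hw₂, hw₂y⟩ := ih K' hK'lt hK' hK'0 hy hdy
    have hσK : ∀ S : Set (List α), on (carried c S (Set.Iic σ)) ≤ on (carried c S K) :=
      fun S => on_mono fun l hl => ⟨hl.1, hK hl.2 hσ.1⟩
    have hK'K : ∀ S : Set (List α), on (carried c S K') ≤ on (carried c S K) :=
      fun S => on_mono fun l hl => ⟨hl.1, hl.2.1⟩
    refine ⟨r + w₂, Submodule.add_mem _ (hσK B hr) (hK'K B hw₂), ?_⟩
    have : z - bd (r + w₂) = t + (w₁ + z' - bd w₂) := by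
      rw [map_add, hdr, ← hzz]; abel
    rw [this]
    exact Submodule.add_mem _ (hσK A ht) (hK'K A hw₂y)

end Chain

end

/-! ### Acyclicity criteria; points, carriers and vertex lists. -/

section
namespace Chain

variable {α : Type*}

lemma acyclic_of_cons {S : Set (List α)} {x : α} (h : ∀ l ∈ S, x :: l ∈ S) : Acyclic S :=
  fun z hz hdz => ⟨cons x z, cons_mem h hz, by rw [bd_cons, hdz, map_zero, sub_zero]⟩

open scoped Classical in
/-- A closed set of lists is acyclic if `x` can be put in front of each list avoiding `x`, and `x`
only occurs at the front. -/
lemma acyclic_of_head {S : Set (List α)} {x : α}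
    (h : ∀ l ∈ S, x ∉ l → x :: l ∈ S) (h' : ∀ l ∈ S, x ∈ l → ∃ m, l = x :: m ∧ x ∉ m) :
    Acyclic S := by
  intro z hz hdz
  set z₁ := z.filter (fun l => x ∈ l)
  set z₂ := z.filter (fun l => ¬ x ∈ l)
  have hzz : z₁ + z₂ = z := Finsupp.filter_add_filter_not z _
  have hz₂ : z₂ ∈ on (S ∩ {l | ¬ x ∈ l}) := filter_mem hz _
  have hz₁ : z₁ ∈ on (List.cons x '' {l | x ∉ l}) :=
    mem_mono (filter_mem hz _) (by
      rintro l ⟨hl, hx⟩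
      obtain ⟨m, rfl, hm⟩ := h' l hl hx
      exact ⟨m, hm, rfl⟩)
  rw [on, ← Finsupp.lmapDomain_supported] at hz₁
  obtain ⟨y, hy, hyz⟩ := hz₁
  change cons x y = z₁ at hyz
  have hdz₂ : bd z₂ ∈ on {l : List α | x ∉ l} :=
    bd_mem (fun l hl l' hl' _ hx => hl.2 (hl'.subset hx)) hz₂
  set t := y + bd z₂
  have ht : t ∈ on {l : List α | x ∉ l} := Submodule.add_mem _ hy hdz₂
  -- Coning the part avoiding `x` leaves `cons x t`, where `t` avoids `x`. As this is a cycle, `t =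
  -- cons x (bd t)`, so every list in `t` would start with `x`; hence `t = 0`.
  have hzt : z - bd (cons x z₂) = cons x t := by
    rw [bd_cons, ← hzz, ← hyz, map_add]; abel
  have ht' : t = cons x (bd t) := by
    have : bd (cons x t) = 0 := by rw [← hzt, map_sub, hdz, bd_bd, sub_zero]
    rwa [bd_cons, sub_eq_zero] at this
  have ht'' : t ∈ on (List.cons x '' Set.univ) := by
    rw [ht', on, ← Finsupp.lmapDomain_supported]
    exact ⟨bd t, by simp, rfl⟩
  have ht0 : t = 0 := by
    by_contra hne
    obtain ⟨l, hl⟩ := Finsupp.support_nonempty_iff.2 hne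
    obtain ⟨m, -, rfl⟩ := ht'' hl
    exact ht hl (by simp)
  refine ⟨cons x z₂, cons_mem (fun l hl => h l hl.1 hl.2) hz₂, ?_⟩
  rw [ht0, map_zero, sub_eq_zero] at hzt
  exact hzt.symm

/-- Chain maps induced by consecutively homotopic maps are homologous on cycles. -/
lemma exists_map_sub_map {β : Type*} {S : Set (List α)} {T : Set (List β)} (f : ℕ → α → β) (n : ℕ)
    (h : ∀ i < n, ∀ l ∈ S, ∀ l' : List β,
      (∀ y ∈ l', y ∈ l.map (f i) ++ l.map (f (i + 1))) → l' ∈ T)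
    {z : Chain α} (hz : z ∈ on S) (hdz : bd z = 0) :
    ∃ w ∈ on T, bd w = map (f n) z - map (f 0) z := by
  induction n with
  | zero => exact ⟨0, zero_mem _, by simp⟩
  | succ n ih =>
    obtain ⟨w, hw, hdw⟩ := ih fun i hi => h i (by omega)
    refine ⟨w + prism (f n) (f (n + 1)) z, Submodule.add_mem _ hw
      (prism_mem (fun l hl l' hl' _ => h n (by omega) l hl l' hl') hz), ?_⟩
    rw [map_add, hdw, bd_prism, hdz, map_zero]
    abel

lemma map_id' (z : Chain α) : map id z = z := by
  have : map (id : α → α) = LinearMap.id := hom_ext fun l => by simp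
  rw [this]; rfl

lemma map_comp {β γ : Type*} (g : β → γ) (f : α → β) (z : Chain α) :
    map g (map f z) = map (g ∘ f) z := by
  have : map g ∘ₗ map f = map (g ∘ f) := hom_ext fun l => by simp
  exact LinearMap.congr_fun this z

end Chain

variable {V : Type*}

open scoped Classical in
/-- The vertex `v` of the standard simplex. -/
def vert (v : V) : V → ℝ := Pi.single v 1

lemma vert_self (v : V) : vert v v = 1 := by simp [vert]

lemma vert_of_ne {v w : V} (h : w ≠ v) : vert v w = 0 := by simp [vert, h]

variable [Fintype V]

open scoped Classical in
/-- The support of a point. -/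
def supp (x : V → ℝ) : Finset V := Finset.univ.filter fun v => x v ≠ 0

@[simp] lemma mem_supp {x : V → ℝ} {v : V} : v ∈ supp x ↔ x v ≠ 0 := by simp [supp]

lemma notMem_supp {x : V → ℝ} {v : V} : v ∉ supp x ↔ x v = 0 := by simp

/-- The geometric realization of a set of faces. -/
def geom (K : Set (Finset V)) : Set (V → ℝ) := {x | x ∈ stdSimplex ℝ V ∧ supp x ∈ K}

open scoped Classical in
/-- The vertex set of the smallest simplex containing a list of points. -/
def carrier (l : List (V → ℝ)) : Finset V := Finset.univ.filter fun v => ∃ x ∈ l, x v ≠ 0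

@[simp] lemma mem_carrier {l : List (V → ℝ)} {v : V} : v ∈ carrier l ↔ ∃ x ∈ l, x v ≠ 0 := by
  simp [carrier]

lemma carrier_mono {l l' : List (V → ℝ)} (h : ∀ x ∈ l', x ∈ l) : carrier l' ⊆ carrier l := by
  intro v hv
  obtain ⟨x, hx, hxv⟩ := mem_carrier.1 hv
  exact mem_carrier.2 ⟨x, h x hx, hxv⟩

lemma carrier_sublist (l l' : List (V → ℝ)) (h : l'.Sublist l) : carrier l' ⊆ carrier l :=
  carrier_mono fun _ hx => h.subset hx

lemma carrier_subset_iff {l : List (V → ℝ)} {σ : Finset V} :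
    carrier l ⊆ σ ↔ ∀ x ∈ l, supp x ⊆ σ := by
  constructor
  · intro h x hx v hv
    exact h (mem_carrier.2 ⟨x, hx, mem_supp.1 hv⟩)
  · intro h v hv
    obtain ⟨x, hx, hxv⟩ := mem_carrier.1 hv
    exact h x hx (mem_supp.2 hxv)

lemma supp_nonempty {x : V → ℝ} (hx : x ∈ stdSimplex ℝ V) : (supp x).Nonempty := by
  by_contra h
  rw [Finset.not_nonempty_iff_eq_empty] at h
  have : ∑ v, x v = 0 := Finset.sum_eq_zero fun v _ => by
    rw [← notMem_supp, h]; simp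
  rw [hx.2] at this
  exact one_ne_zero this

/-- Lists of points of the standard simplex. -/
def pointLists (V : Type*) [Fintype V] : Set (List (V → ℝ)) := {l | ∀ x ∈ l, x ∈ stdSimplex ℝ V}

/-- Lists of points of the standard simplex at pairwise distance less than `ε`. -/
def smallLists (V : Type*) [Fintype V] (ε : ℝ) : Set (List (V → ℝ)) :=
  {l | l ∈ pointLists V ∧ ∀ x ∈ l, ∀ y ∈ l, dist x y < ε}

lemma supp_vert (v : V) : supp (vert v) = {v} := by
  ext w
  by_cases h : w = v
  · subst h; simp [vert_self]
  · simp [vert_of_ne h, h]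

lemma vert_injective : Function.Injective (vert : V → V → ℝ) := fun v w h => by
  have := congrArg supp h
  simpa [supp_vert] using this

lemma vert_mem_stdSimplex (v : V) : vert v ∈ stdSimplex ℝ V := by
  classical
  unfold vert
  exact single_mem_stdSimplex ℝ v

/-- Increasing lists of vertices of the standard simplex. -/
def vertexLists (V : Type*) [Fintype V] [LinearOrder V] : Set (List (V → ℝ)) :=
  {l | ∃ m : List V, m.Pairwise (· < ·) ∧ l = m.map vert}

lemma closed_pointLists : Chain.Closed (pointLists V) :=
  fun _ hl _ h x hx => hl x (h.subset hx)

lemma closed_smallLists (ε : ℝ) : Chain.Closed (smallLists V ε) :=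
  fun l hl l' h => ⟨closed_pointLists l hl.1 l' h,
    fun x hx y hy => hl.2 x (h.subset hx) y (h.subset hy)⟩

lemma closed_vertexLists [LinearOrder V] : Chain.Closed (vertexLists V) := by
  rintro _ ⟨m, hm, rfl⟩ l' h
  obtain ⟨m', hm', rfl⟩ := List.sublist_map_iff.1 h
  exact ⟨m', hm.sublist hm', rfl⟩

lemma mem_carrier_map_vert {m : List V} {w : V} : w ∈ carrier (m.map vert) ↔ w ∈ m := by
  simp only [mem_carrier, List.mem_map, exists_exists_and_eq_and]
  constructor
  · rintro ⟨v, hv, h⟩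
    rw [← mem_supp, supp_vert, Finset.mem_singleton] at h
    exact h ▸ hv
  · exact fun h => ⟨w, h, by simp [vert_self]⟩

lemma vertexLists_subset [LinearOrder V] : vertexLists V ⊆ pointLists V := by
  rintro _ ⟨m, -, rfl⟩ x hx
  obtain ⟨v, -, rfl⟩ := List.mem_map.1 hx
  exact vert_mem_stdSimplex v

lemma eq_nil_of_carrier {l : List (V → ℝ)} (hl : l ∈ pointLists V) (h : carrier l = ∅) :
    l = [] := by
  cases l with
  | nil => rfl
  | cons x l =>
    obtain ⟨v, hv⟩ := supp_nonempty (hl x (by simp))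
    have : v ∈ carrier (x :: l) := mem_carrier.2 ⟨x, by simp, mem_supp.1 hv⟩
    simp [h] at this

/-- Repetitions and all orders are allowed, so any vertex of `σ` is a cone point. -/
lemma acyclic_pointLists {σ : Finset V} (hσ : σ.Nonempty) :
    Chain.Acyclic (Chain.carried carrier (pointLists V) (Set.Iic σ)) := by
  obtain ⟨v, hv⟩ := hσ
  refine Chain.acyclic_of_cons (x := vert v) fun l hl => ⟨?_, ?_⟩
  · intro x hx
    rcases List.mem_cons.1 hx with rfl | hx
    · exact vert_mem_stdSimplex v
    · exact hl.1 x hx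
  · refine carrier_subset_iff.2 fun x hx => ?_
    rcases List.mem_cons.1 hx with rfl | hx
    · rw [supp_vert]; simpa using hv
    · exact carrier_subset_iff.1 hl.2 x hx

/-- The smallest vertex of `σ` can be put in front of an increasing list exactly when it is absent
from it. -/
lemma acyclic_vertexLists [LinearOrder V] {σ : Finset V} (hσ : σ.Nonempty) :
    Chain.Acyclic (Chain.carried carrier (vertexLists V) (Set.Iic σ)) := by
  refine Chain.acyclic_of_head (x := vert (σ.min' hσ)) ?_ ?_
  · rintro _ ⟨⟨m, hm, rfl⟩, hσ'⟩ hx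
    have hmσ : ∀ v ∈ m, v ∈ σ := fun v hv => by
      have : v ∈ carrier (m.map vert) := by
        exact mem_carrier_map_vert.2 hv
      exact hσ' this
    refine ⟨⟨σ.min' hσ :: m, List.pairwise_cons.2 ⟨fun v hv => ?_, hm⟩, rfl⟩, ?_⟩
    · refine lt_of_le_of_ne (σ.min'_le v (hmσ v hv)) ?_
      rintro h
      exact hx (List.mem_map.2 ⟨v, hv, by rw [h]⟩)
    · refine carrier_subset_iff.2 fun x hx => ?_
      rcases List.mem_cons.1 hx with rfl | hx
      · rw [supp_vert]; simpa using σ.min'_mem hσ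
      · exact carrier_subset_iff.1 hσ' x hx
  · rintro _ ⟨⟨m, hm, rfl⟩, hσ'⟩ hx
    obtain ⟨v, hv, hvx⟩ := List.mem_map.1 hx
    have hmσ : ∀ v ∈ m, v ∈ σ := fun v hv => by
      have : v ∈ carrier (m.map vert) := by
        exact mem_carrier_map_vert.2 hv
      exact hσ' this
    have hv' : v = σ.min' hσ := vert_injective hvx
    cases m with
    | nil => simp at hv
    | cons w m =>
      have hw : w = v := by
        rcases List.mem_cons.1 hv with h | h
        · exact h.symm
        · exact absurd (σ.min'_le w (hmσ w (by simp)))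
            (not_le.2 (hv' ▸ (List.pairwise_cons.1 hm).1 v h))
      refine ⟨m.map vert, by simp [hw, hv'], fun h => ?_⟩
      obtain ⟨u, hu, hux⟩ := List.mem_map.1 h
      have hu' : u = σ.min' hσ := vert_injective hux
      have := (List.pairwise_cons.1 hm).1 u hu
      rw [hw, hv', hu'] at this
      exact lt_irrefl _ this

end

/-! ### Acyclicity of the lists of small diameter. -/

section

variable {V : Type*} [Fintype V]

lemma dist_le_one_of_mem_stdSimplex {x y : V → ℝ} (hx : x ∈ stdSimplex ℝ V)
    (hy : y ∈ stdSimplex ℝ V) : dist x y ≤ 1 := by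
  refine (dist_pi_le_iff zero_le_one).2 fun v => ?_
  have h1 := mem_Icc_of_mem_stdSimplex hx v
  have h2 := mem_Icc_of_mem_stdSimplex hy v
  rw [Real.dist_eq, abs_le]
  constructor <;> linarith [h1.1, h1.2, h2.1, h2.2]

lemma lineMap_mem_stdSimplex {x y : V → ℝ} (hx : x ∈ stdSimplex ℝ V)
    (hy : y ∈ stdSimplex ℝ V) {t : ℝ} (ht : t ∈ Set.Icc (0 : ℝ) 1) :
    AffineMap.lineMap x y t ∈ stdSimplex ℝ V :=
  (convex_stdSimplex ℝ V).lineMap_mem hx hy ht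

lemma supp_lineMap_subset {x y : V → ℝ} {σ : Finset V} (hx : supp x ⊆ σ) (hy : supp y ⊆ σ)
    (t : ℝ) : supp (AffineMap.lineMap x y t) ⊆ σ := by
  intro v hv
  by_contra h
  have h1 : x v = 0 := notMem_supp.1 fun h' => h (hx h')
  have h2 : y v = 0 := notMem_supp.1 fun h' => h (hy h')
  simp [AffineMap.lineMap_apply, h1, h2] at hv

lemma dist_lineMap_le {x y c : V → ℝ} {s t : ℝ} (hs : s ∈ Set.Icc (0 : ℝ) 1) :
    dist (AffineMap.lineMap x c s) (AffineMap.lineMap y c t) ≤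
      dist x y + |s - t| * dist y c := by
  refine (dist_triangle _ (AffineMap.lineMap y c s) _).trans (add_le_add ?_ ?_)
  · have : dist (AffineMap.lineMap x c s) (AffineMap.lineMap y c s) ≤ (1 - s) * dist x y := by
      rw [dist_eq_norm, dist_eq_norm]
      have : AffineMap.lineMap x c s - AffineMap.lineMap y c s = (1 - s) • (x - y) := by
        ext v; simp [AffineMap.lineMap_apply]; ring
      rw [this, norm_smul, Real.norm_of_nonneg (by linarith [hs.2])]
    refine this.trans ?_
    nlinarith [hs.1, hs.2, dist_nonneg (x := x) (y := y)]
  · rw [dist_lineMap_lineMap, Real.dist_eq]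

/-- A chain has finite support, so strict smallness leaves a uniform margin; the steps of the
contraction below use it up. -/
lemma exists_uniform_lt {ε : ℝ} (hε : 0 < ε) (F : Finset (List (V → ℝ)))
    (hF : ∀ l ∈ F, ∀ x ∈ l, ∀ y ∈ l, dist x y < ε) :
    ∃ ε' : ℝ, ε' < ε ∧ ∀ l ∈ F, ∀ x ∈ l, ∀ y ∈ l, dist x y ≤ ε' := by
  classical
  set D : Finset ℝ := insert 0 (F.biUnion fun l => (l.toFinset ×ˢ l.toFinset).image
    fun p => dist p.1 p.2)
  refine ⟨D.max' (Finset.insert_nonempty _ _), ?_, ?_⟩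
  · rw [Finset.max'_lt_iff]
    intro y hy
    simp only [D, Finset.mem_insert, Finset.mem_biUnion, Finset.mem_image, Finset.mem_product,
      List.mem_toFinset] at hy
    rcases hy with rfl | ⟨l, hl, p, hp, rfl⟩
    · exact hε
    · exact hF l hl _ hp.1 _ hp.2
  · intro l hl x hx y hy
    refine Finset.le_max' _ _ ?_
    simp only [D, Finset.mem_insert, Finset.mem_biUnion, Finset.mem_image, Finset.mem_product,
      List.mem_toFinset]
    exact Or.inr ⟨l, hl, (x, y), ⟨hx, hy⟩, rfl⟩

/-- A cone over a small list need not be small. Instead the cycle is moved linearly to a vertex of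
`σ` in steps so short that the prisms are small; once all points coincide with the vertex, the cone
is small too. -/
lemma acyclic_smallLists {ε : ℝ} (hε : 0 < ε) {σ : Finset V} (hσ : σ.Nonempty) :
    Chain.Acyclic (Chain.carried carrier (smallLists V ε) (Set.Iic σ)) := by
  intro z hz hdz
  obtain ⟨v, hv⟩ := hσ
  set c : V → ℝ := vert v with hc
  have hcm : c ∈ stdSimplex ℝ V := vert_mem_stdSimplex v
  have hcσ : supp c ⊆ σ := by rw [hc, supp_vert]; simpa using hv
  obtain ⟨ε', hε', hzε'⟩ := exists_uniform_lt hε z.support fun l hl => (hz hl).1.2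
  -- Points of the simplex are at distance at most `1`, so each of `N` equal steps moves a point by
  -- at most `1 / N`, less than the margin `ε - ε'`.
  obtain ⟨N, hN⟩ := exists_nat_gt (1 / (ε - ε'))
  have hεε : 0 < ε - ε' := by linarith
  have hN0 : (0 : ℝ) < N := lt_trans (by positivity) hN
  have hN1 : 1 / (N : ℝ) < ε - ε' := by
    rw [div_lt_iff₀ hN0]
    rw [div_lt_iff₀ hεε] at hN
    linarith
  set h : ℕ → (V → ℝ) → (V → ℝ) := fun i x => AffineMap.lineMap x c ((i : ℝ) / N) with hh
  have hIcc : ∀ i ≤ N, (i : ℝ) / N ∈ Set.Icc (0 : ℝ) 1 := fun i hi =>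
    ⟨by positivity, by rw [div_le_one hN0]; exact_mod_cast hi⟩
  set S : Set (List (V → ℝ)) := ↑z.support
  have hzS : z ∈ Chain.on S := by simp [S, Finsupp.mem_supported]
  have hclose : ∀ i ≤ N, ∀ j ≤ N, |(i : ℝ) / N - j / N| ≤ 1 / N → ∀ l ∈ S, ∀ x ∈ l, ∀ y ∈ l,
      dist (h i x) (h j y) < ε := by
    intro i hi j hj hij l hl x hx y hy
    refine (dist_lineMap_le (hIcc i hi)).trans_lt ?_
    have h1 := hzε' l hl x hx y hy
    have h2 := dist_le_one_of_mem_stdSimplex ((hz hl).1.1 y hy) hcm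
    have h3 := abs_nonneg ((i : ℝ) / N - j / N)
    nlinarith [dist_nonneg (x := y) (y := c)]
  obtain ⟨w, hw, hdw⟩ := Chain.exists_map_sub_map (S := S)
    (T := Chain.carried carrier (smallLists V ε) (Set.Iic σ)) h N (by
      intro i hi l hl l' hl'
      have key : ∀ y ∈ l', ∃ j ∈ ({i, i + 1} : Set ℕ), ∃ x ∈ l, h j x = y := by
        intro y hy
        rcases List.mem_append.1 (hl' y hy) with hy | hy
        · obtain ⟨x, hx, rfl⟩ := List.mem_map.1 hy
          exact ⟨i, by simp, x, hx, rfl⟩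
        · obtain ⟨x, hx, rfl⟩ := List.mem_map.1 hy
          exact ⟨i + 1, by simp, x, hx, rfl⟩
      have hle : ∀ j ∈ ({i, i + 1} : Set ℕ), j ≤ N := by
        rintro j (rfl | rfl) <;> omega
      have hdiff : ∀ j ∈ ({i, i + 1} : Set ℕ), ∀ k ∈ ({i, i + 1} : Set ℕ),
          |(j : ℝ) / N - k / N| ≤ 1 / N := by
        intro j hj k hk
        rw [← sub_div, abs_div, abs_of_pos hN0]
        gcongr
        rcases hj with rfl | rfl <;> rcases hk with rfl | rfl <;> simp
      refine ⟨⟨?_, ?_⟩, ?_⟩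
      · intro y hy
        obtain ⟨j, hj, x, hx, rfl⟩ := key y hy
        exact lineMap_mem_stdSimplex ((hz hl).1.1 x hx) hcm (hIcc j (hle j hj))
      · intro y hy y' hy'
        obtain ⟨j, hj, x, hx, rfl⟩ := key y hy
        obtain ⟨k, hk, x', hx', rfl⟩ := key y' hy'
        exact hclose j (hle j hj) k (hle k hk) (hdiff j hj k hk) l hl x hx x' hx'
      · refine carrier_subset_iff.2 fun y hy => ?_
        obtain ⟨j, hj, x, hx, rfl⟩ := key y hy
        exact supp_lineMap_subset (carrier_subset_iff.1 (hz hl).2 x hx) hcσ _) hzS hdz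
  have h0 : Chain.map (h 0) z = z := by
    have : h 0 = id := by funext x; simp [hh]
    rw [this, Chain.map_id']
  have hNc : h N = fun _ => c := by
    funext x; simp [hh, hN0.ne']
  have hmem : Chain.cons c (Chain.map (h N) z) ∈
      Chain.on (Chain.carried carrier (smallLists V ε) (Set.Iic σ)) := by
    have : Chain.map (h N) z ∈ Chain.on {l : List (V → ℝ) | ∀ x ∈ l, x = c} := by
      refine Chain.map_mem (S := S) (fun l _ => ?_) hzS
      intro x hx
      rw [hNc] at hx
      obtain ⟨_, _, rfl⟩ := List.mem_map.1 hx
      rfl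
    refine Chain.cons_mem (fun l hl => ?_) this
    have hl' : ∀ x ∈ c :: l, x = c := by
      intro x hx
      rcases List.mem_cons.1 hx with rfl | hx
      · rfl
      · exact hl x hx
    refine ⟨⟨fun x hx => hl' x hx ▸ hcm, fun x hx y hy => ?_⟩,
      carrier_subset_iff.2 fun x hx => hl' x hx ▸ hcσ⟩
    rw [hl' x hx, hl' y hy, dist_self]
    exact hε
  refine ⟨Chain.cons c (Chain.map (h N) z) - w, Submodule.sub_mem _ hmem hw, ?_⟩
  rw [map_sub, Chain.bd_cons, Chain.bd_map, hdz, map_zero, map_zero, hdw, h0]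
  abel

end

/-! ### Homology graded by parity, and its Euler characteristic. -/

section
namespace Chain

variable {α β : Type*}

/-- The lists whose length has the given parity. -/
def ofParity (p : ZMod 2) : Set (List α) := {l | (l.length : ZMod 2) = p}

lemma mem_ofParity {p : ZMod 2} {l : List α} : l ∈ ofParity p ↔ (l.length : ZMod 2) = p := Iff.rfl

/-- The projection of chains to the part of a given parity. -/
def parityProj (p : ZMod 2) : Chain α →ₗ[ℚ] Chain α :=
  Finsupp.linearCombination ℚ fun l : List α =>
    if (l.length : ZMod 2) = p then Finsupp.single l (1 : ℚ) else 0

lemma parityProj_single (p : ZMod 2) (l : List α) : parityProj p (Finsupp.single l 1) =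
    if (l.length : ZMod 2) = p then Finsupp.single l (1 : ℚ) else 0 := by
  simp [parityProj]

lemma parityProj_of_mem {p : ZMod 2} {z : Chain α} (hz : z ∈ on (ofParity p)) :
    parityProj p z = z := by
  have h := apply_mem_of_list (N := ⊥) (parityProj p - LinearMap.id) (fun l hl => by
    rw [Submodule.mem_bot, LinearMap.sub_apply, parityProj_single, if_pos (mem_ofParity.1 hl),
      LinearMap.id_apply, sub_self]) hz
  rw [Submodule.mem_bot, LinearMap.sub_apply, sub_eq_zero] at h
  exact h

lemma parityProj_of_mem_of_ne {p q : ZMod 2} (hpq : q ≠ p) {z : Chain α}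
    (hz : z ∈ on (ofParity q)) : parityProj p z = 0 := by
  have h := apply_mem_of_list (N := ⊥) (parityProj p) (fun l hl => by
    rw [Submodule.mem_bot, parityProj_single, if_neg]
    rw [mem_ofParity.1 hl]
    exact hpq) hz
  exact (Submodule.mem_bot ℚ).1 h

lemma parityProj_mem {S : Set (List α)} (p : ZMod 2) {z : Chain α} (hz : z ∈ on S) :
    parityProj p z ∈ on (S ∩ ofParity p) :=
  apply_mem_of_list _ (fun l hl => by
    rw [parityProj_single]
    split_ifs with h
    · exact single_mem_on (S := S ∩ ofParity p) ⟨hl, h⟩ 1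
    · exact zero_mem _) hz

lemma bd_mem_ofParity {S T : Set (List α)} {p : ZMod 2} {z : Chain α}
    (h : ∀ l ∈ S, ∀ l' : List α, l'.Sublist l → l' ∈ T)
    (hz : z ∈ on (S ∩ ofParity (p + 1))) : bd z ∈ on (T ∩ ofParity p) :=
  bd_mem (T := T ∩ ofParity p) (fun l hl l' hl' hlen => ⟨h l hl.1 l' hl', by
    have := mem_ofParity.1 hl.2
    rw [← hlen, Nat.cast_succ] at this
    exact add_right_cancel this⟩) hz

lemma parityProj_bd (p : ZMod 2) (z : Chain α) :
    parityProj p (bd z) = bd (parityProj (p + 1) z) := by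
  have : parityProj p ∘ₗ bd = bd ∘ₗ (parityProj (p + 1) : Chain α →ₗ[ℚ] Chain α) :=
    hom_ext fun l => by
      have hl : Finsupp.single l (1 : ℚ) ∈
          on (Set.univ ∩ ofParity ((l.length : ZMod 2) - 1 + 1)) :=
        single_mem_on (S := Set.univ ∩ ofParity _) ⟨trivial, by simp [mem_ofParity]⟩ 1
      have h := bd_mem_ofParity (T := Set.univ) (fun _ _ _ _ => trivial) hl
      have h' := mem_mono h fun _ h => h.2
      simp only [LinearMap.comp_apply, parityProj_single]
      split_ifs with hp
      · rw [hp, add_sub_cancel_right] at h'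
        exact parityProj_of_mem h'
      · rw [map_zero]
        exact parityProj_of_mem_of_ne (fun h => hp (by rw [← h, sub_add_cancel])) h'
  exact LinearMap.congr_fun this z

/-- The cycles on `S` of a given parity. -/
def cycles (S : Set (List α)) (p : ZMod 2) : Submodule ℚ (Chain α) :=
  on (S ∩ ofParity p) ⊓ LinearMap.ker bd

/-- The boundaries on `S` of a given parity. -/
def bounds (S : Set (List α)) (p : ZMod 2) : Submodule ℚ (Chain α) :=
  (on (S ∩ ofParity (p + 1))).map bd

lemma bounds_le_cycles {S : Set (List α)} (hS : Closed S) (p : ZMod 2) :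
    bounds S p ≤ cycles S p := by
  rintro _ ⟨w, hw, rfl⟩
  exact ⟨bd_mem_ofParity hS hw, bd_bd w⟩

/-- A cycle that bounds without control of parity bounds with the right parity. -/
lemma mem_bounds_of_bd {S : Set (List α)} {p : ZMod 2} {z w : Chain α}
    (hz : z ∈ on (ofParity p)) (hw : w ∈ on S) (h : bd w = z) : z ∈ bounds S p := by
  refine ⟨parityProj (p + 1) w, parityProj_mem _ hw, ?_⟩
  rw [← parityProj_bd, h, parityProj_of_mem hz]

/-- The homology of a set of lists, graded by parity. -/
abbrev Homology (S : Set (List α)) (p : ZMod 2) :=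
  cycles S p ⧸ (bounds S p).submoduleOf (cycles S p)

/-- A linear map compatible with cycles and boundaries induces a map on homology, which is injective
if only boundaries go to boundaries. -/
lemma exists_injective_homology {S : Set (List α)} {T : Set (List β)} {p : ZMod 2}
    (φ : Chain α →ₗ[ℚ] Chain β) (h1 : ∀ z ∈ cycles S p, φ z ∈ cycles T p)
    (h2 : ∀ z ∈ bounds S p, φ z ∈ bounds T p)
    (h3 : ∀ z ∈ cycles S p, φ z ∈ bounds T p → z ∈ bounds S p) :
    ∃ f : Homology S p →ₗ[ℚ] Homology T p, Function.Injective f ∧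
      ∀ z : cycles S p, f (Submodule.Quotient.mk z) =
        Submodule.Quotient.mk ⟨φ z, h1 z z.2⟩ := by
  refine ⟨Submodule.mapQ _ _ (φ.restrict h1) ?_, ?_, fun z => rfl⟩
  · rintro ⟨z, hz⟩ hzb
    exact h2 z hzb
  · rw [← LinearMap.ker_eq_bot, LinearMap.ker_eq_bot']
    intro x hx
    obtain ⟨z, rfl⟩ := Submodule.Quotient.mk_surjective _ x
    rw [Submodule.mapQ_apply, Submodule.Quotient.mk_eq_zero] at hx
    rw [Submodule.Quotient.mk_eq_zero]
    exact h3 z z.2 hx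

/-- If relative cycles are trivial modulo boundaries, the inclusion is an isomorphism on
homology. -/
lemma nonempty_homology_equiv {A B : Set (List α)} (hAB : A ⊆ B)
    (h : ∀ z ∈ on B, bd z ∈ on A → ∃ w ∈ on B, z - bd w ∈ on A) (p : ZMod 2) :
    Nonempty (Homology A p ≃ₗ[ℚ] Homology B p) := by
  obtain ⟨f, hf, hfz⟩ := exists_injective_homology (S := A) (T := B) (p := p) LinearMap.id
    (fun z hz => ⟨mem_mono hz.1 fun l hl => ⟨hAB hl.1, hl.2⟩, hz.2⟩)
    (fun z ⟨w, hw, hwz⟩ => ⟨w, mem_mono hw fun l hl => ⟨hAB hl.1, hl.2⟩, hwz⟩)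
    (fun z hz ⟨w, hw, hwz⟩ => by
      -- Injectivity: a chain on `B` bounding a cycle on `A` is a relative cycle, so subtracting a
      -- boundary moves it to `A` without changing its own boundary.
      have hwB : w ∈ on B := mem_mono hw fun l hl => hl.1
      have hwz' : bd w = z := hwz
      obtain ⟨w', hw', hww'⟩ := h w hwB (hwz' ▸ mem_mono hz.1 fun l hl => hl.1)
      exact mem_bounds_of_bd (mem_mono hz.1 fun l hl => hl.2) hww'
        (by rw [map_sub, bd_bd, sub_zero, hwz']))
  refine ⟨LinearEquiv.ofBijective f ⟨hf, fun y => ?_⟩⟩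
  obtain ⟨z, rfl⟩ := Submodule.Quotient.mk_surjective _ y
  have hzB : (z : Chain α) ∈ on B := mem_mono z.2.1 fun l hl => hl.1
  have hz0 : bd (z : Chain α) = 0 := z.2.2
  obtain ⟨w, hw, hzw⟩ := h z hzB (by rw [hz0]; exact zero_mem _)
  have hzp : parityProj p (z : Chain α) = z :=
    parityProj_of_mem (mem_mono z.2.1 fun l hl => hl.2)
  have hx : parityProj p ((z : Chain α) - bd w) ∈ cycles A p := by
    refine ⟨parityProj_mem p hzw, ?_⟩
    have : bd (parityProj p ((z : Chain α) - bd w)) = 0 := by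
      rw [map_sub, hzp, parityProj_bd, map_sub, hz0, bd_bd, sub_zero]
    exact this
  refine ⟨Submodule.Quotient.mk ⟨_, hx⟩, ?_⟩
  rw [hfz, Submodule.Quotient.eq]
  refine ⟨parityProj (p + 1) (-w), parityProj_mem _ (Submodule.neg_mem _ hw), ?_⟩
  simp only [LinearMap.id_apply, Submodule.subtype_apply, map_sub, map_neg, hzp,
    parityProj_bd]
  abel

lemma map_mem_cycles {f : α → β} {S : Set (List α)} {T : Set (List β)}
    (h : ∀ l ∈ S, l.map f ∈ T) {p : ZMod 2} {z : Chain α} (hz : z ∈ cycles S p) :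
    map f z ∈ cycles T p := by
  refine ⟨map_mem (T := T ∩ ofParity p) (fun l hl => ⟨h l hl.1, ?_⟩) hz.1, ?_⟩
  · rw [mem_ofParity, List.length_map]; exact hl.2
  · have h0 : bd z = 0 := hz.2
    have : bd (map f z) = 0 := by rw [bd_map, h0, map_zero]
    exact this

lemma map_mem_bounds {f : α → β} {S : Set (List α)} {T : Set (List β)}
    (h : ∀ l ∈ S, l.map f ∈ T) {p : ZMod 2} {z : Chain α} (hz : z ∈ bounds S p) :
    map f z ∈ bounds T p := by
  obtain ⟨w, hw, rfl⟩ := hz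
  refine ⟨map f w, map_mem (T := T ∩ ofParity (p + 1)) (fun l hl => ⟨h l hl.1, ?_⟩) hw,
    bd_map f w⟩
  rw [mem_ofParity, List.length_map]; exact hl.2

/-- Dimension count for the finite complex of a finite closed set of lists. -/
lemma finrank_homology_sub {S : Set (List α)} (hS : Closed S) (hfin : S.Finite) :
    (∀ p, FiniteDimensional ℚ (Homology S p)) ∧
    (Module.finrank ℚ (Homology S 0) : ℤ) - Module.finrank ℚ (Homology S 1) =
      (S ∩ ofParity 0).ncard - (S ∩ ofParity 1).ncard := by
  have hfinp : ∀ p, (S ∩ ofParity p).Finite := fun p => hfin.subset Set.inter_subset_left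
  have hdim : ∀ p, FiniteDimensional ℚ (on (S ∩ ofParity p)) := fun p => by
    have := (hfinp p).to_subtype
    exact Module.Finite.equiv (Finsupp.supportedEquivFinsupp (S ∩ ofParity p)).symm
  have hcard : ∀ p, Module.finrank ℚ (on (S ∩ ofParity p)) = (S ∩ ofParity p).ncard := fun p => by
    have := (hfinp p).fintype
    rw [(Finsupp.supportedEquivFinsupp (S ∩ ofParity p)).finrank_eq, Module.finrank_finsupp_self,
      Set.ncard_eq_toFinset_card', Set.toFinset_card]
  have hc : ∀ p, FiniteDimensional ℚ (cycles S p) := fun p =>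
    Submodule.finiteDimensional_of_le (inf_le_left : cycles S p ≤ on (S ∩ ofParity p))
  have hH : ∀ p, FiniteDimensional ℚ (Homology S p) := fun p => inferInstance
  refine ⟨hH, ?_⟩
  -- Rank–nullity in a complex of period two: the dimensions of the boundaries cancel in the
  -- difference of the two parities, which is all that an Euler characteristic needs.
  have h1 : ∀ p, Module.finrank ℚ (Homology S p) + Module.finrank ℚ (bounds S p) =
      Module.finrank ℚ (cycles S p) := fun p => by
    rw [← Submodule.finrank_quotient_add_finrank ((bounds S p).submoduleOf (cycles S p)),
      (Submodule.submoduleOfEquivOfLe (bounds_le_cycles hS p)).finrank_eq]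
  have h2 : ∀ p, Module.finrank ℚ (bounds S p) + Module.finrank ℚ (cycles S (p + 1)) =
      (S ∩ ofParity (p + 1)).ncard := fun p => by
    rw [← hcard, ← LinearMap.finrank_range_add_finrank_ker
      ((bd : Chain α →ₗ[ℚ] Chain α).domRestrict (on (S ∩ ofParity (p + 1))))]
    congr 1
    · rw [LinearMap.range_domRestrict]; rfl
    · rw [LinearMap.ker_domRestrict]
      have : cycles S (p + 1) =
          ((LinearMap.ker bd).submoduleOf (on (S ∩ ofParity (p + 1)))).map
            (on (S ∩ ofParity (p + 1))).subtype := by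
        rw [Submodule.submoduleOf, Submodule.map_comap_subtype]; rfl
      rw [this, Submodule.finrank_map_subtype_eq]
      rfl
  have e0 := h1 0
  have e1 := h1 1
  have e2 := h2 0
  have e3 := h2 1
  have h11 : (1 + 1 : ZMod 2) = 0 := rfl
  rw [zero_add] at e2
  rw [h11] at e3
  omega

end Chain

end

/-! ### Homotopy invariance of the homology of realizations. -/

section

variable {V W : Type*} [Fintype V] [Fintype W]

/-- Push a point of the standard simplex away from the faces it is close to, by cutting its
coordinates off below `η` and normalizing. -/
def shrink (η : ℝ) (x : V → ℝ) : V → ℝ :=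
  fun v => max (x v - η) 0 / ∑ w, max (x w - η) 0

lemma le_sum_shrink {η : ℝ} {x : V → ℝ} (hx : x ∈ stdSimplex ℝ V) :
    1 - Fintype.card V * η ≤ ∑ w, max (x w - η) 0 := by
  have : ∑ w, (x w - η) ≤ ∑ w, max (x w - η) 0 := Finset.sum_le_sum fun w _ => le_max_left _ _
  rw [Finset.sum_sub_distrib, hx.2] at this
  simpa using this

lemma sum_shrink_le {η : ℝ} (hη : 0 ≤ η) {x : V → ℝ} (hx : x ∈ stdSimplex ℝ V) :
    ∑ w, max (x w - η) 0 ≤ 1 := by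
  rw [← hx.2]
  exact Finset.sum_le_sum fun w _ => max_le (by linarith) (hx.1 w)

lemma shrink_mem {η : ℝ} (hη : Fintype.card V * η < 1) {x : V → ℝ} (hx : x ∈ stdSimplex ℝ V) :
    shrink η x ∈ stdSimplex ℝ V := by
  have h := le_sum_shrink (η := η) hx
  have hpos : 0 < ∑ w, max (x w - η) 0 := by linarith
  refine ⟨fun v => div_nonneg (le_max_right _ _) hpos.le, ?_⟩
  simp only [shrink]
  rw [← Finset.sum_div, div_self hpos.ne']

lemma lt_of_shrink_ne_zero {η : ℝ} {x : V → ℝ} {v : V} (h : shrink η x v ≠ 0) : η < x v := by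
  by_contra hle
  apply h
  rw [shrink, max_eq_right (by linarith), zero_div]

/-- A coordinate of `y` surviving the cut exceeds `η`, so it is nonzero at every point within `η`.
This plays the role of simplicial approximation: after shrinking, close points share a simplex. -/
lemma supp_shrink_subset {η : ℝ} {x y : V → ℝ} (h : dist x y ≤ η) :
    supp (shrink η y) ⊆ supp x := by
  intro v hv
  have h1 := lt_of_shrink_ne_zero (mem_supp.1 hv)
  have h2 := (dist_le_pi_dist x y v).trans h
  rw [Real.dist_eq, abs_le] at h2
  exact mem_supp.2 (by linarith [h2.1] : (0 : ℝ) < x v).ne'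

lemma dist_shrink_le {η : ℝ} (hη : 0 ≤ η) (hη' : Fintype.card V * η < 1) {x : V → ℝ}
    (hx : x ∈ stdSimplex ℝ V) : dist (shrink η x) x ≤ (Fintype.card V + 1) * η := by
  have h1 := le_sum_shrink (η := η) hx
  have h2 := sum_shrink_le hη hx
  refine (dist_pi_le_iff (by positivity)).2 fun v => ?_
  have h3 := mem_Icc_of_mem_stdSimplex (shrink_mem hη' hx) v
  set s := ∑ w, max (x w - η) 0 with hs
  have hpos : 0 < s := by linarith
  have h4 : shrink η x v * s = max (x v - η) 0 := div_mul_cancel₀ _ hpos.ne'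
  have h5 : x v - η ≤ max (x v - η) 0 := le_max_left _ _
  have h6 : max (x v - η) 0 ≤ x v := max_le (by linarith) (hx.1 v)
  rw [Real.dist_eq, abs_le]
  constructor <;> nlinarith [h3.1, h3.2]

lemma geom_subset (K : Set (Finset V)) : geom K ⊆ stdSimplex ℝ V := fun _ hx => hx.1

lemma isClosed_geom {K : Set (Finset V)} (hK : IsLowerSet K) : IsClosed (geom K) := by
  have : geom K = ⋃ σ ∈ K, (stdSimplex ℝ V ∩ ⋂ v ∈ ((σ : Set V)ᶜ), {x : V → ℝ | x v = 0}) := by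
    ext x
    simp only [geom, Set.mem_ofPred_eq, Set.mem_iUnion, Set.mem_inter_iff, Set.mem_iInter,
      Set.mem_compl_iff, SetLike.mem_coe, exists_prop]
    constructor
    · rintro ⟨h1, h2⟩
      exact ⟨_, h2, h1, fun v hv => notMem_supp.1 hv⟩
    · rintro ⟨σ, hσ, h1, h2⟩
      refine ⟨h1, hK (fun v hv => ?_) hσ⟩
      by_contra h
      exact (mem_supp.1 hv) (h2 v h)
  rw [this]
  refine Set.Finite.isClosed_biUnion (Set.toFinite K) fun σ _ => ?_
  refine (isCompact_stdSimplex ℝ V).isClosed.inter ?_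
  exact isClosed_biInter fun v _ => isClosed_eq (continuous_apply v) continuous_const

lemma isCompact_geom {K : Set (Finset V)} (hK : IsLowerSet K) : IsCompact (geom K) :=
  (isCompact_stdSimplex ℝ V).of_isClosed_subset (isClosed_geom hK) (geom_subset K)

/-- The lists of points contained in a common simplex of `K`. -/
abbrev points (K : Set (Finset V)) : Set (List (V → ℝ)) := Chain.carried carrier (pointLists V) K

lemma mem_geom_of_mem {K : Set (Finset V)} (hK : IsLowerSet K) {l : List (V → ℝ)}
    (hl : l ∈ points K) {x : V → ℝ} (hx : x ∈ l) : x ∈ geom K :=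
  ⟨hl.1 x hx, hK (carrier_subset_iff.1 le_rfl x hx) hl.2⟩

/-- The support of any single point of `P` contains the supports of all the shrunken points. -/
lemma mem_points_of_shrink {K : Set (Finset V)} (hK : IsLowerSet K) (hne : ∅ ∈ K) {η : ℝ}
    (hη : Fintype.card V * η < 1) {P : Set (V → ℝ)} (hP : P ⊆ geom K)
    (hd : ∀ u ∈ P, ∀ u' ∈ P, dist u u' ≤ η) {l : List (V → ℝ)}
    (hl : ∀ y ∈ l, ∃ u ∈ P, shrink η u = y) : l ∈ points K := by
  refine ⟨fun y hy => ?_, ?_⟩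
  · obtain ⟨u, hu, rfl⟩ := hl y hy
    exact shrink_mem hη (hP hu).1
  · cases l with
    | nil =>
      have : carrier ([] : List (V → ℝ)) = ∅ := by ext; simp
      rw [Set.mem_ofPred_eq, this]
      exact hne
    | cons y l =>
      obtain ⟨u, hu, rfl⟩ := hl y (by simp)
      refine hK (carrier_subset_iff.2 fun y hy => ?_) (hP hu).2
      obtain ⟨u', hu', rfl⟩ := hl y hy
      exact supp_shrink_subset (hd u hu u' hu')

/-- This takes the place of iterated subdivision of singular simplices. -/
lemma nonempty_equiv_small {K : Set (Finset V)} (hK : IsLowerSet K) (hne : ∅ ∈ K) {ε : ℝ}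
    (hε : 0 < ε) (p : ZMod 2) :
    Nonempty (Chain.Homology (Chain.carried carrier (smallLists V ε) K) p ≃ₗ[ℚ]
      Chain.Homology (points K) p) := by
  refine Chain.nonempty_homology_equiv (A := Chain.carried carrier (smallLists V ε) K)
    (B := points K) (fun l hl => ⟨hl.1.1, hl.2⟩) (fun z hz hdz => ?_) p
  refine Chain.exists_sub_bd_mem carrier_sublist (fun l hl => hl.1) (closed_smallLists ε)
    closed_pointLists (fun l hl h => ?_) (fun σ hσ => acyclic_smallLists hε hσ)
    (fun σ hσ => acyclic_pointLists hσ) hK hne hz (Chain.mem_mono hdz fun l hl => hl.1)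
  rw [eq_nil_of_carrier hl h]
  exact ⟨by simp [pointLists], by simp⟩

lemma nonempty_equiv_vertex [LinearOrder V] {K : Set (Finset V)} (hK : IsLowerSet K)
    (hne : ∅ ∈ K) (p : ZMod 2) :
    Nonempty (Chain.Homology (Chain.carried carrier (vertexLists V) K) p ≃ₗ[ℚ]
      Chain.Homology (points K) p) := by
  refine Chain.nonempty_homology_equiv (A := Chain.carried carrier (vertexLists V) K)
    (B := points K) (fun l hl => ⟨vertexLists_subset hl.1, hl.2⟩) (fun z hz hdz => ?_) p
  refine Chain.exists_sub_bd_mem carrier_sublist vertexLists_subset closed_vertexLists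
    closed_pointLists (fun l hl h => ?_) (fun σ hσ => acyclic_vertexLists hσ)
    (fun σ hσ => acyclic_pointLists hσ) hK hne hz (Chain.mem_mono hdz fun l hl => hl.1)
  rw [eq_nil_of_carrier hl h]
  exact ⟨[], List.Pairwise.nil, rfl⟩

/-- A map between realizations with a left homotopy inverse is injective on homology. -/
theorem exists_injective_of_homotopy {K : Set (Finset V)} (hK : IsLowerSet K) (hK0 : ∅ ∈ K)
    {L : Set (Finset W)} (hL : IsLowerSet L) (hL0 : ∅ ∈ L)
    {f : (V → ℝ) → (W → ℝ)} (hf : ContinuousOn f (geom K)) (hfm : Set.MapsTo f (geom K) (geom L))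
    {g : (W → ℝ) → (V → ℝ)} (hg : ContinuousOn g (geom L)) (hgm : Set.MapsTo g (geom L) (geom K))
    {H : ℝ × (V → ℝ) → (V → ℝ)} (hH : ContinuousOn H (Set.Icc 0 1 ×ˢ geom K))
    (hHm : Set.MapsTo H (Set.Icc 0 1 ×ˢ geom K) (geom K))
    (hH0 : ∀ x ∈ geom K, H (0, x) = x) (hH1 : ∀ x ∈ geom K, H (1, x) = g (f x)) (p : ZMod 2) :
    ∃ F : Chain.Homology (points K) p →ₗ[ℚ] Chain.Homology (points L) p,
      Function.Injective F := by
  have hmod : ∀ n : ℕ, ∀ r : ℝ, 0 < r → ∃ η : ℝ, 0 < η ∧ n * η < 1 ∧ (n + 1) * η < r := by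
    intro n r hr
    refine ⟨min 1 r / (n + 2), by positivity, ?_, ?_⟩
    · rw [← mul_div_assoc, div_lt_one (by positivity)]
      nlinarith [min_le_left 1 r, (Nat.cast_nonneg n : (0 : ℝ) ≤ n)]
    · rw [← mul_div_assoc, div_lt_iff₀ (by positivity)]
      nlinarith [min_le_right 1 r, (Nat.cast_nonneg n : (0 : ℝ) ≤ n)]
  obtain ⟨η, hη, hη1, -⟩ := hmod (Fintype.card V) 1 one_pos
  have hHu := Metric.uniformContinuousOn_iff.1
    ((isCompact_Icc.prod (isCompact_geom hK)).uniformContinuousOn_of_continuous hH)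
  have hgu := Metric.uniformContinuousOn_iff.1
    ((isCompact_geom hL).uniformContinuousOn_of_continuous hg)
  have hfu := Metric.uniformContinuousOn_iff.1
    ((isCompact_geom hK).uniformContinuousOn_of_continuous hf)
  -- `θ` is the modulus of continuity of `g` for `η`, and shrinking by `η'` moves points by less
  -- than `θ / 3`. On lists of diameter below `δ₂`, `f` spreads points by less than `η'`, so
  -- shrinking puts them in one simplex, and by less than `θ / 3`, so three thirds stay below `θ`.
  obtain ⟨δ₁, hδ₁, hHδ⟩ := hHu η hη
  obtain ⟨θ, hθ, hgθ⟩ := hgu η hη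
  obtain ⟨η', hη', hη'1, hη'2⟩ := hmod (Fintype.card W) (θ / 3) (by positivity)
  obtain ⟨δ₂, hδ₂, hfδ⟩ := hfu (min η' (θ / 3)) (by positivity)
  set δ := min δ₁ δ₂ with hδdef
  have hδ : 0 < δ := by positivity
  obtain ⟨N, hN⟩ := exists_nat_gt (1 / δ)
  have hN0 : (0 : ℝ) < N := lt_trans (by positivity) hN
  have hN1 : 1 / (N : ℝ) < δ := by
    rw [div_lt_iff₀ hN0]
    rw [div_lt_iff₀ hδ] at hN
    linarith
  set S := Chain.carried carrier (smallLists V δ) K with hS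
  have hSp : ∀ l ∈ S, l ∈ points K := fun l hl => ⟨hl.1.1, hl.2⟩
  have hSg : ∀ l ∈ S, ∀ x ∈ l, x ∈ geom K := fun l hl x hx => mem_geom_of_mem hK (hSp l hl) hx
  have hgeom' : ∀ y ∈ geom L, shrink η' y ∈ geom L := fun y hy =>
    ⟨shrink_mem hη'1 hy.1, hL (supp_shrink_subset (by rw [dist_self]; exact hη'.le)) hy.2⟩
  have hcl : ∀ y ∈ geom L, dist y (shrink η' y) < θ / 3 := fun y hy => by
    rw [dist_comm]; exact (dist_shrink_le hη'.le hη'1 hy.1).trans_lt hη'2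
  have hff : ∀ l ∈ S, ∀ x ∈ l, ∀ y ∈ l, dist (f x) (f y) < min η' (θ / 3) :=
    fun l hl x hx y hy => hfδ x (hSg l hl x hx) y (hSg l hl y hy)
      ((hl.1.2 x hx y hy).trans_le (min_le_right _ _))
  have hfm' : ∀ l ∈ S, ∀ x ∈ l, f x ∈ geom L := fun l hl x hx => hfm (hSg l hl x hx)
  -- the map forth
  have hforth : ∀ l ∈ S, l.map (shrink η' ∘ f) ∈ Chain.carried carrier (smallLists W θ) L := by
    intro l hl
    have h1 : l.map (shrink η' ∘ f) ∈ points L := by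
      refine mem_points_of_shrink hL hL0 hη'1 (P := f '' {x | x ∈ l}) ?_ ?_ ?_
      · rintro _ ⟨x, hx, rfl⟩
        exact hfm' l hl x hx
      · rintro _ ⟨x, hx, rfl⟩ _ ⟨y, hy, rfl⟩
        exact ((hff l hl x hx y hy).trans_le (min_le_left _ _)).le
      · intro y hy
        obtain ⟨x, hx, rfl⟩ := List.mem_map.1 hy
        exact ⟨f x, ⟨x, hx, rfl⟩, rfl⟩
    refine ⟨⟨h1.1, fun a ha b hb => ?_⟩, h1.2⟩
    obtain ⟨x, hx, rfl⟩ := List.mem_map.1 ha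
    obtain ⟨y, hy, rfl⟩ := List.mem_map.1 hb
    have e1 := hcl _ (hfm' l hl x hx)
    have e2 := hcl _ (hfm' l hl y hy)
    have e3 := (hff l hl x hx y hy).trans_le (min_le_right _ _)
    rw [dist_comm] at e1
    have e4 := dist_triangle4 (shrink η' (f x)) (f x) (f y) (shrink η' (f y))
    simp only [Function.comp_apply]
    linarith
  -- the map back
  have hback : ∀ l ∈ Chain.carried carrier (smallLists W θ) L,
      l.map (shrink η ∘ g) ∈ points K := by
    intro l hl
    have hlg : ∀ x ∈ l, x ∈ geom L := fun x hx => mem_geom_of_mem hL ⟨hl.1.1, hl.2⟩ hx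
    refine mem_points_of_shrink hK hK0 hη1 (P := g '' {x | x ∈ l}) ?_ ?_ ?_
    · rintro _ ⟨x, hx, rfl⟩
      exact hgm (hlg x hx)
    · rintro _ ⟨x, hx, rfl⟩ _ ⟨y, hy, rfl⟩
      exact (hgθ x (hlg x hx) y (hlg y hy) (hl.1.2 x hx y hy)).le
    · intro y hy
      obtain ⟨x, hx, rfl⟩ := List.mem_map.1 hy
      exact ⟨g x, ⟨x, hx, rfl⟩, rfl⟩
  have hstep : ∀ (a b : (V → ℝ) → (V → ℝ)) (z : Chain (V → ℝ)), z ∈ Chain.on S →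
      Chain.bd z = 0 → (∀ l ∈ S, ∀ l' : List (V → ℝ),
        (∀ y ∈ l', y ∈ l.map a ++ l.map b) → l' ∈ points K) →
      ∃ w ∈ Chain.on (points K), Chain.bd w = Chain.map b z - Chain.map a z := by
    intro a b z hz hdz h
    refine ⟨Chain.prism a b z, Chain.prism_mem (fun l hl l' hl' _ => h l hl l' hl') hz, ?_⟩
    rw [Chain.bd_prism, hdz, map_zero, sub_zero]
  -- Three homotopies are concatenated: from the identity to `shrink η`, along `H` in `N` steps to
  -- `shrink η ∘ g ∘ f`, and finally the insertion of `shrink η'` between `f` and `g`.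
  have hhom : ∀ z ∈ Chain.on S, Chain.bd z = 0 → ∃ w ∈ Chain.on (points K),
      Chain.bd w = Chain.map ((shrink η ∘ g) ∘ (shrink η' ∘ f)) z - z := by
    intro z hz hdz
    set h : ℕ → (V → ℝ) → (V → ℝ) := fun i x => shrink η (H ((i : ℝ) / N, x)) with hh
    have hIcc : ∀ i ≤ N, (i : ℝ) / N ∈ Set.Icc (0 : ℝ) 1 := fun i hi =>
      ⟨by positivity, by rw [div_le_one hN0]; exact_mod_cast hi⟩
    obtain ⟨w₁, hw₁, hdw₁⟩ := hstep id (h 0) z hz hdz (by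
      intro l hl l' hl'
      have hsub : ∀ y ∈ l', y ∈ stdSimplex ℝ V ∧ supp y ⊆ carrier l := by
        intro y hy
        rcases List.mem_append.1 (hl' y hy) with hy | hy
        · rw [List.map_id] at hy
          exact ⟨hl.1.1 y hy, carrier_subset_iff.1 le_rfl y hy⟩
        · obtain ⟨x, hx, rfl⟩ := List.mem_map.1 hy
          have hx0 : h 0 x = shrink η x := by
            simp only [hh, Nat.cast_zero, zero_div, hH0 x (hSg l hl x hx)]
          rw [hx0]
          exact ⟨shrink_mem hη1 (hl.1.1 x hx),
            (supp_shrink_subset (by rw [dist_self]; exact hη.le)).trans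
              (carrier_subset_iff.1 le_rfl x hx)⟩
      exact ⟨fun y hy => (hsub y hy).1, hK (carrier_subset_iff.2 fun y hy => (hsub y hy).2) hl.2⟩)
    obtain ⟨w₂, hw₂, hdw₂⟩ := Chain.exists_map_sub_map (S := S) (T := points K) h N (by
      intro i hi l hl l' hl'
      refine mem_points_of_shrink hK hK0 hη1
        (P := {u | ∃ j ∈ ({i, i + 1} : Set ℕ), ∃ x ∈ l, H ((j : ℝ) / N, x) = u}) ?_ ?_ ?_
      · rintro _ ⟨j, hj, x, hx, rfl⟩
        refine hHm ⟨hIcc j ?_, hSg l hl x hx⟩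
        rcases hj with rfl | rfl <;> omega
      · rintro _ ⟨j, hj, x, hx, rfl⟩ _ ⟨k, hk, y, hy, rfl⟩
        refine (hHδ _ ⟨hIcc j ?_, hSg l hl x hx⟩ _ ⟨hIcc k ?_, hSg l hl y hy⟩ ?_).le
        · rcases hj with rfl | rfl <;> omega
        · rcases hk with rfl | rfl <;> omega
        · rw [Prod.dist_eq, max_lt_iff]
          refine ⟨?_, (hl.1.2 x hx y hy).trans_le (min_le_left _ _)⟩
          have : dist ((j : ℝ) / N) (k / N) ≤ 1 / N := by
            rw [Real.dist_eq, ← sub_div, abs_div, abs_of_pos hN0]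
            gcongr
            rcases hj with rfl | rfl <;> rcases hk with rfl | rfl <;> simp
          exact (this.trans_lt hN1).trans_le (min_le_left _ _)
      · intro y hy
        rcases List.mem_append.1 (hl' y hy) with hy | hy
        · obtain ⟨x, hx, rfl⟩ := List.mem_map.1 hy
          exact ⟨_, ⟨i, by simp, x, hx, rfl⟩, rfl⟩
        · obtain ⟨x, hx, rfl⟩ := List.mem_map.1 hy
          exact ⟨_, ⟨i + 1, by simp, x, hx, rfl⟩, rfl⟩) hz hdz
    obtain ⟨w₃, hw₃, hdw₃⟩ := hstep (h N) ((shrink η ∘ g) ∘ (shrink η' ∘ f)) z hz hdz (by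
      intro l hl l' hl'
      refine mem_points_of_shrink hK hK0 hη1
        (P := g '' {u | ∃ x ∈ l, u = f x ∨ u = shrink η' (f x)}) ?_ ?_ ?_
      · rintro _ ⟨_, ⟨x, hx, rfl | rfl⟩, rfl⟩
        · exact hgm (hfm' l hl x hx)
        · exact hgm (hgeom' _ (hfm' l hl x hx))
      · rintro _ ⟨u, ⟨x, hx, hu⟩, rfl⟩ _ ⟨u', ⟨y, hy, hu'⟩, rfl⟩
        have key : ∀ u x, x ∈ l → u = f x ∨ u = shrink η' (f x) →
            u ∈ geom L ∧ dist (f x) u < θ / 3 := by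
          rintro u x hx (rfl | rfl)
          · exact ⟨hfm' l hl x hx, by rw [dist_self]; positivity⟩
          · exact ⟨hgeom' _ (hfm' l hl x hx), hcl _ (hfm' l hl x hx)⟩
        have e1 := key u x hx hu
        have e2 := key u' y hy hu'
        refine (hgθ u e1.1 u' e2.1 ?_).le
        have e3 := (hff l hl x hx y hy).trans_le (min_le_right _ _)
        have e4 := dist_triangle4 u (f x) (f y) u'
        have e5 := e1.2
        rw [dist_comm] at e5
        linarith [e2.2]
      · intro y hy
        rcases List.mem_append.1 (hl' y hy) with hy | hy
        · obtain ⟨x, hx, rfl⟩ := List.mem_map.1 hy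
          refine ⟨_, ⟨f x, ⟨x, hx, Or.inl rfl⟩, rfl⟩, ?_⟩
          simp only [hh, div_self hN0.ne', hH1 x (hSg l hl x hx)]
        · obtain ⟨x, hx, rfl⟩ := List.mem_map.1 hy
          exact ⟨_, ⟨_, ⟨x, hx, Or.inr rfl⟩, rfl⟩, rfl⟩)
    refine ⟨w₁ + w₂ + w₃, Submodule.add_mem _ (Submodule.add_mem _ hw₁ hw₂) hw₃, ?_⟩
    rw [map_add, map_add, hdw₁, hdw₂, hdw₃, Chain.map_id']
    abel
  obtain ⟨e₁⟩ := nonempty_equiv_small hK hK0 hδ p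
  obtain ⟨e₂⟩ := nonempty_equiv_small hL hL0 hθ p
  obtain ⟨F, hF, -⟩ := Chain.exists_injective_homology (S := S)
    (T := Chain.carried carrier (smallLists W θ) L) (p := p) (Chain.map (shrink η' ∘ f))
    (fun z hz => Chain.map_mem_cycles hforth hz) (fun z hz => Chain.map_mem_bounds hforth hz) (by
      rintro z ⟨hz, hdz⟩ hzb
      have hzS : z ∈ Chain.on S := Chain.mem_mono hz fun l hl => hl.1
      have hdz' : Chain.bd z = 0 := hdz
      -- If the image of `z` bounds, so does its image back in `K`, which is homologous to `z`. The
      -- bounding chain consists of lists of any size and is then replaced by one of small lists.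
      obtain ⟨w, hw, hwz⟩ := hhom z hzS hdz'
      obtain ⟨w', hw', hwz'⟩ := Chain.map_mem_bounds hback hzb
      have hwz'' : Chain.bd w' = Chain.map ((shrink η ∘ g) ∘ (shrink η' ∘ f)) z := by
        rw [← Chain.map_comp]; exact hwz'
      have hwB : w' - w ∈ Chain.on (points K) :=
        Submodule.sub_mem _ (Chain.mem_mono hw' fun l hl => hl.1) hw
      have hbd : Chain.bd (w' - w) = z := by rw [map_sub, hwz, hwz'']; abel
      obtain ⟨w₂, hw₂, hw₂'⟩ := Chain.exists_sub_bd_mem carrier_sublist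
        (A := smallLists V δ) (B := pointLists V) (fun l hl => hl.1) (closed_smallLists δ)
        closed_pointLists
        (fun l hl h => by
          rw [eq_nil_of_carrier hl h]
          exact ⟨by simp [pointLists], by simp⟩)
        (fun σ hσ => acyclic_smallLists hδ hσ)
        (fun σ hσ => acyclic_pointLists hσ) hK hK0 hwB
        (by rw [hbd]; exact Chain.mem_mono hzS fun l hl => hl.1)
      exact Chain.mem_bounds_of_bd (Chain.mem_mono hz fun l hl => hl.2) hw₂'
        (by rw [map_sub, Chain.bd_bd, sub_zero, hbd]))
  exact ⟨e₂.toLinearMap ∘ₗ F ∘ₗ e₁.symm.toLinearMap,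
    e₂.injective.comp (hF.comp e₁.symm.injective)⟩

end

/-! ### Homotopy invariance of the signed face count. -/

section

variable {V W : Type*} [Fintype V] [Fintype W]

open scoped Classical in
/-- The number of even faces minus the number of odd faces. -/
def signedCount (K : Set (Finset V)) : ℤ := ∑ τ : Finset V with τ ∈ K, (-1) ^ τ.card

lemma signedCount_eq_ncard (K : Set (Finset V)) : signedCount K =
    ({τ | τ ∈ K ∧ (τ.card : ZMod 2) = 0}.ncard : ℤ) -
      {τ | τ ∈ K ∧ (τ.card : ZMod 2) = 1}.ncard := by
  classical
  have h1 : ∀ τ : Finset V, ((-1 : ℤ)) ^ τ.card =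
      (if (τ.card : ZMod 2) = 0 then 1 else 0) - (if (τ.card : ZMod 2) = 1 then 1 else 0) := by
    intro τ
    rcases Nat.even_or_odd τ.card with h | h
    · rw [h.neg_one_pow, if_pos ((ZMod.natCast_eq_zero_iff_even).2 h), if_neg]
      · rfl
      · rw [(ZMod.natCast_eq_zero_iff_even).2 h]; decide
    · rw [h.neg_one_pow, if_pos ((ZMod.natCast_eq_one_iff_odd).2 h), if_neg]
      · rfl
      · rw [(ZMod.natCast_eq_one_iff_odd).2 h]; decide
  unfold signedCount
  rw [Finset.sum_congr rfl fun τ _ => h1 τ, Finset.sum_sub_distrib, Finset.sum_boole,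
    Finset.sum_boole, Finset.filter_filter, Finset.filter_filter, ← Set.ncard_coe_finset,
    ← Set.ncard_coe_finset]
  simp

lemma ncard_vertexLists [LinearOrder V] (K : Set (Finset V)) (p : ZMod 2) :
    (Chain.carried carrier (vertexLists V) K ∩ Chain.ofParity p).ncard =
      {τ | τ ∈ K ∧ (τ.card : ZMod 2) = p}.ncard := by
  have hcar : ∀ m : List V, carrier (m.map vert) = m.toFinset := fun m => by
    ext v; rw [mem_carrier_map_vert, List.mem_toFinset]
  refine Set.ncard_congr (fun l _ => carrier l) ?_ ?_ ?_
  · rintro _ ⟨⟨⟨m, hm, rfl⟩, hK⟩, hp⟩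
    refine ⟨hK, ?_⟩
    rw [hcar, List.toFinset_card_of_nodup (hm.imp fun h => ne_of_lt h)]
    rw [Chain.mem_ofParity, List.length_map] at hp
    exact hp
  · rintro _ _ ⟨⟨⟨m, hm, rfl⟩, -⟩, -⟩ ⟨⟨⟨m', hm', rfl⟩, -⟩, -⟩ h
    rw [hcar, hcar] at h
    have hperm : m.Perm m' := (List.perm_ext_iff_of_nodup (hm.imp fun h => ne_of_lt h)
      (hm'.imp fun h => ne_of_lt h)).2 fun v => by
        rw [← List.mem_toFinset, h, List.mem_toFinset]
    rw [hperm.eq_of_pairwise (fun a b _ _ h1 h2 => absurd h1 (lt_asymm h2)) hm hm']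
  · rintro τ ⟨hτ, hp⟩
    have hs : carrier ((τ.sort (· ≤ ·)).map vert) = τ := by rw [hcar, Finset.sort_toFinset]
    refine ⟨(τ.sort (· ≤ ·)).map vert, ⟨⟨⟨_, ?_, rfl⟩, ?_⟩, ?_⟩, hs⟩
    · exact (Finset.sortedLT_sort τ).pairwise
    · rw [Set.mem_ofPred_eq, hs]; exact hτ
    · rw [Chain.mem_ofParity, List.length_map, Finset.length_sort]; exact hp

lemma finite_vertexLists [LinearOrder V] : (vertexLists V).Finite := by
  have : vertexLists V ⊆ (fun s : Finset V => (s.sort (· ≤ ·)).map vert) '' Set.univ := by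
    rintro _ ⟨m, hm, rfl⟩
    refine ⟨m.toFinset, trivial, ?_⟩
    have hperm : (m.toFinset.sort (· ≤ ·)).Perm m :=
      (List.perm_ext_iff_of_nodup (Finset.sort_nodup _ _) (hm.imp fun h => ne_of_lt h)).2
        fun v => by simp
    have := hperm.eq_of_pairwise (fun a b _ _ h1 h2 => absurd h1 (lt_asymm h2))
      (Finset.sortedLT_sort m.toFinset).pairwise hm
    simp only [this]
  exact (Set.finite_univ.image _).subset this

/-- The reduced Euler characteristic is determined by the dimensions of homology. -/
lemma finrank_homology {K : Set (Finset V)} (hK : IsLowerSet K) (hK0 : ∅ ∈ K) :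
    (∀ p, FiniteDimensional ℚ (Chain.Homology (points K) p)) ∧
    signedCount K = (Module.finrank ℚ (Chain.Homology (points K) 0) : ℤ) -
      Module.finrank ℚ (Chain.Homology (points K) 1) := by
  -- Any linear order on the vertices will do: it only selects one list for each face.
  let e := Fintype.equivFin V
  let _ : LinearOrder V := LinearOrder.lift' e e.injective
  have hcl : Chain.Closed (Chain.carried carrier (vertexLists V) K) :=
    closed_vertexLists.carried carrier_sublist hK
  obtain ⟨h1, h2⟩ := Chain.finrank_homology_sub hcl
    (finite_vertexLists.subset Set.inter_subset_left)
  have E := fun p => (nonempty_equiv_vertex hK hK0 p).some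
  refine ⟨fun p => ?_, ?_⟩
  · have := h1 p
    exact (E p).finiteDimensional
  · rw [← (E 0).finrank_eq, ← (E 1).finrank_eq, h2, ncard_vertexLists, ncard_vertexLists,
      signedCount_eq_ncard]

/-- The reduced Euler characteristic is a homotopy invariant. -/
theorem signedCount_eq_of_homotopy {K : Set (Finset V)} (hK : IsLowerSet K) (hK0 : ∅ ∈ K)
    {L : Set (Finset W)} (hL : IsLowerSet L) (hL0 : ∅ ∈ L)
    {f : (V → ℝ) → (W → ℝ)} (hf : ContinuousOn f (geom K)) (hfm : Set.MapsTo f (geom K) (geom L))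
    {g : (W → ℝ) → (V → ℝ)} (hg : ContinuousOn g (geom L)) (hgm : Set.MapsTo g (geom L) (geom K))
    {H : ℝ × (V → ℝ) → (V → ℝ)} (hH : ContinuousOn H (Set.Icc 0 1 ×ˢ geom K))
    (hHm : Set.MapsTo H (Set.Icc 0 1 ×ˢ geom K) (geom K))
    (hH0 : ∀ x ∈ geom K, H (0, x) = x) (hH1 : ∀ x ∈ geom K, H (1, x) = g (f x))
    {G : ℝ × (W → ℝ) → (W → ℝ)} (hG : ContinuousOn G (Set.Icc 0 1 ×ˢ geom L))
    (hGm : Set.MapsTo G (Set.Icc 0 1 ×ˢ geom L) (geom L))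
    (hG0 : ∀ x ∈ geom L, G (0, x) = x) (hG1 : ∀ x ∈ geom L, G (1, x) = f (g x)) :
    signedCount K = signedCount L := by
  obtain ⟨h1, h2⟩ := finrank_homology hK hK0
  obtain ⟨h3, h4⟩ := finrank_homology hL hL0
  have : ∀ p, Module.finrank ℚ (Chain.Homology (points K) p) =
      Module.finrank ℚ (Chain.Homology (points L) p) := fun p => by
    obtain ⟨F, hF⟩ := exists_injective_of_homotopy hK hK0 hL hL0 hf hfm hg hgm hH hHm hH0 hH1 p
    obtain ⟨F', hF'⟩ := exists_injective_of_homotopy hL hL0 hK hK0 hg hgm hf hfm hG hGm hG0 hG1 p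
    have := h1 p
    have := h3 p
    exact le_antisymm (LinearMap.finrank_le_finrank_of_injective hF)
      (LinearMap.finrank_le_finrank_of_injective hF')
  rw [h2, h4, this, this]

end

/-! ### Local invariance: complements of open stars. -/

section

section

variable {V : Type*}

/-- The complement of the open star of `ρ`. -/
def costar (K : Set (Finset V)) (ρ : Finset V) : Set (Finset V) := {τ | τ ∈ K ∧ ¬ ρ ⊆ τ}

lemma isLowerSet_costar {K : Set (Finset V)} (hK : IsLowerSet K) (ρ : Finset V) :
    IsLowerSet (costar K ρ) :=
  fun _ _ h hs => ⟨hK h hs.1, fun h' => hs.2 (h'.trans h)⟩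

lemma empty_mem_costar {K : Set (Finset V)} (hK0 : ∅ ∈ K) {ρ : Finset V} (hρ : ρ.Nonempty) :
    ∅ ∈ costar K ρ :=
  ⟨hK0, fun h => hρ.ne_empty (Finset.subset_empty.1 h)⟩

end

variable {V W : Type*} [Fintype V] [Fintype W]

lemma geom_mono {K L : Set (Finset V)} (h : K ⊆ L) : geom K ⊆ geom L :=
  fun _ hx => ⟨hx.1, h hx.2⟩

/-- The gauge measuring how far a point is from `x`: it is `0` at `x` only, and `1` outside the
open star of the simplex of `x`. -/
def radius (x y : V → ℝ) : ℝ :=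
  if h : (supp x).Nonempty then (supp x).sup' h fun v => 1 - y v / x v else 1

/-- The push away from `x`, at time `t`. -/
def push (x : V → ℝ) (t : ℝ) (y : V → ℝ) : V → ℝ :=
  x + ((1 - t) + t / radius x y) • (y - x)

lemma continuous_radius (x : V → ℝ) : Continuous (radius x) := by
  unfold radius
  split_ifs with h
  · exact Continuous.finset_sup'_apply h fun v _ => by fun_prop
  · exact continuous_const

lemma continuousOn_push (x : V → ℝ) :
    ContinuousOn (fun q : ℝ × (V → ℝ) => push x q.1 q.2) {q | radius x q.2 ≠ 0} := by
  unfold push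
  have h1 : Continuous fun q : ℝ × (V → ℝ) => 1 - q.1 := by fun_prop
  have h2 : Continuous fun q : ℝ × (V → ℝ) => q.2 - x := by fun_prop
  refine continuousOn_const.add (ContinuousOn.smul (h1.continuousOn.add ?_) h2.continuousOn)
  exact continuousOn_fst.div ((continuous_radius x).comp continuous_snd).continuousOn
    fun q hq => hq

section

variable {K : Set (Finset V)} {x y : V → ℝ}

lemma le_radius (x y : V → ℝ) {v : V} (hv : v ∈ supp x) : 1 - y v / x v ≤ radius x y := by
  rw [radius, dif_pos ⟨v, hv⟩]
  exact Finset.le_sup' (fun v => 1 - y v / x v) hv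

lemma exists_radius_eq (hx : x ∈ stdSimplex ℝ V) (y : V → ℝ) :
    ∃ v ∈ supp x, radius x y = 1 - y v / x v := by
  rw [radius, dif_pos (supp_nonempty hx)]
  exact Finset.exists_mem_eq_sup' _ _

lemma pos_of_mem_supp (hx : x ∈ stdSimplex ℝ V) {v : V} (hv : v ∈ supp x) : 0 < x v :=
  lt_of_le_of_ne (hx.1 v) (Ne.symm (mem_supp.1 hv))

lemma radius_le_one (hx : x ∈ stdSimplex ℝ V) (hy : y ∈ stdSimplex ℝ V) : radius x y ≤ 1 := by
  obtain ⟨v, hv, h⟩ := exists_radius_eq hx y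
  rw [h]
  have := div_nonneg (hy.1 v) (hx.1 v)
  linarith

lemma radius_pos (hx : x ∈ stdSimplex ℝ V) (hy : y ∈ stdSimplex ℝ V) (hne : y ≠ x) :
    0 < radius x y := by
  by_contra h
  rw [not_lt] at h
  have h1 : ∀ v ∈ Finset.univ, x v ≤ y v := by
    intro v _
    by_cases hv : v ∈ supp x
    · have := (le_radius x y hv).trans h
      have hp := pos_of_mem_supp hx hv
      have h2 : 1 ≤ y v / x v := by linarith
      rwa [le_div_iff₀ hp, one_mul] at h2
    · rw [notMem_supp.1 hv]; exact hy.1 v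
  have h2 := (Finset.sum_eq_sum_iff_of_le h1).1 (by rw [hx.2, hy.2])
  exact hne (funext fun v => (h2 v (Finset.mem_univ v)).symm)

lemma radius_eq_one (hx : x ∈ stdSimplex ℝ V) (hy : y ∈ stdSimplex ℝ V)
    (h : ¬ supp x ⊆ supp y) : radius x y = 1 := by
  refine le_antisymm (radius_le_one hx hy) ?_
  obtain ⟨v, hv, hv'⟩ := Finset.not_subset.1 h
  have := le_radius x y hv
  rwa [notMem_supp.1 hv', zero_div, sub_zero] at this

lemma push_zero (x y : V → ℝ) : push x 0 y = y := by simp [push]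

lemma push_eq_self (hx : x ∈ stdSimplex ℝ V) (hy : y ∈ stdSimplex ℝ V)
    (h : ¬ supp x ⊆ supp y) (t : ℝ) : push x t y = y := by
  simp [push, radius_eq_one hx hy h]

lemma push_mem_stdSimplex (hx : x ∈ stdSimplex ℝ V) (hy : y ∈ stdSimplex ℝ V) (hne : y ≠ x)
    {t : ℝ} (ht : t ∈ Set.Icc (0 : ℝ) 1) : push x t y ∈ stdSimplex ℝ V := by
  have hM := radius_pos hx hy hne
  have hM1 := radius_le_one hx hy
  set M := radius x y with hMdef
  set c := (1 - t) + t / M with hc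
  have hc0 : 0 ≤ c := add_nonneg (by linarith [ht.2]) (div_nonneg ht.1 hM.le)
  have hcM : c * M ≤ 1 := by
    rw [hc, add_mul, div_mul_cancel₀ _ hM.ne']
    nlinarith [ht.1, ht.2]
  refine ⟨fun v => ?_, ?_⟩
  · have e : push x t y v = x v + c * (y v - x v) := by simp [push, hc, hMdef]
    rw [e]
    by_cases hv : v ∈ supp x
    · have hp := pos_of_mem_supp hx hv
      have h1 := le_radius x y hv
      have h2 : x v - y v ≤ M * x v := by
        have : (1 - y v / x v) * x v = x v - y v := by field_simp
        rw [← this]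
        exact mul_le_mul_of_nonneg_right h1 hp.le
      nlinarith [mul_le_mul_of_nonneg_left h2 hc0]
    · rw [notMem_supp.1 hv]
      have := hy.1 v
      nlinarith [mul_nonneg hc0 this]
  · simp only [push, Pi.add_apply, Pi.smul_apply, Pi.sub_apply, smul_eq_mul]
    rw [Finset.sum_add_distrib, ← Finset.mul_sum, Finset.sum_sub_distrib, hx.2, hy.2]
    ring

lemma supp_push_subset (h : supp x ⊆ supp y) (t : ℝ) : supp (push x t y) ⊆ supp y := by
  intro v hv
  by_contra hv'
  have h1 : y v = 0 := notMem_supp.1 hv'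
  have h2 : x v = 0 := notMem_supp.1 fun h' => hv' (h h')
  simp [push, h1, h2] at hv

lemma push_mem_geom (hK : IsLowerSet K) (hx : x ∈ stdSimplex ℝ V) (hy : y ∈ geom K)
    (hne : y ≠ x) {t : ℝ} (ht : t ∈ Set.Icc (0 : ℝ) 1) : push x t y ∈ geom K := by
  by_cases h : supp x ⊆ supp y
  · exact ⟨push_mem_stdSimplex hx hy.1 hne ht, hK (supp_push_subset h t) hy.2⟩
  · rwa [push_eq_self hx hy.1 h]

/-- At time one the gauge is scaled to `1`, so a coordinate attaining the maximum in `radius`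
becomes zero and the support no longer contains that of `x`. -/
lemma push_one_mem_costar (hK : IsLowerSet K) (hx : x ∈ stdSimplex ℝ V) (hy : y ∈ geom K)
    (hne : y ≠ x) : push x 1 y ∈ geom (costar K (supp x)) := by
  have hg := push_mem_geom hK hx hy hne ⟨zero_le_one, le_rfl⟩
  refine ⟨hg.1, hg.2, fun hsub => ?_⟩
  obtain ⟨v, hv, hM⟩ := exists_radius_eq hx y
  have hM0 := radius_pos hx hy.1 hne
  have hp := pos_of_mem_supp hx hv
  refine mem_supp.1 (hsub hv) ?_
  have : radius x y * x v = x v - y v := by rw [hM]; field_simp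
  simp only [push, Pi.add_apply, Pi.smul_apply, Pi.sub_apply, smul_eq_mul, sub_self, zero_add]
  have h2 : y v - x v = - (radius x y * x v) := by linarith
  rw [h2]
  field_simp
  ring

lemma push_ne (hx : x ∈ stdSimplex ℝ V) (hy : y ∈ stdSimplex ℝ V) (hne : y ≠ x)
    {t : ℝ} (ht : t ∈ Set.Icc (0 : ℝ) 1) : push x t y ≠ x := by
  have hM := radius_pos hx hy hne
  have hc : 0 < (1 - t) + t / radius x y := by
    rcases eq_or_lt_of_le ht.1 with h | h
    · rw [← h]; simp
    · have := div_pos h hM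
      linarith [ht.2]
  intro h
  rw [push, add_eq_left, smul_eq_zero] at h
  rcases h with h | h
  · exact hc.ne' h
  · exact hne (sub_eq_zero.1 h)

lemma ne_of_mem_costar (hy : y ∈ geom (costar K (supp x))) : y ≠ x := by
  rintro rfl
  exact hy.2.2 le_rfl

end

section

variable {K : Set (Finset V)} {L : Set (Finset W)} {f : (V → ℝ) → (W → ℝ)}
  {g : (W → ℝ) → (V → ℝ)} {x : V → ℝ} {x' : W → ℝ}

lemma continuousOn_push_comp {X : Type*} [TopologicalSpace X] {A : Set X} {τ : X → ℝ}
    {u : X → (V → ℝ)} (hτ : ContinuousOn τ A) (hu : ContinuousOn u A) (hx : x ∈ stdSimplex ℝ V)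
    (huA : ∀ a ∈ A, u a ∈ stdSimplex ℝ V ∧ u a ≠ x) :
    ContinuousOn (fun a => push x (τ a) (u a)) A :=
  (continuousOn_push x).comp (hτ.prodMk hu) fun a ha =>
    (radius_pos hx (huA a ha).1 (huA a ha).2).ne'

lemma apply_mem_of_mem_costar (hfm : Set.MapsTo f (geom K) (geom L))
    (hgf : ∀ x ∈ geom K, g (f x) = x) (hgx : g x' = x)
    {y : V → ℝ} (hy : y ∈ geom (costar K (supp x))) : f y ∈ geom L ∧ f y ≠ x' := by
  have hyK : y ∈ geom K := geom_mono (fun _ h => h.1) hy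
  refine ⟨hfm hyK, fun h => ne_of_mem_costar hy ?_⟩
  rw [← hgf y hyK, h, hgx]

lemma continuousOn_push_apply (hf : ContinuousOn f (geom K))
    (hfm : Set.MapsTo f (geom K) (geom L)) (hgf : ∀ x ∈ geom K, g (f x) = x)
    (hx' : x' ∈ geom L) (hgx : g x' = x) :
    ContinuousOn (fun y => push x' 1 (f y)) (geom (costar K (supp x))) := by
  refine continuousOn_push_comp continuousOn_const (hf.mono (geom_mono fun _ h => h.1)) hx'.1
    fun y hy => ?_
  have := apply_mem_of_mem_costar hfm hgf hgx hy
  exact ⟨this.1.1, this.2⟩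

lemma mapsTo_push_apply (hL : IsLowerSet L)
    (hfm : Set.MapsTo f (geom K) (geom L)) (hgf : ∀ x ∈ geom K, g (f x) = x)
    (hx' : x' ∈ geom L) (hgx : g x' = x) :
    Set.MapsTo (fun y => push x' 1 (f y)) (geom (costar K (supp x)))
      (geom (costar L (supp x'))) := fun y hy => by
  have := apply_mem_of_mem_costar hfm hgf hgx hy
  exact push_one_mem_costar hL hx'.1 this.1 this.2

/-- `push` retracts the realization minus a point onto the complement of the open star. Running the
push in `L` from time `0` to time `1` between `f` and `g` joins the identity of the complement to
the composite of the two retracted maps; `push_ne` keeps the path away from the removed points. -/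
lemma push_homotopy (hK : IsLowerSet K) (hL : IsLowerSet L) (hf : ContinuousOn f (geom K))
    (hfm : Set.MapsTo f (geom K) (geom L)) (hg : ContinuousOn g (geom L))
    (hgm : Set.MapsTo g (geom L) (geom K)) (hgf : ∀ x ∈ geom K, g (f x) = x)
    (hfg : ∀ x ∈ geom L, f (g x) = x) (hx : x ∈ geom K) (hx' : x' ∈ geom L) (hgx : g x' = x) :
    ContinuousOn (fun q : ℝ × (V → ℝ) => push x 1 (g (push x' q.1 (f q.2))))
      (Set.Icc 0 1 ×ˢ geom (costar K (supp x))) ∧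
    Set.MapsTo (fun q : ℝ × (V → ℝ) => push x 1 (g (push x' q.1 (f q.2))))
      (Set.Icc 0 1 ×ˢ geom (costar K (supp x))) (geom (costar K (supp x))) ∧
    ∀ y ∈ geom (costar K (supp x)), push x 1 (g (push x' 0 (f y))) = y := by
  have h1 : ∀ q ∈ Set.Icc (0 : ℝ) 1 ×ˢ geom (costar K (supp x)),
      push x' q.1 (f q.2) ∈ geom L ∧ push x' q.1 (f q.2) ≠ x' := fun q hq => by
    have := apply_mem_of_mem_costar hfm hgf hgx hq.2
    exact ⟨push_mem_geom hL hx'.1 this.1 this.2 hq.1, push_ne hx'.1 this.1.1 this.2 hq.1⟩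
  have h2 : ∀ q ∈ Set.Icc (0 : ℝ) 1 ×ˢ geom (costar K (supp x)),
      g (push x' q.1 (f q.2)) ∈ geom K ∧ g (push x' q.1 (f q.2)) ≠ x := fun q hq => by
    refine ⟨hgm (h1 q hq).1, fun h => (h1 q hq).2 ?_⟩
    rw [← hfg _ (h1 q hq).1, h, ← hgx, hfg _ hx']
  refine ⟨?_, fun q hq => push_one_mem_costar hK hx.1 (h2 q hq).1 (h2 q hq).2, fun y hy => ?_⟩
  · refine continuousOn_push_comp continuousOn_const ?_ hx.1
      fun q hq => ⟨(h2 q hq).1.1, (h2 q hq).2⟩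
    refine hg.comp (continuousOn_push_comp continuousOn_fst ?_ hx'.1 fun q hq => ?_)
      fun q hq => (h1 q hq).1
    · exact (hf.mono (geom_mono fun _ h => h.1)).comp continuousOn_snd fun q hq => hq.2
    · have := apply_mem_of_mem_costar hfm hgf hgx hq.2
      exact ⟨this.1.1, this.2⟩
  · have hyK : y ∈ geom K := geom_mono (fun _ h => h.1) hy
    rw [push_zero, hgf y hyK, push_eq_self hx.1 hy.1 hy.2.2]

end

/-- The signed count of the complement of an open star is a local topological invariant. -/
theorem signedCount_costar_eq {K : Set (Finset V)} (hK : IsLowerSet K) (hK0 : ∅ ∈ K)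
    {L : Set (Finset W)} (hL : IsLowerSet L) (hL0 : ∅ ∈ L)
    {f : (V → ℝ) → (W → ℝ)} (hf : ContinuousOn f (geom K)) (hfm : Set.MapsTo f (geom K) (geom L))
    {g : (W → ℝ) → (V → ℝ)} (hg : ContinuousOn g (geom L)) (hgm : Set.MapsTo g (geom L) (geom K))
    (hgf : ∀ x ∈ geom K, g (f x) = x) (hfg : ∀ x ∈ geom L, f (g x) = x)
    {x : V → ℝ} (hx : x ∈ geom K) :
    signedCount (costar K (supp x)) = signedCount (costar L (supp (f x))) := by
  have hx' := hfm hx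
  have hgx := hgf x hx
  obtain ⟨a1, a2, a3⟩ := push_homotopy hK hL hf hfm hg hgm hgf hfg hx hx' hgx
  obtain ⟨b1, b2, b3⟩ := push_homotopy hL hK hg hgm hf hfm hfg hgf hx' hx rfl
  exact signedCount_eq_of_homotopy
    (isLowerSet_costar hK _) (empty_mem_costar hK0 (supp_nonempty hx.1))
    (isLowerSet_costar hL _) (empty_mem_costar hL0 (supp_nonempty hx'.1))
    (continuousOn_push_apply hf hfm hgf hx' hgx) (mapsTo_push_apply hL hfm hgf hx' hgx)
    (continuousOn_push_apply hg hgm hfg hx rfl) (mapsTo_push_apply hK hgm hfg hx rfl)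
    a1 a2 a3 (fun _ _ => rfl) b1 b2 b3 fun _ _ => rfl

/-- The reduced Euler characteristic is a topological invariant. -/
theorem signedCount_eq_of_homeomorph {K : Set (Finset V)} (hK : IsLowerSet K) (hK0 : ∅ ∈ K)
    {L : Set (Finset W)} (hL : IsLowerSet L) (hL0 : ∅ ∈ L)
    {f : (V → ℝ) → (W → ℝ)} (hf : ContinuousOn f (geom K)) (hfm : Set.MapsTo f (geom K) (geom L))
    {g : (W → ℝ) → (V → ℝ)} (hg : ContinuousOn g (geom L)) (hgm : Set.MapsTo g (geom L) (geom K))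
    (hgf : ∀ x ∈ geom K, g (f x) = x) (hfg : ∀ x ∈ geom L, f (g x) = x) :
    signedCount K = signedCount L :=
  signedCount_eq_of_homotopy hK hK0 hL hL0 hf hfm hg hgm (H := Prod.snd) (G := Prod.snd)
    continuousOn_snd (fun _ h => h.2) (fun _ _ => rfl) (fun x hx => (hgf x hx).symm)
    continuousOn_snd (fun _ h => h.2) (fun _ _ => rfl) (fun x hx => (hfg x hx).symm)

end

/-! ### Realizations, star counts and transfer of the semi-Eulerian condition. -/

section

variable {V W : Type*} [Fintype V] [Fintype W]

/-- The faces of a complex, the empty one included. -/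
def allFaces {V : Type*} (K : AbstractSimplicialComplex V) : Set (Finset V) := insert ∅ K.faces

lemma isLowerSet_allFaces {V : Type*} (K : AbstractSimplicialComplex V) :
    IsLowerSet (allFaces K) := by
  intro s t hts hs
  rcases Finset.eq_empty_or_nonempty t with rfl | ht
  · exact Set.mem_insert _ _
  · rcases hs with rfl | hs
    · exact absurd (Finset.subset_empty.1 hts) ht.ne_empty
    · exact Or.inr ((K.isRelLowerSet_faces hs).2 hts ht)

lemma empty_mem_allFaces {V : Type*} (K : AbstractSimplicialComplex V) : ∅ ∈ allFaces K :=
  Set.mem_insert _ _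

lemma nonempty_of_mem_faces {V : Type*} {K : AbstractSimplicialComplex V} {s : Finset V}
    (hs : s ∈ K.faces) : s.Nonempty :=
  (K.isRelLowerSet_faces hs).1

lemma mem_faces_of_mem_allFaces {V : Type*} {K : AbstractSimplicialComplex V} {s : Finset V}
    (hs : s ∈ allFaces K) (hne : s.Nonempty) : s ∈ K.faces :=
  hs.resolve_left hne.ne_empty

lemma convexHull_vert (s : Finset V) :
    convexHull ℝ (vert '' (s : Set V)) = {x | x ∈ stdSimplex ℝ V ∧ supp x ⊆ s} := by
  refine Set.Subset.antisymm (convexHull_min ?_ ?_) ?_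
  · rintro _ ⟨v, hv, rfl⟩
    exact ⟨vert_mem_stdSimplex v, by rw [supp_vert]; simpa using hv⟩
  · rintro x ⟨hx, hxs⟩ y ⟨hy, hys⟩ a b ha hb hab
    refine ⟨convex_stdSimplex ℝ V hx hy ha hb hab, fun v hv => ?_⟩
    by_contra h
    have h1 : x v = 0 := notMem_supp.1 fun h' => h (hxs h')
    have h2 : y v = 0 := notMem_supp.1 fun h' => h (hys h')
    simp [h1, h2] at hv
  · rintro x ⟨hx, hxs⟩
    have h0 : ∀ v ∉ s, x v = 0 := fun v hv => notMem_supp.1 fun h => hv (hxs h)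
    have hsum : ∑ v ∈ s, x v = 1 := by
      rw [← hx.2]
      exact Finset.sum_subset (Finset.subset_univ s) fun v _ hv => h0 v hv
    have hxe : x = ∑ v ∈ s, x v • vert v := by
      ext w
      simp only [Finset.sum_apply, Pi.smul_apply, smul_eq_mul]
      by_cases hw : w ∈ s
      · rw [Finset.sum_eq_single_of_mem w hw fun v _ hv => by rw [vert_of_ne hv.symm, mul_zero],
          vert_self, mul_one]
      · rw [h0 w hw, Finset.sum_eq_zero]
        intro v hv
        rw [vert_of_ne (fun h => hw (by rw [h]; exact hv)), mul_zero]
    rw [hxe]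
    exact (convex_convexHull ℝ _).sum_mem (fun v _ => hx.1 v) hsum
      fun v hv => subset_convexHull ℝ _ ⟨v, hv, rfl⟩

lemma realization_eq_geom (K : AbstractSimplicialComplex V) :
    realization K = geom (allFaces K) := by
  have : realization K = ⋃ s ∈ K.faces, convexHull ℝ (vert '' (s : Set V)) := rfl
  rw [this]
  ext x
  simp only [convexHull_vert, Set.mem_iUnion, exists_prop, geom, Set.mem_ofPred_eq]
  constructor
  · rintro ⟨s, hs, hx, hxs⟩
    exact ⟨hx, isLowerSet_allFaces K hxs (Or.inr hs)⟩
  · rintro ⟨hx, hxs⟩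
    exact ⟨supp x, mem_faces_of_mem_allFaces hxs (supp_nonempty hx), hx, le_rfl⟩

open scoped Classical in
/-- The signed number of faces containing `ρ`. -/
def starCount (K : Set (Finset V)) (ρ : Finset V) : ℤ :=
  ∑ τ : Finset V with τ ∈ K ∧ ρ ⊆ τ, (-1) ^ τ.card

lemma signedCount_eq_add (K : Set (Finset V)) (ρ : Finset V) :
    signedCount K = starCount K ρ + signedCount (costar K ρ) := by
  classical
  unfold signedCount starCount costar
  rw [← Finset.sum_filter_add_sum_filter_not _ (fun τ => ρ ⊆ τ), Finset.filter_filter,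
    Finset.filter_filter]
  simp only [Set.mem_ofPred_eq]

/-- Removing `ρ` matches the faces properly containing it with the nonempty faces of the link; `ρ`
itself gives the empty face of the link, hence the `1`. -/
lemma starCount_eq_eulerChar (K : AbstractSimplicialComplex V) {ρ : Finset V} (hρ : ρ ∈ K.faces) :
    starCount (allFaces K) ρ = (-1) ^ ρ.card * (1 - eulerChar (link K ρ)) := by
  classical
  unfold starCount eulerChar
  have hmem : ρ ∈ Finset.univ.filter fun τ : Finset V => τ ∈ allFaces K ∧ ρ ⊆ τ := by
    simp [allFaces, hρ]
  rw [← Finset.add_sum_erase _ _ hmem, mul_sub, mul_one, Finset.mul_sum, sub_eq_add_neg,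
    ← Finset.sum_neg_distrib]
  congr 1
  refine Finset.sum_bij' (fun τ _ => τ \ ρ) (fun τ _ => τ ∪ ρ) ?_ ?_ ?_ ?_ ?_
  · intro τ hτ
    simp only [Finset.mem_erase, Finset.mem_filter, Finset.mem_univ, true_and] at hτ ⊢
    refine ⟨?_, Finset.sdiff_disjoint, ?_⟩
    · rw [Finset.sdiff_nonempty]
      exact fun h => hτ.1 (le_antisymm h hτ.2.2)
    · rw [Finset.sdiff_union_of_subset hτ.2.2]
      exact mem_faces_of_mem_allFaces hτ.2.1 ((nonempty_of_mem_faces hρ).mono hτ.2.2)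
  · intro τ hτ
    simp only [Finset.mem_erase, Finset.mem_filter, Finset.mem_univ, true_and] at hτ ⊢
    obtain ⟨h1, h2, h3⟩ := hτ
    refine ⟨fun h => ?_, Or.inr h3, Finset.subset_union_right⟩
    obtain ⟨v, hv⟩ := h1
    exact Finset.disjoint_left.1 h2 hv (h ▸ Finset.mem_union_left ρ hv)
  · intro τ hτ
    simp only [Finset.mem_erase, Finset.mem_filter, Finset.mem_univ, true_and] at hτ
    exact Finset.sdiff_union_of_subset hτ.2.2
  · intro τ hτ
    simp only [Finset.mem_filter, Finset.mem_univ, true_and] at hτ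
    rw [Finset.union_sdiff_right, Finset.sdiff_eq_self_of_disjoint hτ.2.1]
  · intro τ hτ
    simp only [Finset.mem_erase, Finset.mem_filter, Finset.mem_univ, true_and] at hτ
    have h1 := Finset.card_sdiff_add_card_eq_card hτ.2.2
    have h2 : 0 < (τ \ ρ).card := by
      rw [Finset.card_pos, Finset.sdiff_nonempty]
      exact fun h => hτ.1 (le_antisymm h hτ.2.2)
    obtain ⟨k, hk⟩ := Nat.exists_eq_succ_of_ne_zero h2.ne'
    rw [← h1, hk, Nat.succ_sub_one, pow_add, pow_succ]
    ring

/-- For the sphere of the right dimension `1 - χ` is `(-1) ^ (d - #ρ)`, so the dependence on `ρ`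
cancels. -/
lemma starCount_of_isSemiEulerian {K : AbstractSimplicialComplex V} {d : ℕ}
    (hK : IsSemiEulerian K d) {ρ : Finset V} (hρ : ρ ∈ K.faces) :
    starCount (allFaces K) ρ = (-1) ^ d := by
  rw [starCount_eq_eulerChar K hρ, hK ρ hρ, sphereEulerChar, sub_add_cancel_left]
  have : (((d : ℤ) - ρ.card - 1).negOnePow : ℤ) = (-1) ^ d * (-1) ^ ρ.card * (-1) := by
    rw [Int.negOnePow_sub, Int.negOnePow_sub, Int.negOnePow_one]
    simp [Int.coe_negOnePow_natCast]
  rw [this]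
  have h2 : ((-1 : ℤ) ^ ρ.card) * (-1) ^ ρ.card = 1 := by
    rw [← mul_pow]; simp
  linear_combination ((-1 : ℤ)) ^ d * h2

/-- Extend a homeomorphism of realizations by zero. -/
lemma exists_maps_of_homeomorphic {K : AbstractSimplicialComplex V}
    {L : AbstractSimplicialComplex W} (h : Homeomorphic K L) :
    ∃ (f : (V → ℝ) → (W → ℝ)) (g : (W → ℝ) → (V → ℝ)),
      ContinuousOn f (geom (allFaces K)) ∧ Set.MapsTo f (geom (allFaces K)) (geom (allFaces L)) ∧
      ContinuousOn g (geom (allFaces L)) ∧ Set.MapsTo g (geom (allFaces L)) (geom (allFaces K)) ∧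
      (∀ x ∈ geom (allFaces K), g (f x) = x) ∧ ∀ x ∈ geom (allFaces L), f (g x) = x := by
  classical
  obtain ⟨e⟩ := h
  rw [realization_eq_geom, realization_eq_geom] at e
  set A := geom (allFaces K)
  set B := geom (allFaces L)
  refine ⟨fun x => if h : x ∈ A then (e ⟨x, h⟩ : W → ℝ) else 0,
    fun y => if h : y ∈ B then (e.symm ⟨y, h⟩ : V → ℝ) else 0, ?_, ?_, ?_, ?_, ?_, ?_⟩
  · rw [continuousOn_iff_continuous_domRestrict]
    have : A.domRestrict (fun x => if h : x ∈ A then (e ⟨x, h⟩ : W → ℝ) else 0) =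
        fun x => (e x : W → ℝ) := by
      funext x; simp [Set.domRestrict]
    rw [this]
    exact continuous_subtype_val.comp e.continuous
  · intro x hx
    simp only [hx, dif_pos]
    exact (e ⟨x, hx⟩).2
  · rw [continuousOn_iff_continuous_domRestrict]
    have : B.domRestrict (fun y => if h : y ∈ B then (e.symm ⟨y, h⟩ : V → ℝ) else 0) =
        fun x => (e.symm x : V → ℝ) := by
      funext x; simp [Set.domRestrict]
    rw [this]
    exact continuous_subtype_val.comp e.symm.continuous
  · intro x hx
    simp only [hx, dif_pos]
    exact (e.symm ⟨x, hx⟩).2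
  · intro x hx
    simp [hx]
  · intro x hx
    simp [hx]

/-- The star counts of nonempty faces and the reduced Euler characteristic carry over from a
semi-Eulerian complex to every complex homeomorphic to it. -/
theorem starCount_of_homeomorphic {K : AbstractSimplicialComplex V}
    {L : AbstractSimplicialComplex W}
    (h : Homeomorphic K L) {d : ℕ} (hL : IsSemiEulerian L d) :
    signedCount (allFaces K) = signedCount (allFaces L) ∧
      ∀ ρ ∈ K.faces, starCount (allFaces K) ρ = (-1) ^ d := by
  obtain ⟨f, g, hf, hfm, hg, hgm, hgf, hfg⟩ := exists_maps_of_homeomorphic h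
  have htot := signedCount_eq_of_homeomorph (isLowerSet_allFaces K) (empty_mem_allFaces K)
    (isLowerSet_allFaces L) (empty_mem_allFaces L) hf hfm hg hgm hgf hfg
  refine ⟨htot, fun ρ hρ => ?_⟩
  have hρne := nonempty_of_mem_faces hρ
  have hcard : (0 : ℝ) < ρ.card := by exact_mod_cast hρne.card_pos
  -- The barycentre of `ρ`; only its support matters.
  obtain ⟨x, hx, hxρ⟩ : ∃ x ∈ geom (allFaces K), supp x = ρ := by
    classical
    have hs : supp (fun v : V => if v ∈ ρ then (1 : ℝ) / ρ.card else 0) = ρ := by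
      ext v
      rw [mem_supp]
      by_cases hv : v ∈ ρ
      · simp [hv, hρne.ne_empty]
      · simp [hv]
    refine ⟨_, ⟨⟨fun v => ?_, ?_⟩, by rw [hs]; exact Or.inr hρ⟩, hs⟩
    · split_ifs
      · positivity
      · exact le_rfl
    · rw [Finset.sum_ite_mem, Finset.univ_inter, Finset.sum_const, nsmul_eq_mul]
      field_simp
  have hloc := signedCount_costar_eq (isLowerSet_allFaces K) (empty_mem_allFaces K)
    (isLowerSet_allFaces L) (empty_mem_allFaces L) hf hfm hg hgm hgf hfg hx
  -- The total count and the count off the open star are both invariant, hence so is their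
  -- difference, the star count.
  have h1 := signedCount_eq_add (allFaces K) (supp x)
  have h2 := signedCount_eq_add (allFaces L) (supp (f x))
  have h3 := starCount_of_isSemiEulerian hL
    (mem_faces_of_mem_allFaces (hfm hx).2 (supp_nonempty (hfm hx).1))
  rw [hxρ] at h1 hloc
  linarith

end

/-! ### Fine `h`-numbers and the Dehn–Sommerville relations. -/

section

/-- The coefficient of `f_c` in `h_b`, for one colour. -/
def hCoeff (a b c : ℕ) : ℝ := if c ≤ b then (-1) ^ (b - c) * ((a - c).choose (b - c) : ℝ) else 0

open Polynomial in
lemma coeff_one_sub_X_pow (n k : ℕ) :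
    ((1 - X : ℝ[X]) ^ n).coeff k = (-1) ^ k * (n.choose k : ℝ) := by
  have h : (1 - X : ℝ[X]) ^ n = ((1 + X : ℝ[X]) ^ n).comp (C (-1) * X) := by
    simp [sub_eq_add_neg]
  rw [h, comp_C_mul_X_coeff, coeff_one_add_X_pow, mul_comm]

-- The one-colour form of the Dehn–Sommerville reversal. It compares coefficients of `X ^ (a - b)`
-- after multiplying the binomial expansion of `(X + (1 - X)) ^ k = 1` by `(1 - X) ^ (a - k)`.
open Polynomial in
lemma sum_choose_mul_hCoeff {a b k : ℕ} (hb : b ≤ a) (hk : k ≤ a) :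
    ∑ c ∈ Finset.Iic (a - b), (k.choose c : ℝ) * hCoeff a (a - b) c =
      (-1) ^ (a - k) * hCoeff a b k := by
  have hpoly : ∑ c ∈ Finset.range (k + 1),
      (C (k.choose c : ℝ)) * (X ^ c * (1 - X : ℝ[X]) ^ (a - c)) =
      (1 - X : ℝ[X]) ^ (a - k) := by
    have h1 : (X + (1 - X) : ℝ[X]) ^ k = 1 := by simp
    rw [add_pow] at h1
    calc _ = ∑ c ∈ Finset.range (k + 1), (1 - X : ℝ[X]) ^ (a - k) *
          (X ^ c * (1 - X : ℝ[X]) ^ (k - c) * (k.choose c : ℝ[X])) := by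
          refine Finset.sum_congr rfl fun c hc => ?_
          have hc' : c ≤ k := Nat.lt_succ_iff.1 (Finset.mem_range.1 hc)
          rw [show a - c = (a - k) + (k - c) by omega, pow_add, C_eq_natCast]
          ring
      _ = _ := by rw [← Finset.mul_sum, h1, mul_one]
  have h2 := congrArg (fun p => coeff p (a - b)) hpoly
  simp only [finsetSum_coeff, coeff_C_mul, coeff_X_pow_mul', coeff_one_sub_X_pow] at h2
  have h3 : ∑ c ∈ Finset.Iic (a - b), (k.choose c : ℝ) * hCoeff a (a - b) c =
      (-1) ^ (a - b) * ((a - k).choose (a - b) : ℝ) := by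
    rw [← h2]
    have e1 : ∀ c ∈ Finset.Iic (a - b), (k.choose c : ℝ) * hCoeff a (a - b) c =
        (k.choose c : ℝ) * if c ≤ a - b then (-1) ^ (a - b - c) * ((a - c).choose (a - b - c) : ℝ)
          else 0 := fun c _ => rfl
    rw [Finset.sum_congr rfl e1]
    rw [Finset.sum_subset (Finset.subset_union_left (s₂ := Finset.range (k + 1)))]
    · symm
      apply Finset.sum_subset Finset.subset_union_right
      intro c _ hc
      rw [Nat.choose_eq_zero_of_lt (by simpa using hc)]
      simp
    · intro c _ hc
      rw [if_neg (by simpa using hc), mul_zero]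
  rw [h3, hCoeff]
  split_ifs with h
  · rw [← Nat.choose_symm (by omega : a - b ≤ a - k), ← mul_assoc, ← pow_add,
      show a - k - (a - b) = b - k by omega]
    congr 1
    rw [show a - k + (b - k) = (a - b) + 2 * (b - k) by omega, pow_add, pow_mul]
    simp
  · rw [Nat.choose_eq_zero_of_lt (by omega)]
    simp

/-- The binomial coefficient counts the `c`-subsets of an `a`-set containing a fixed `s`-subset; the
`h`-transform inverts this count. -/
lemma sum_choose_mul_hCoeff_eq {a b s : ℕ} :
    ∑ c ∈ Finset.Iic b, (if s ≤ c then ((a - s).choose (c - s) : ℝ) else 0) * hCoeff a b c =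
      if s = b then 1 else 0 := by
  by_cases hsb : s ≤ b
  · have h1 : ∀ c ∈ Finset.Icc s b,
        (if s ≤ c then ((a - s).choose (c - s) : ℝ) else 0) * hCoeff a b c =
          ((a - s).choose (b - s) : ℝ) * ((-1) ^ (b - c) * ((b - s).choose (c - s) : ℝ)) := by
      intro c hc
      obtain ⟨h1, h2⟩ := Finset.mem_Icc.1 hc
      rw [if_pos h1, hCoeff, if_pos h2]
      have := Nat.choose_mul (n := a - s) (k := b - s) (s := c - s) (by omega)
      rw [show a - s - (c - s) = a - c by omega, show b - s - (c - s) = b - c by omega] at this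
      have h3 : ((a - s).choose (b - s) : ℝ) * ((b - s).choose (c - s) : ℝ) =
          ((a - s).choose (c - s) : ℝ) * ((a - c).choose (b - c) : ℝ) := by exact_mod_cast this
      linear_combination (-(-1 : ℝ) ^ (b - c)) * h3
    have h2 : ∑ c ∈ Finset.Icc s b, (-1 : ℝ) ^ (b - c) * ((b - s).choose (c - s) : ℝ) =
        if s = b then 1 else 0 := by
      have h := Int.alternating_sum_range_choose (n := b - s)
      have h' : ∑ i ∈ Finset.range (b - s + 1), (-1 : ℝ) ^ i * ((b - s).choose i : ℝ) =
          if b - s = 0 then 1 else 0 := by exact_mod_cast congrArg (Int.cast : ℤ → ℝ) h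
      have hiff : (b - s = 0) ↔ (s = b) := by omega
      simp only [hiff] at h'
      rw [← h']
      refine Finset.sum_bij' (fun c _ => b - c) (fun i _ => b - i) ?_ ?_ ?_ ?_ ?_
      · intro c hc; simp only [Finset.mem_Icc, Finset.mem_range] at *; omega
      · intro c hc; simp only [Finset.mem_Icc, Finset.mem_range] at *; omega
      · intro c hc; simp only [Finset.mem_Icc] at *; omega
      · intro c hc; simp only [Finset.mem_range] at *; omega
      · intro c hc
        obtain ⟨h1, h2⟩ := Finset.mem_Icc.1 hc
        rw [← Nat.choose_symm (by omega : c - s ≤ b - s), show b - s - (c - s) = b - c by omega]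
    rw [← Finset.sum_subset (s₁ := Finset.Icc s b) (by intro c; simp), Finset.sum_congr rfl h1,
      ← Finset.mul_sum, h2]
    · split_ifs with h
      · subst h; simp
      · simp
    · intro c hc hc'
      rw [if_neg, zero_mul]
      simp only [Finset.mem_Iic, Finset.mem_Icc, not_and] at hc hc'
      exact fun h => hc' h hc
  · rw [if_neg (by omega), Finset.sum_eq_zero]
    intro c hc
    rw [if_neg (by have := Finset.mem_Iic.1 hc; omega), zero_mul]

lemma sum_Iic_prod {m : ℕ} (b : Fin m → ℕ) (F : Fin m → ℕ → ℝ) :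
    ∑ c ∈ Finset.Iic b, ∏ i, F i (c i) = ∏ i, ∑ c ∈ Finset.Iic (b i), F i c := by
  rw [Finset.prod_univ_sum]
  rfl

section counting

variable {V : Type*} {m : ℕ}

lemma colorCount_mono {φ : V → Fin m} {s t : Finset V} (h : s ⊆ t) (j : Fin m) :
    colorCount φ s j ≤ colorCount φ t j :=
  Finset.card_le_card (Finset.filter_subset_filter _ h)

lemma sum_colorCount (φ : V → Fin m) (s : Finset V) : ∑ j, colorCount φ s j = s.card := by
  classical
  rw [Finset.card_eq_sum_card_fiberwise (f := φ) (t := Finset.univ) (by simp)]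
  unfold colorCount
  exact Finset.sum_congr rfl fun j _ => by congr 1

/-- The number of subsets with a prescribed number of elements of each colour. -/
lemma card_filter_colorCount [DecidableEq V] (φ : V → Fin m) (X : Finset V) (c : Fin m → ℕ) :
    (X.powerset.filter fun S => ∀ j, colorCount φ S j = c j).card =
      ∏ j, (colorCount φ X j).choose (c j) := by
  classical
  have h : ∏ j, (colorCount φ X j).choose (c j) = (Fintype.piFinset fun j =>
      (X.filter fun v => φ v = j).powersetCard (c j)).card := by
    rw [Fintype.card_piFinset]
    exact Finset.prod_congr rfl fun j _ => by
      rw [Finset.card_powersetCard]; rfl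
  rw [h]
  refine Finset.card_bij' (fun S _ j => S.filter fun v => φ v = j)
    (fun F _ => Finset.univ.biUnion F) ?_ ?_ ?_ ?_
  · intro S hS
    simp only [Finset.mem_filter, Finset.mem_powerset] at hS
    rw [Fintype.mem_piFinset]
    intro j
    rw [Finset.mem_powersetCard]
    refine ⟨Finset.filter_subset_filter _ hS.1, ?_⟩
    rw [← hS.2 j]; unfold colorCount; congr! 2
  · intro F hF
    rw [Fintype.mem_piFinset] at hF
    simp only [Finset.mem_powersetCard] at hF
    simp only [Finset.mem_filter, Finset.mem_powerset]
    refine ⟨?_, fun j => ?_⟩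
    · intro v hv
      obtain ⟨j, -, hj⟩ := Finset.mem_biUnion.1 hv
      exact (Finset.mem_filter.1 ((hF j).1 hj)).1
    · rw [← (hF j).2]
      unfold colorCount
      congr 1
      ext v
      simp only [Finset.mem_filter, Finset.mem_biUnion, Finset.mem_univ, true_and]
      constructor
      · rintro ⟨⟨i, hi⟩, rfl⟩
        rwa [(Finset.mem_filter.1 ((hF i).1 hi)).2]
      · exact fun h => ⟨⟨j, h⟩, (Finset.mem_filter.1 ((hF j).1 h)).2⟩
  · intro S _
    ext v
    simp
  · intro F hF
    rw [Fintype.mem_piFinset] at hF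
    simp only [Finset.mem_powersetCard] at hF
    funext j
    ext v
    simp only [Finset.mem_filter, Finset.mem_biUnion, Finset.mem_univ, true_and]
    constructor
    · rintro ⟨⟨i, hi⟩, rfl⟩
      rwa [(Finset.mem_filter.1 ((hF i).1 hi)).2]
    · exact fun h => ⟨⟨j, h⟩, (Finset.mem_filter.1 ((hF j).1 h)).2⟩

end counting

section

variable {V : Type*} [Fintype V] {m : ℕ}

open scoped Classical in
/-- The number of elements of a set of faces with prescribed colour counts. -/
def typeCount (K : Set (Finset V)) (φ : V → Fin m) (c : Fin m → ℕ) : ℝ :=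
  ∑ τ : Finset V with τ ∈ K, if (∀ j, colorCount φ τ j = c j) then 1 else 0

lemma fineF_eq_typeCount (K : AbstractSimplicialComplex V) (φ : V → Fin m) (c : Fin m → ℕ) :
    (fineF K φ c : ℝ) = typeCount (allFaces K) φ c := by
  classical
  unfold fineF typeCount
  rw [Finset.sum_boole, Finset.filter_filter, ← Set.ncard_coe_finset]
  congr 2
  ext τ
  simp [allFaces]

open scoped Classical in
/-- The fine `h`-vector as a sum over all faces. -/
lemma fineH_eq_sum (K : AbstractSimplicialComplex V) (φ : V → Fin m) (a : Fin m → ℕ)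
    (b : Set.Iic a) : fineH K φ a b =
      ∑ τ : Finset V with τ ∈ allFaces K, ∏ i, hCoeff (a i) (b.1 i) (colorCount φ τ i) := by
  have h1 : fineH K φ a b = ∑ c ∈ Finset.Iic (b : Fin m → ℕ),
      typeCount (allFaces K) φ c * ∏ i, hCoeff (a i) (b.1 i) (c i) := by
    unfold fineH
    refine Finset.sum_congr rfl fun c hc => ?_
    rw [fineF_eq_typeCount]
    congr 1
    refine Finset.prod_congr rfl fun i _ => ?_
    rw [hCoeff, if_pos (Finset.mem_Iic.1 hc i)]
  rw [h1]
  unfold typeCount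
  simp_rw [Finset.sum_mul]
  rw [Finset.sum_comm]
  refine Finset.sum_congr rfl fun τ _ => ?_
  have h2 : ∀ c : Fin m → ℕ, (∀ j, colorCount φ τ j = c j) ↔ colorCount φ τ = c :=
    fun c => funext_iff.symm
  simp_rw [h2, ite_mul, one_mul, zero_mul]
  rw [Finset.sum_ite_eq]
  split_ifs with h
  · rfl
  · rw [Finset.mem_Iic, Pi.le_def, not_forall] at h
    obtain ⟨i, hi⟩ := h
    exact (Finset.prod_eq_zero (Finset.mem_univ i) (by rw [hCoeff, if_neg hi])).symm

end

section

variable {V : Type*} [Fintype V] {m : ℕ} {K : AbstractSimplicialComplex V} {φ : V → Fin m}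
  {a : Fin m → ℕ}

lemma exists_isFacet (K : AbstractSimplicialComplex V) {s : Finset V} (hs : s ∈ K.faces) :
    ∃ σ, IsFacet K σ ∧ s ⊆ σ := by
  obtain ⟨σ, h1, h2⟩ := (Set.toFinite K.faces).exists_le_maximal hs
  exact ⟨σ, h2, h1⟩

lemma colorCount_le (hb : ∀ σ, IsFacet K σ → ∀ j, colorCount φ σ j = a j) {τ : Finset V}
    (hτ : τ ∈ allFaces K) (j : Fin m) : colorCount φ τ j ≤ a j := by
  rcases hτ with rfl | hτ
  · simp [colorCount]
  · obtain ⟨σ, hσ, h⟩ := exists_isFacet K hτ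
    exact (colorCount_mono h j).trans (hb σ hσ j).le

lemma fineH_zero (K : AbstractSimplicialComplex V) (φ : V → Fin m) (a : Fin m → ℕ)
    (h0 : (0 : Fin m → ℕ) ∈ Set.Iic a) : fineH K φ a ⟨0, h0⟩ = 1 := by
  classical
  rw [fineH_eq_sum, Finset.sum_eq_single ∅]
  · simp [hCoeff, colorCount]
  · intro τ _ hne
    obtain ⟨v, hv⟩ := Finset.nonempty_iff_ne_empty.2 hne
    refine Finset.prod_eq_zero (Finset.mem_univ (φ v)) ?_
    rw [hCoeff, if_neg]
    have : 0 < colorCount φ τ (φ v) :=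
      Finset.card_pos.2 ⟨v, Finset.mem_filter.2 ⟨hv, rfl⟩⟩
    simp only [Pi.zero_apply]
    omega
  · intro h
    exact absurd (empty_mem_allFaces K) (by simpa using h)

/-- The generalized Dehn–Sommerville relations. -/
theorem fineH_reverse (hb : ∀ σ, IsFacet K σ → ∀ j, colorCount φ σ j = a j)
    {d : ℕ} (had : ∑ j, a j = d)
    (hstar : ∀ ρ ∈ K.faces, starCount (allFaces K) ρ = (-1) ^ d) (b b' : Set.Iic a)
    (hbb : ∀ j, b'.1 j = a j - b.1 j) :
    fineH K φ a b' = fineH K φ a b -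
      ((-1) ^ d * (signedCount (allFaces K) : ℝ) - 1) * ∏ i, hCoeff (a i) (b'.1 i) 0 := by
  classical
  set e : ℝ := (-1) ^ d * (signedCount (allFaces K) : ℝ) - 1 with he
  -- Double counting of pairs `ρ ⊆ τ` with `ρ` of type `c`: the signed sum over `τ` is the star
  -- count of `ρ`, equal to `(-1) ^ d` unless `ρ` is empty. The empty face has type `0` only, and
  -- `e` is its deviation.
  have hf : ∀ c : Fin m → ℕ, typeCount (allFaces K) φ c =
      (-1) ^ d * (∑ τ : Finset V with τ ∈ allFaces K, (-1) ^ τ.card *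
        ∏ j, ((colorCount φ τ j).choose (c j) : ℝ)) - if c = 0 then e else 0 := by
    intro c
    have h1 : ∀ τ : Finset V, ∏ j, ((colorCount φ τ j).choose (c j) : ℝ) =
        ∑ ρ : Finset V, if ρ ⊆ τ ∧ ∀ j, colorCount φ ρ j = c j then 1 else 0 := by
      intro τ
      rw [← Nat.cast_prod, ← card_filter_colorCount, Finset.sum_boole]
      congr 2
      ext ρ
      simp
    have h2 : ∑ τ : Finset V with τ ∈ allFaces K, (-1 : ℝ) ^ τ.card *
        ∏ j, ((colorCount φ τ j).choose (c j) : ℝ) =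
        ∑ ρ : Finset V with ρ ∈ allFaces K, if (∀ j, colorCount φ ρ j = c j) then
          (starCount (allFaces K) ρ : ℝ) else 0 := by
      simp_rw [h1, Finset.mul_sum]
      rw [Finset.sum_comm, Finset.sum_filter]
      refine Finset.sum_congr rfl fun ρ _ => ?_
      unfold starCount
      push_cast
      rw [← Finset.filter_filter, Finset.sum_filter (p := fun τ => ρ ⊆ τ)]
      by_cases hρ : ρ ∈ allFaces K
      · rw [if_pos hρ]
        split_ifs with hc
        · refine Finset.sum_congr rfl fun τ _ => ?_
          split_ifs with h3 h4 h4
          · rw [mul_one]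
          · exact absurd h3.1 h4
          · exact absurd ⟨h4, hc⟩ h3
          · rw [mul_zero]
        · refine Finset.sum_eq_zero fun τ _ => ?_
          rw [if_neg fun h => hc h.2, mul_zero]
      · rw [if_neg hρ]
        refine Finset.sum_eq_zero fun τ hτ => ?_
        rw [if_neg, mul_zero]
        exact fun h => hρ (isLowerSet_allFaces K h.1 (Finset.mem_filter.1 hτ).2)
    rw [h2]
    have hsq : ((-1 : ℝ) ^ d) * (-1) ^ d = 1 := by rw [← mul_pow]; simp
    have h3 : ∀ ρ ∈ Finset.univ.filter fun ρ : Finset V => ρ ∈ allFaces K,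
        (if (∀ j, colorCount φ ρ j = c j) then (starCount (allFaces K) ρ : ℝ) else 0) =
        (-1) ^ d * (if (∀ j, colorCount φ ρ j = c j) then 1 else 0) +
          if ρ = ∅ then (if c = 0 then (-1) ^ d * e else 0) else 0 := by
      intro ρ hρ
      have hρ' := (Finset.mem_filter.1 hρ).2
      by_cases h0 : ρ = ∅
      · subst h0
        have hc : (∀ j, colorCount φ ∅ j = c j) ↔ c = 0 := by
          rw [funext_iff]
          refine forall_congr' fun j => ?_
          simp only [colorCount, Finset.filter_empty, Finset.card_empty, Pi.zero_apply]
          exact eq_comm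
        have hs : starCount (allFaces K) ∅ = signedCount (allFaces K) := by
          unfold starCount signedCount
          simp
        simp only [hc, if_true, hs]
        split_ifs
        · rw [he]; linear_combination (-(signedCount (allFaces K) : ℝ)) * hsq
        · simp
      · rw [if_neg h0, add_zero, hstar ρ (mem_faces_of_mem_allFaces hρ'
          (Finset.nonempty_iff_ne_empty.2 h0))]
        split_ifs <;> simp
    rw [Finset.sum_congr rfl h3, Finset.sum_add_distrib, ← Finset.mul_sum, Finset.sum_ite_eq',
      if_pos (by simpa using empty_mem_allFaces K)]
    unfold typeCount
    split_ifs
    · linear_combination (-(∑ τ : Finset V with τ ∈ allFaces K,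
        if (∀ j, colorCount φ τ j = c j) then (1 : ℝ) else 0) - e) * hsq
    · linear_combination (-(∑ τ : Finset V with τ ∈ allFaces K,
        if (∀ j, colorCount φ τ j = c j) then (1 : ℝ) else 0)) * hsq
  have hH : fineH K φ a b' = ∑ c ∈ Finset.Iic (b' : Fin m → ℕ),
      typeCount (allFaces K) φ c * ∏ i, hCoeff (a i) (b'.1 i) (c i) := by
    unfold fineH
    refine Finset.sum_congr rfl fun c hc => ?_
    rw [fineF_eq_typeCount]
    congr 1
    refine Finset.prod_congr rfl fun i _ => ?_
    rw [hCoeff, if_pos (Finset.mem_Iic.1 hc i)]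
  rw [hH, fineH_eq_sum]
  simp_rw [hf, sub_mul]
  rw [Finset.sum_sub_distrib]
  congr 1
  -- Each `τ` now contributes a product over the colours, where `sum_choose_mul_hCoeff` applies
  -- factor by factor; the total sign exponent is `2 * d`.
  · simp_rw [mul_assoc, Finset.sum_mul]
    rw [← Finset.mul_sum, Finset.sum_comm, Finset.mul_sum]
    refine Finset.sum_congr rfl fun τ hτ => ?_
    have hle := colorCount_le hb (Finset.mem_filter.1 hτ).2
    have h1 : ∀ c : Fin m → ℕ, (-1 : ℝ) ^ τ.card * (∏ j, ((colorCount φ τ j).choose (c j) : ℝ)) *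
        ∏ i, hCoeff (a i) (b'.1 i) (c i) = (-1) ^ τ.card *
          ∏ i, ((colorCount φ τ i).choose (c i) : ℝ) * hCoeff (a i) (b'.1 i) (c i) := fun c => by
      rw [Finset.prod_mul_distrib, mul_assoc]
    simp_rw [mul_assoc] at h1
    simp_rw [mul_assoc, h1]
    rw [← Finset.mul_sum, sum_Iic_prod (b' : Fin m → ℕ)
      fun i c => ((colorCount φ τ i).choose c : ℝ) * hCoeff (a i) (b'.1 i) c]
    have h2 : ∀ i, ∑ c ∈ Finset.Iic (b'.1 i), ((colorCount φ τ i).choose c : ℝ) *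
        hCoeff (a i) (b'.1 i) c =
        (-1) ^ (a i - colorCount φ τ i) * hCoeff (a i) (b.1 i) (colorCount φ τ i) := fun i => by
      rw [hbb i]
      exact sum_choose_mul_hCoeff (b.2 i) (hle i)
    simp_rw [h2]
    rw [Finset.prod_mul_distrib, Finset.prod_pow_eq_pow_sum, ← mul_assoc, ← mul_assoc, ← pow_add,
      ← pow_add]
    have h3 : d + τ.card + ∑ i, (a i - colorCount φ τ i) = 2 * d := by
      rw [← sum_colorCount φ τ, ← had, add_assoc, ← Finset.sum_add_distrib, two_mul]
      congr 1
      exact Finset.sum_congr rfl fun i _ => by have := hle i; omega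
    rw [h3, pow_mul]
    simp
  · simp_rw [ite_mul, zero_mul]
    rw [Finset.sum_ite_eq', if_pos (by simp)]
    rfl

end

end

/-! ### The barycentric subdivision is homeomorphic to the complex. -/

section

section homeo

variable {V W : Type*} [Fintype V] [Fintype W]

/-- A continuous bijection from a compact space to a Hausdorff space is a homeomorphism, so inverses
of subdivision maps need no continuity proof. -/
lemma nonempty_homeomorph_of_bijOn {K : Set (Finset V)} {L : Set (Finset W)} (hL : IsLowerSet L)
    {Φ : (W → ℝ) → (V → ℝ)} (hΦ : Continuous Φ) (hb : Set.BijOn Φ (geom L) (geom K)) :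
    Nonempty (geom L ≃ₜ geom K) := by
  have : CompactSpace (geom L) := isCompact_iff_compactSpace.1 (isCompact_geom hL)
  let e : geom L ≃ geom K := Set.BijOn.equiv Φ hb
  have he : Continuous e := by
    refine Continuous.subtype_mk (hΦ.comp continuous_subtype_val) _
  exact ⟨he.homeoOfEquivCompactToT2⟩

end homeo

section barycentric

variable {V : Type*} [Fintype V]

/-- `W` is a decomposition of `z` as a nonnegative combination of indicators of a chain of nonempty
sets. -/
structure IsChainDecomp (W : Finset V → ℝ) (z : V → ℝ) : Prop where
  nonneg : ∀ s, 0 ≤ W s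
  chain : ∀ s t, W s ≠ 0 → W t ≠ 0 → s ⊆ t ∨ t ⊆ s
  empty : W ∅ = 0
  eq_sum : ∀ v, z v = ∑ s, Set.indicator {s : Finset V | v ∈ s} W s

namespace IsChainDecomp

variable {W W' : Finset V → ℝ} {z : V → ℝ}

lemma le_apply (h : IsChainDecomp W z) {s : Finset V} {v : V} (hv : v ∈ s) : W s ≤ z v := by
  rw [h.eq_sum]
  have := Finset.single_le_sum (f := fun s => Set.indicator {s : Finset V | v ∈ s} W s)
    (fun s _ => Set.indicator_nonneg (fun s _ => h.nonneg s) s) (Finset.mem_univ s)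
  rwa [Set.indicator_of_mem (show s ∈ {s : Finset V | v ∈ s} from hv)] at this

lemma apply_nonneg (h : IsChainDecomp W z) (v : V) : 0 ≤ z v := by
  rw [h.eq_sum]
  exact Finset.sum_nonneg fun s _ => Set.indicator_nonneg (fun s _ => h.nonneg s) s

lemma subset_supp (h : IsChainDecomp W z) {s : Finset V} (hs : W s ≠ 0) : s ⊆ supp z := by
  intro v hv
  have h1 := h.le_apply hv
  have h2 := lt_of_le_of_ne (h.nonneg s) hs.symm
  exact mem_supp.2 (by linarith : 0 < z v).ne'

/-- A vertex of the support outside the largest smaller member of the chain lies in the top member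
only, and so reads off its weight. -/
lemma exists_apply_eq (h : IsChainDecomp W z) (hz : (supp z).Nonempty) :
    ∃ v ∈ supp z, z v = W (supp z) := by
  classical
  obtain ⟨v, hv, hvs⟩ : ∃ v ∈ supp z, ∀ s, W s ≠ 0 → s ≠ supp z → v ∉ s := by
    by_cases hex : ∃ s, W s ≠ 0 ∧ s ≠ supp z
    · obtain ⟨s₀, hs₀⟩ := hex
      obtain ⟨t, -, ht⟩ := (Set.toFinite {s | W s ≠ 0 ∧ s ≠ supp z}).exists_le_maximal hs₀
      have hsub := h.subset_supp ht.1.1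
      obtain ⟨v, hv, hvt⟩ := Finset.exists_of_ssubset (lt_of_le_of_ne hsub ht.1.2)
      refine ⟨v, hv, fun s hs hs' hvs => hvt ?_⟩
      rcases h.chain s t hs ht.1.1 with h1 | h1
      · exact h1 hvs
      · exact ht.2 ⟨hs, hs'⟩ h1 hvs
    · push Not at hex
      obtain ⟨v, hv⟩ := hz
      exact ⟨v, hv, fun s hs hs' => absurd (hex s hs) hs'⟩
  refine ⟨v, hv, ?_⟩
  rw [h.eq_sum, Finset.sum_eq_single (supp z)]
  · exact Set.indicator_of_mem (show supp z ∈ {s : Finset V | v ∈ s} from hv) W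
  · intro s _ hs
    by_cases hW : W s = 0
    · rw [Set.indicator_apply]; split_ifs <;> simp [hW]
    · exact Set.indicator_of_notMem (show s ∉ {s : Finset V | v ∈ s} from hvs s hW hs) W
  · exact fun h => absurd (Finset.mem_univ _) h

open scoped Classical in
lemma update (h : IsChainDecomp W z) (t : Finset V) : IsChainDecomp (Function.update W t 0)
    (fun v => z v - if v ∈ t then W t else 0) where
  nonneg s := by
    rw [Function.update_apply]
    split_ifs
    · exact le_rfl
    · exact h.nonneg s
  chain s s' hs hs' := by
    rw [Function.update_apply] at hs hs'
    refine h.chain s s' ?_ ?_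
    · intro h0; split_ifs at hs <;> simp_all
    · intro h0; split_ifs at hs' <;> simp_all
  empty := by
    rw [Function.update_apply]
    split_ifs
    · rfl
    · exact h.empty
  eq_sum v := by
    rw [h.eq_sum, sub_eq_iff_eq_add, ← Finset.add_sum_erase _ _ (Finset.mem_univ t),
      ← Finset.add_sum_erase (a := t) Finset.univ
        (fun s => Set.indicator {s : Finset V | v ∈ s} (Function.update W t 0) s)
        (Finset.mem_univ t)]
    have h1 : ∑ s ∈ Finset.univ.erase t,
        Set.indicator {s : Finset V | v ∈ s} (Function.update W t 0) s =
        ∑ s ∈ Finset.univ.erase t, Set.indicator {s : Finset V | v ∈ s} W s := by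
      refine Finset.sum_congr rfl fun s hs => ?_
      rw [Set.indicator_apply, Set.indicator_apply,
        Function.update_of_ne (Finset.ne_of_mem_erase hs)]
    rw [h1, Set.indicator_apply, Set.indicator_apply, Function.update_self]
    simp only [Set.mem_ofPred_eq, ite_self]
    ring

lemma supp_sub_ssubset (h : IsChainDecomp W z) (hz : (supp z).Nonempty) :
    open scoped Classical in
    supp (fun v => z v - if v ∈ supp z then W (supp z) else 0) ⊂ supp z := by
  classical
  obtain ⟨v, hv, hvz⟩ := h.exists_apply_eq hz
  refine (Finset.ssubset_iff_of_subset fun w hw => ?_).2 ⟨v, hv, ?_⟩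
  · by_contra hw'
    rw [mem_supp, if_neg hw', notMem_supp.1 hw'] at hw
    simp at hw
  · rw [notMem_supp, if_pos hv, hvz, sub_self]

/-- The weight of the top set is the least coordinate of `z` on its support, hence determined;
subtracting it gives a smaller support. -/
lemma unique (h : IsChainDecomp W z) (h' : IsChainDecomp W' z) : W = W' := by
  classical
  generalize hn : (supp z).card = n
  induction n using Nat.strong_induction_on generalizing z W W' with
  | _ n ih =>
    by_cases hz : (supp z).Nonempty
    · have heq : W (supp z) = W' (supp z) := by
        obtain ⟨v, hv, hvz⟩ := h.exists_apply_eq hz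
        obtain ⟨v', hv', hvz'⟩ := h'.exists_apply_eq hz
        exact le_antisymm (hvz' ▸ h.le_apply hv') (hvz ▸ h'.le_apply hv)
      have h1 := h.update (supp z)
      have h2 := h'.update (supp z)
      rw [← heq] at h2
      have h3 := ih _ (hn ▸ Finset.card_lt_card (h.supp_sub_ssubset hz)) h1 h2 rfl
      funext s
      by_cases hs : s = supp z
      · rw [hs, heq]
      · have := congrFun h3 s
        rwa [Function.update_of_ne hs, Function.update_of_ne hs] at this
    · rw [Finset.not_nonempty_iff_eq_empty] at hz
      have key : ∀ {W : Finset V → ℝ}, IsChainDecomp W z → W = 0 := fun {W} h => by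
        funext s
        by_contra hs
        have hsub := h.subset_supp hs
        rw [hz, Finset.subset_empty] at hsub
        rw [hsub] at hs
        exact hs h.empty
      rw [key h, key h']

end IsChainDecomp

/-- Greedy peeling: subtract the least positive coordinate on the whole support. The sets used for
the remainder all lie in a proper subset of `supp z`, so adding `supp z` keeps a chain. -/
lemma exists_isChainDecomp {z : V → ℝ} (hz : ∀ v, 0 ≤ z v) : ∃ W, IsChainDecomp W z := by
  classical
  generalize hn : (supp z).card = n
  induction n using Nat.strong_induction_on generalizing z with
  | _ n ih =>
    by_cases hne : (supp z).Nonempty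
    · obtain ⟨v₀, hv₀, hmin⟩ := Finset.exists_min_image (supp z) z hne
      set z' : V → ℝ := fun v => z v - if v ∈ supp z then z v₀ else 0 with hz'
      have hpos : 0 < z v₀ := lt_of_le_of_ne (hz v₀) (Ne.symm (mem_supp.1 hv₀))
      have hz'0 : ∀ v, 0 ≤ z' v := by
        intro v
        simp only [hz']
        split_ifs with h
        · linarith [hmin v h]
        · linarith [hz v]
      have hsub : supp z' ⊂ supp z := by
        refine (Finset.ssubset_iff_of_subset fun w hw => ?_).2 ⟨v₀, hv₀, ?_⟩
        · by_contra hw'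
          simp [hz', notMem_supp.1 hw'] at hw
        · simp only [notMem_supp, hz', if_pos hv₀, sub_self]
      obtain ⟨W, hW⟩ := ih _ (hn ▸ Finset.card_lt_card hsub) hz'0 rfl
      have hW0 : W (supp z) = 0 := by
        by_contra h
        exact hsub.2 (hW.subset_supp h)
      have hval : ∀ s, Function.update W (supp z) (z v₀) s ≠ 0 → s = supp z ∨ W s ≠ 0 := by
        intro s hs
        rw [Function.update_apply] at hs
        split_ifs at hs with h
        · exact Or.inl h
        · exact Or.inr hs
      refine ⟨Function.update W (supp z) (z v₀),
        ⟨fun s => ?_, fun s t hs ht => ?_, ?_, fun v => ?_⟩⟩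
      · rw [Function.update_apply]
        split_ifs
        · exact hpos.le
        · exact hW.nonneg s
      · rcases hval s hs with rfl | hs' <;> rcases hval t ht with rfl | ht'
        · exact Or.inl le_rfl
        · exact Or.inr ((hW.subset_supp ht').trans hsub.1)
        · exact Or.inl ((hW.subset_supp hs').trans hsub.1)
        · exact hW.chain s t hs' ht'
      · rw [Function.update_of_ne hne.ne_empty.symm]
        exact hW.empty
      · have h1 := hW.eq_sum v
        rw [← Finset.add_sum_erase _ _ (Finset.mem_univ (supp z))] at h1 ⊢
        have h2 : ∑ s ∈ Finset.univ.erase (supp z),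
            Set.indicator {s : Finset V | v ∈ s} (Function.update W (supp z) (z v₀)) s =
            ∑ s ∈ Finset.univ.erase (supp z), Set.indicator {s : Finset V | v ∈ s} W s := by
          refine Finset.sum_congr rfl fun s hs => ?_
          rw [Set.indicator_apply, Set.indicator_apply,
            Function.update_of_ne (Finset.ne_of_mem_erase hs)]
        rw [h2]
        simp only [Set.indicator_apply, Set.mem_ofPred_eq, hW0, ite_self, zero_add,
          Function.update_self, hz'] at h1 ⊢
        rw [← h1]
        ring
    · rw [Finset.not_nonempty_iff_eq_empty] at hne
      refine ⟨0, ⟨fun _ => le_rfl, fun s t hs => absurd rfl hs, rfl, fun v => ?_⟩⟩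
      have : z v = 0 := notMem_supp.1 (by rw [hne]; simp)
      rw [this, Finset.sum_eq_zero]
      intro s _
      rw [Set.indicator_apply]
      split_ifs <;> rfl

/-- The barycentric subdivision: chains of nonempty faces. -/
def barycentric {V : Type*} (K : Set (Finset V)) : Set (Finset (Finset V)) :=
  {C | (∀ s ∈ C, s ∈ K ∧ s.Nonempty) ∧ ∀ s ∈ C, ∀ t ∈ C, s ⊆ t ∨ t ⊆ s}

lemma isLowerSet_barycentric {V : Type*} (K : Set (Finset V)) : IsLowerSet (barycentric K) :=
  fun _ _ h hC => ⟨fun s hs => hC.1 s (h hs), fun s hs t ht => hC.2 s (h hs) t (h ht)⟩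

/-- The barycentric subdivision of a complex is homeomorphic to it. -/
theorem nonempty_homeomorph_barycentric {K : Set (Finset V)} (hK : IsLowerSet K) :
    Nonempty (geom (barycentric K) ≃ₜ geom K) := by
  classical
  -- `Φ` sends the vertex `s` to the barycentre of the face `s`; dividing the weight by the
  -- cardinality turns a point into a chain decomposition.
  set Φ : (Finset V → ℝ) → (V → ℝ) := fun w v =>
    ∑ s, Set.indicator {s : Finset V | v ∈ s} (fun s => w s / s.card) s with hΦ
  have hdec : ∀ w ∈ geom (barycentric K), IsChainDecomp (fun s => w s / s.card) (Φ w) := by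
    rintro w ⟨hw, hwC⟩
    have hne : ∀ s, w s / (s.card : ℝ) ≠ 0 → s ∈ supp w := fun s hs =>
      mem_supp.2 fun h => hs (by rw [h, zero_div])
    exact ⟨fun s => div_nonneg (hw.1 s) (Nat.cast_nonneg _),
      fun s t hs ht => hwC.2 s (hne s hs) t (hne t ht), by simp, fun v => rfl⟩
  have hsum : ∀ w : Finset V → ℝ, ∑ v, Φ w v = ∑ s : Finset V, (s.card : ℝ) * (w s / s.card) := by
    intro w
    simp only [hΦ]
    rw [Finset.sum_comm]
    refine Finset.sum_congr rfl fun s _ => ?_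
    simp [Set.indicator_apply]
  refine nonempty_homeomorph_of_bijOn (isLowerSet_barycentric K) (Φ := Φ) ?_ ⟨?_, ?_, ?_⟩
  · refine continuous_pi fun v => continuous_finsetSum _ fun s _ => ?_
    simp only [Set.indicator_apply]
    split_ifs
    · fun_prop
    · exact continuous_const
  · intro w hw
    have hd := hdec w hw
    refine ⟨⟨hd.apply_nonneg, ?_⟩, ?_⟩
    · rw [hsum, ← hw.1.2]
      refine Finset.sum_congr rfl fun s _ => ?_
      by_cases hs : s ∈ supp w
      · have : (s.card : ℝ) ≠ 0 := by exact_mod_cast ((hw.2.1 s hs).2.card_pos).ne'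
        field_simp
      · rw [notMem_supp.1 hs]; simp
    · obtain ⟨t, ht, hmax⟩ := Finset.exists_max_image (supp w) Finset.card (supp_nonempty hw.1)
      refine hK (fun v hv => ?_) (hw.2.1 t ht).1
      by_contra hvt
      refine mem_supp.1 hv (Finset.sum_eq_zero fun s _ => ?_)
      rw [Set.indicator_apply]
      split_ifs with hvs
      · by_cases hs : s ∈ supp w
        · exfalso
          rcases hw.2.2 s hs t ht with h | h
          · exact hvt (h hvs)
          · exact hvt (Finset.eq_of_subset_of_card_le h (hmax s hs) ▸ hvs)
        · rw [notMem_supp.1 hs, zero_div]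
      · rfl
  · intro w hw w' hw' h
    have h1 := hdec w hw
    have h2 := hdec w' hw'
    rw [← h] at h2
    have h3 := h1.unique h2
    funext s
    by_cases hs : s.Nonempty
    · have : (s.card : ℝ) ≠ 0 := by exact_mod_cast hs.card_pos.ne'
      have h4 := congrFun h3 s
      field_simp at h4
      exact h4
    · have key : ∀ w ∈ geom (barycentric K), w s = 0 := fun w hw =>
        notMem_supp.1 fun h => hs (hw.2.1 s h).2
      rw [key w hw, key w' hw']
  · intro z hz
    obtain ⟨W, hW⟩ := exists_isChainDecomp hz.1.1
    have hWe : (fun s : Finset V => (s.card * W s) / (s.card : ℝ)) = W := by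
      funext s
      by_cases hs : s.Nonempty
      · have : (s.card : ℝ) ≠ 0 := by exact_mod_cast hs.card_pos.ne'
        field_simp
      · rw [Finset.not_nonempty_iff_eq_empty] at hs
        simp [hs, hW.empty]
    have hΦW : Φ (fun s => s.card * W s) = z := by
      funext v
      simp only [hΦ, hWe]
      exact (hW.eq_sum v).symm
    have hsup : ∀ s ∈ supp (fun s : Finset V => (s.card : ℝ) * W s), W s ≠ 0 := fun s hs h =>
      mem_supp.1 hs (by rw [h, mul_zero])
    refine ⟨fun s => s.card * W s, ⟨⟨fun s => mul_nonneg (Nat.cast_nonneg _) (hW.nonneg s), ?_⟩,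
      fun s hs => ⟨?_, ?_⟩, fun s hs t ht => hW.chain s t (hsup s hs) (hsup t ht)⟩, hΦW⟩
    · have := hsum (fun s => s.card * W s)
      rw [hΦW, hz.1.2] at this
      rw [this]
      exact Finset.sum_congr rfl fun s _ => by rw [congrFun hWe s]
    · exact hK (hW.subset_supp (hsup s hs)) hz.2
    · rw [Finset.nonempty_iff_ne_empty]
      rintro rfl
      exact hsup _ hs hW.empty

end barycentric

end

/-! ### The cross-polytopal subdivision is homeomorphic to the complex. -/

section

/-- Subdivide the face `G` in the pattern of a Schlegel diagram of the boundary of a cross-polytope: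
a new vertex `inr i` is opposite to each vertex `i` of `G`. -/
def crossSubdivision {V : Type*} [DecidableEq V] (K : Set (Finset V)) (G : Finset V) :
    Set (Finset (V ⊕ V)) :=
  {τ | τ.toRight ⊆ G ∧ Disjoint τ.toLeft τ.toRight ∧ ¬ G ⊆ τ.toLeft ∧ τ.toLeft ∈ K ∧
    (τ.toRight.Nonempty → τ.toLeft ∪ G ∈ K)}

section

variable {V : Type*} [DecidableEq V]

lemma isLowerSet_crossSubdivision {K : Set (Finset V)} (hK : IsLowerSet K) (G : Finset V) :
    IsLowerSet (crossSubdivision K G) := by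
  intro s t hts hs
  have hl : t.toLeft ⊆ s.toLeft := Finset.toLeft_subset_toLeft hts
  have hr : t.toRight ⊆ s.toRight := Finset.toRight_subset_toRight hts
  obtain ⟨h1, h2, h3, h4, h5⟩ := hs
  exact ⟨hr.trans h1, Finset.disjoint_of_subset_left hl (Finset.disjoint_of_subset_right hr h2),
    fun h => h3 (h.trans hl), hK hl h4, fun h => hK (Finset.union_subset_union_left hl)
      (h5 (h.mono hr))⟩

end

/-- The level at which the coordinates in `G` are cut. -/
lemma exists_level {V : Type*} {G : Finset V} {z : V → ℝ} (hz : ∀ v ∈ G, 0 < z v)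
    (hG : G.Nonempty) : ∃ s : ℝ, s = 2 * ∑ v ∈ G, max (s - z v) 0 ∧ 0 < s ∧ ∃ v ∈ G, z v ≤ s := by
  obtain ⟨v₀, hv₀, hmin⟩ := Finset.exists_min_image G z hG
  set g : ℝ → ℝ := fun s => 2 * ∑ v ∈ G, max (s - z v) 0 - s with hg
  have hcont : ContinuousOn g (Set.Icc (z v₀) (2 * z v₀)) := by
    apply Continuous.continuousOn
    fun_prop
  have hp := hz v₀ hv₀
  -- At the minimum of `z` the sum vanishes; at twice the minimum the term of `v₀` alone makes `g`
  -- nonnegative.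
  have h1 : g (z v₀) ≤ 0 := by
    have : ∑ v ∈ G, max (z v₀ - z v) 0 = 0 :=
      Finset.sum_eq_zero fun v hv => max_eq_right (by linarith [hmin v hv])
    simp only [hg, this]
    linarith
  have h2 : 0 ≤ g (2 * z v₀) := by
    have := Finset.single_le_sum (f := fun v => max (2 * z v₀ - z v) 0)
      (fun v _ => le_max_right _ _) hv₀
    have h3 := le_max_left (2 * z v₀ - z v₀) 0
    simp only [hg]
    linarith
  obtain ⟨s, hs, hgs⟩ := intermediate_value_Icc (by linarith) hcont ⟨h1, h2⟩
  refine ⟨s, ?_, by linarith [hs.1], v₀, hv₀, hs.1⟩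
  simp only [hg] at hgs
  linarith

/-- Above the smallest coordinate the right-hand side grows with slope at least `2`, so it cannot
meet the diagonal again. The last hypothesis excludes the solution `0` lying below all coordinates.
-/
lemma level_unique {V : Type*} {G : Finset V} {z : V → ℝ} {s s' : ℝ}
    (hs : s = 2 * ∑ v ∈ G, max (s - z v) 0) (hs' : s' = 2 * ∑ v ∈ G, max (s' - z v) 0)
    (h : ∃ v ∈ G, z v ≤ s) : s' ≤ s := by
  by_contra hlt
  rw [not_le] at hlt
  obtain ⟨v₀, hv₀, hz⟩ := h
  have h1 : ∑ v ∈ G, (max (s' - z v) 0 - max (s - z v) 0) ≥ s' - s := by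
    have h2 := Finset.single_le_sum (f := fun v => max (s' - z v) 0 - max (s - z v) 0)
      (fun v _ => sub_nonneg.2 (max_le_max_right 0 (by linarith))) hv₀
    have h3 : max (s' - z v₀) 0 - max (s - z v₀) 0 = s' - s := by
      rw [max_eq_left (by linarith), max_eq_left (by linarith)]; ring
    linarith
  rw [Finset.sum_sub_distrib] at h1
  linarith

lemma supp_toLeft {V : Type*} [Fintype V] {y : V ⊕ V → ℝ} {v : V} :
    v ∈ (supp y).toLeft ↔ y (Sum.inl v) ≠ 0 := by
  rw [Finset.mem_toLeft, mem_supp]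

lemma supp_toRight {V : Type*} [Fintype V] {y : V ⊕ V → ℝ} {v : V} :
    v ∈ (supp y).toRight ↔ y (Sum.inr v) ≠ 0 := by
  rw [Finset.mem_toRight, mem_supp]

section

variable {V : Type*} [Fintype V] [DecidableEq V]

/-- The piecewise linear map realizing the subdivision `crossSubdivision K G`. -/
def crossMap (G : Finset V) (y : V ⊕ V → ℝ) : V → ℝ := fun v =>
  y (Sum.inl v) + if v ∈ G then
    (2 * ∑ i ∈ G, y (Sum.inr i) - y (Sum.inr v)) / (2 * G.card - 1) else 0

lemma sum_crossMap {G : Finset V} (hG : G.Nonempty) {y : V ⊕ V → ℝ}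
    (hy : ∀ v ∉ G, y (Sum.inr v) = 0) : ∑ v, crossMap G y v = ∑ v, y v := by
  have h1 : (1 : ℝ) ≤ G.card := by exact_mod_cast hG.card_pos
  have h2 : ∑ v ∈ G, y (Sum.inr v) = ∑ v, y (Sum.inr v) :=
    Finset.sum_subset (Finset.subset_univ G) fun v _ hv => hy v hv
  unfold crossMap
  rw [Finset.sum_add_distrib, Fintype.sum_sum_type, Finset.sum_ite_mem, Finset.univ_inter,
    ← Finset.sum_div, Finset.sum_sub_distrib, Finset.sum_const, nsmul_eq_mul, ← h2]
  congr 1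
  have h3 : (2 * (G.card : ℝ) - 1) ≠ 0 := by linarith
  rw [div_eq_iff h3]
  ring

/-- The cross-polytopal subdivision of a face does not change the homeomorphism type. -/
theorem nonempty_homeomorph_crossSubdivision {K : Set (Finset V)} (hK : IsLowerSet K)
    {G : Finset V} (hG : G.Nonempty) :
    Nonempty (geom (crossSubdivision K G) ≃ₜ geom K) := by
  -- The new vertex `inr i` goes to the interior point of `G` with coordinate `1 / k` at `i` and `2
  -- / k` at the other vertices of `G`; `k` normalizes the sum.
  set k : ℝ := 2 * G.card - 1 with hk
  have hk0 : 0 < k := by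
    have : (1 : ℝ) ≤ G.card := by exact_mod_cast hG.card_pos
    linarith
  -- the level of a point of the subdivision
  set lev : (V ⊕ V → ℝ) → ℝ := fun y => 2 * ∑ i ∈ G, y (Sum.inr i) / k with hlev
  have hval : ∀ y : V ⊕ V → ℝ, ∀ v ∈ G,
      crossMap G y v = y (Sum.inl v) - y (Sum.inr v) / k + lev y := by
    intro y v hv
    simp only [crossMap, if_pos hv, hlev, ← Finset.sum_div, ← hk]
    field_simp
    ring
  have hval' : ∀ y : V ⊕ V → ℝ, ∀ v ∉ G, crossMap G y v = y (Sum.inl v) := by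
    intro y v hv
    simp [crossMap, if_neg hv]
  have hright : ∀ y ∈ geom (crossSubdivision K G), ∀ v ∉ G, y (Sum.inr v) = 0 := by
    intro y hy v hv
    by_contra h
    exact hv (hy.2.1 (supp_toRight.2 h))
  have hdisj : ∀ y ∈ geom (crossSubdivision K G), ∀ v, y (Sum.inl v) = 0 ∨ y (Sum.inr v) = 0 := by
    intro y hy v
    by_contra! h
    exact Finset.disjoint_left.1 hy.2.2.1 (supp_toLeft.2 h.1) (supp_toRight.2 h.2)
  -- As `inl v` and `inr v` never lie in a common face, their coordinates (the latter divided by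
  -- `k`) are the positive and negative parts of the image coordinate minus the level. So a point is
  -- determined by its image and level, and the level by its equation.
  have hposl : ∀ y ∈ geom (crossSubdivision K G), ∀ v ∈ G,
      y (Sum.inl v) = max (crossMap G y v - lev y) 0 ∧
      y (Sum.inr v) / k = max (lev y - crossMap G y v) 0 := by
    intro y hy v hv
    have h1 := hy.1.1 (Sum.inl v)
    have h2 := div_nonneg (hy.1.1 (Sum.inr v)) hk0.le
    rw [hval y v hv]
    rcases hdisj y hy v with h | h
    · constructor
      · rw [h, max_eq_right (by linarith)]
      · rw [h, max_eq_left (by linarith)]; ring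
    · constructor
      · rw [h, zero_div, max_eq_left (by linarith)]; ring
      · rw [h, zero_div, max_eq_right (by linarith)]
  have hlevel : ∀ y ∈ geom (crossSubdivision K G),
      lev y = 2 * ∑ v ∈ G, max (lev y - crossMap G y v) 0 := by
    intro y hy
    rw [← Finset.sum_congr rfl fun v hv => (hposl y hy v hv).2]
  have hlow : ∀ y ∈ geom (crossSubdivision K G), ∃ v ∈ G, crossMap G y v ≤ lev y := by
    intro y hy
    obtain ⟨v, hv, hv'⟩ := Finset.not_subset.1 hy.2.2.2.1
    refine ⟨v, hv, ?_⟩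
    rw [hval y v hv]
    have h0 : y (Sum.inl v) = 0 := by
      by_contra h
      exact hv' (supp_toLeft.2 h)
    have h2 := div_nonneg (hy.1.1 (Sum.inr v)) hk0.le
    linarith
  refine nonempty_homeomorph_of_bijOn (isLowerSet_crossSubdivision hK G) (Φ := crossMap G) ?_
    ⟨?_, ?_, ?_⟩
  · refine continuous_pi fun v => ?_
    unfold crossMap
    split_ifs <;> fun_prop
  · intro y hy
    have hnn : ∀ v, 0 ≤ crossMap G y v := by
      intro v
      by_cases hv : v ∈ G
      · rw [hval y v hv]
        have h1 := hy.1.1 (Sum.inl v)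
        have h3 := Finset.single_le_sum (f := fun i => y (Sum.inr i) / k)
          (fun i _ => div_nonneg (hy.1.1 (Sum.inr i)) hk0.le) hv
        have h4 := div_nonneg (hy.1.1 (Sum.inr v)) hk0.le
        simp only [hlev]
        linarith
      · rw [hval' y v hv]; exact hy.1.1 _
    refine ⟨⟨hnn, by rw [sum_crossMap hG (hright y hy), hy.1.2]⟩, ?_⟩
    by_cases hr : (supp y).toRight.Nonempty
    · refine hK (fun v hv => ?_) (hy.2.2.2.2.2 hr)
      rw [Finset.mem_union]
      by_contra! h
      have h0 : y (Sum.inl v) = 0 := by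
        by_contra h'
        exact h.1 (supp_toLeft.2 h')
      rw [mem_supp, hval' y v h.2] at hv
      exact hv h0
    · rw [Finset.not_nonempty_iff_eq_empty] at hr
      have h0 : ∀ v, y (Sum.inr v) = 0 := fun v => by
        by_contra h
        have := supp_toRight.2 h
        rw [hr] at this
        simp at this
      refine hK (fun v hv => ?_) hy.2.2.2.2.1
      rw [supp_toLeft]
      simpa [crossMap, h0] using hv
  · intro y hy y' hy' h
    have hl : lev y = lev y' := by
      have h1 := hlevel y hy
      have h2 := hlevel y' hy'
      have h3 := hlow y hy
      have h4 := hlow y' hy'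
      rw [h] at h1 h3
      exact le_antisymm (level_unique h2 h1 h4) (level_unique h1 h2 h3)
    funext v
    rcases v with v | v
    · by_cases hv : v ∈ G
      · rw [(hposl y hy v hv).1, (hposl y' hy' v hv).1, h, hl]
      · rw [← hval' y v hv, ← hval' y' v hv, h]
    · by_cases hv : v ∈ G
      · have h1 : y (Sum.inr v) / k = y' (Sum.inr v) / k := by
          rw [(hposl y hy v hv).2, (hposl y' hy' v hv).2, h, hl]
        rwa [div_left_inj' hk0.ne'] at h1
      · rw [hright y hy v hv, hright y' hy' v hv]
  · intro z hz
    -- A preimage comes from cutting the coordinates in `G` at the level; if `z` is off the open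
    -- star of `G`, no new vertex is needed.
    by_cases hGz : G ⊆ supp z
    · obtain ⟨s, hs, hs0, v₀, hv₀, hv₀s⟩ := exists_level (z := z) (G := G)
        (fun v hv => lt_of_le_of_ne (hz.1.1 v) (Ne.symm (mem_supp.1 (hGz hv)))) hG
      set y : V ⊕ V → ℝ := Sum.elim (fun v => if v ∈ G then max (z v - s) 0 else z v)
        (fun v => if v ∈ G then k * max (s - z v) 0 else 0) with hy
      have hyr : ∀ v ∈ G, y (Sum.inr v) / k = max (s - z v) 0 := fun v hv => by
        simp only [hy, Sum.elim_inr, if_pos hv]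
        field_simp
      have hylev : lev y = s := by
        simp only [hlev]
        rw [Finset.sum_congr rfl hyr, ← hs]
      have hyz : crossMap G y = z := by
        funext v
        by_cases hv : v ∈ G
        · rw [hval y v hv, hylev, hyr v hv]
          simp only [hy, Sum.elim_inl, if_pos hv]
          rcases le_total (z v) s with h | h
          · rw [max_eq_right (by linarith), max_eq_left (by linarith)]; ring
          · rw [max_eq_left (by linarith), max_eq_right (by linarith)]; ring
        · rw [hval' y v hv]
          simp [hy, hv]
      have hyr0 : ∀ v ∉ G, y (Sum.inr v) = 0 := fun v hv => by simp [hy, hv]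
      have hleft : (supp y).toLeft ⊆ supp z := by
        intro v hv
        by_cases hvG : v ∈ G
        · exact hGz hvG
        · rw [supp_toLeft] at hv
          simpa [hy, hvG] using hv
      refine ⟨y, ⟨⟨?_, ?_⟩, ?_, ?_, ?_, ?_, ?_⟩, hyz⟩
      · rintro (v | v)
        · simp only [hy, Sum.elim_inl]
          split_ifs
          · exact le_max_right _ _
          · exact hz.1.1 v
        · simp only [hy, Sum.elim_inr]
          split_ifs
          · exact mul_nonneg hk0.le (le_max_right _ _)
          · exact le_rfl
      · rw [← sum_crossMap hG hyr0, hyz, hz.1.2]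
      · intro v hv
        by_contra h
        exact (supp_toRight.1 hv) (hyr0 v h)
      · rw [Finset.disjoint_left]
        intro v hv hv'
        rw [supp_toLeft] at hv
        rw [supp_toRight] at hv'
        by_cases hvG : v ∈ G
        · simp only [hy, Sum.elim_inl, Sum.elim_inr, if_pos hvG] at hv hv'
          rcases le_total (z v) s with h | h
          · exact hv (max_eq_right (by linarith))
          · exact hv' (by rw [max_eq_right (by linarith), mul_zero])
        · exact hv' (hyr0 v hvG)
      · intro h
        have := supp_toLeft.1 (h hv₀)
        simp only [hy, Sum.elim_inl, if_pos hv₀] at this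
        exact this (max_eq_right (by linarith))
      · exact hK hleft hz.2
      · exact fun _ => hK (Finset.union_subset hleft hGz) hz.2
    · set y : V ⊕ V → ℝ := Sum.elim z 0 with hy
      have hl : (supp y).toLeft = supp z := by
        ext v
        rw [supp_toLeft, mem_supp]; simp [hy]
      have hr : (supp y).toRight = ∅ := by
        ext v
        rw [supp_toRight]; simp [hy]
      have hyz : crossMap G y = z := by
        funext v
        simp [crossMap, hy]
      refine ⟨y, ⟨⟨?_, ?_⟩, ?_⟩, hyz⟩
      · rintro (v | v)
        · exact hz.1.1 v
        · exact le_rfl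
      · rw [← sum_crossMap hG (fun v _ => rfl), hyz, hz.1.2]
      · rw [crossSubdivision, Set.mem_ofPred_eq, hl, hr]
        exact ⟨by simp, by simp, hGz, hz.2, by simp⟩

end

end

/-! ### Complexes with one vertex of each colour in every facet. -/

section

/-- A complex all of whose maximal faces have exactly one vertex of each of `d` colours. -/
structure Rainbow {V : Type*} {d : ℕ} (K : Set (Finset V)) (κ : V → Fin d) : Prop where
  lower : IsLowerSet K
  empty_mem : ∅ ∈ K
  inj : ∀ s ∈ K, Set.InjOn κ s
  ext : ∀ s ∈ K, ∃ t ∈ K, s ⊆ t ∧ t.card = d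

section

variable {V : Type*} {d : ℕ} {K : Set (Finset V)} {κ : V → Fin d}

lemma Rainbow.card_le (h : Rainbow K κ) {s : Finset V} (hs : s ∈ K) : s.card ≤ d := by
  have := Finset.card_le_card_of_injOn κ (s := s) (t := Finset.univ) (by simp) (h.inj s hs)
  simpa using this

lemma Rainbow.subset_of_card_eq [DecidableEq V] (h : Rainbow K κ) {σ u : Finset V}
    (hcard : σ.card = d) (hu : u ∪ σ ∈ K) : u ⊆ σ := by
  have h1 : σ = u ∪ σ := Finset.eq_of_subset_of_card_le Finset.subset_union_right
    (by rw [hcard]; exact h.card_le hu)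
  exact Finset.union_eq_right.1 h1.symm

lemma Rainbow.image_eq_univ (h : Rainbow K κ) {σ : Finset V} (hσ : σ ∈ K) (hcard : σ.card = d) :
    σ.image κ = Finset.univ := by
  rw [← Finset.card_eq_iff_eq_univ, Finset.card_image_of_injOn (h.inj σ hσ), hcard,
    Fintype.card_fin]

/-- The cross-polytopal subdivision of a rainbow complex, opposite vertices having equal colours. -/
lemma Rainbow.crossSubdivision [DecidableEq V] (h : Rainbow K κ) {G : Finset V}
    (hG : G.Nonempty) :
    Rainbow (crossSubdivision K G) (Sum.elim κ κ) where
  lower := isLowerSet_crossSubdivision h.lower G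
  empty_mem := by
    have hl : (∅ : Finset (V ⊕ V)).toLeft = ∅ := by ext; simp
    have hr : (∅ : Finset (V ⊕ V)).toRight = ∅ := by ext; simp
    refine ⟨by rw [hr]; simp, by rw [hl]; simp, ?_, by rw [hl]; exact h.empty_mem,
      by rw [hr]; simp⟩
    rw [hl, Finset.subset_empty]
    exact hG.ne_empty
  inj τ hτ := by
    obtain ⟨h1, h2, h3, h4, h5⟩ := hτ
    have key : Set.InjOn κ (τ.toLeft ∪ τ.toRight : Finset V) := by
      by_cases hr : τ.toRight.Nonempty
      · exact (h.inj _ (h5 hr)).mono (by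
          exact_mod_cast Finset.union_subset_union_right h1)
      · rw [Finset.not_nonempty_iff_eq_empty] at hr
        rw [hr, Finset.union_empty]
        exact h.inj _ h4
    have hl : ∀ v, Sum.inl v ∈ τ → v ∈ τ.toLeft := fun v hv => Finset.mem_toLeft.2 hv
    have hr : ∀ v, Sum.inr v ∈ τ → v ∈ τ.toRight := fun v hv => Finset.mem_toRight.2 hv
    rintro (v | v) hv (w | w) hw hvw
    · exact congrArg Sum.inl (key (by simp [hl v hv]) (by simp [hl w hw]) hvw)
    · have := key (by simp [hl v hv]) (by simp [hr w hw]) hvw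
      subst this
      exact absurd (hr v hw) (Finset.disjoint_left.1 h2 (hl v hv))
    · have := key (by simp [hr v hv]) (by simp [hl w hw]) hvw
      subst this
      exact absurd (hr v hv) (Finset.disjoint_left.1 h2 (hl v hw))
    · exact congrArg Sum.inr (key (by simp [hr v hv]) (by simp [hr w hw]) hvw)
  ext τ hτ := by
    obtain ⟨h1, h2, h3, h4, h5⟩ := hτ
    have hsub : ∀ {u w : Finset V}, τ.toLeft ⊆ u → τ.toRight ⊆ w → τ ⊆ u.disjSum w := by
      intro u w hu hw
      rw [← Finset.toLeft_disjSum_toRight (u := τ)]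
      exact Finset.disjSum_mono hu hw
    by_cases hr : τ.toRight.Nonempty
    -- A full face of `K` containing `τ.toLeft ∪ G` becomes a full face of the subdivision once the
    -- vertices in `τ.toRight` are switched to the new side.
    · obtain ⟨t, ht, hτt, hcard⟩ := h.ext _ (h5 hr)
      have hGt : G ⊆ t := Finset.subset_union_right.trans hτt
      refine ⟨(t \ τ.toRight).disjSum τ.toRight, ⟨by simpa using h1, ?_, ?_, ?_, ?_⟩, ?_, ?_⟩
      · simpa using Finset.sdiff_disjoint
      · rw [Finset.toLeft_disjSum]
        obtain ⟨v, hv⟩ := hr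
        exact fun h' => (Finset.mem_sdiff.1 (h' (h1 hv))).2 hv
      · rw [Finset.toLeft_disjSum]
        exact h.lower Finset.sdiff_subset ht
      · intro _
        rw [Finset.toLeft_disjSum]
        exact h.lower (Finset.union_subset Finset.sdiff_subset hGt) ht
      · refine hsub (fun v hv => ?_) le_rfl
        exact Finset.mem_sdiff.2 ⟨hτt (Finset.mem_union_left _ hv), Finset.disjoint_left.1 h2 hv⟩
      · rw [Finset.card_disjSum, Finset.card_sdiff_add_card_eq_card (h1.trans hGt), hcard]
    · rw [Finset.not_nonempty_iff_eq_empty] at hr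
      obtain ⟨t, ht, hτt, hcard⟩ := h.ext _ h4
      by_cases hGt : G ⊆ t
      -- A full face containing `G` is not in the subdivision; switching one vertex of `G` that `τ`
      -- avoids repairs this.
      · obtain ⟨g, hg, hgτ⟩ := Finset.not_subset.1 h3
        refine ⟨(t.erase g).disjSum {g}, ⟨by simpa using hg, by simp, ?_, ?_, ?_⟩, ?_, ?_⟩
        · rw [Finset.toLeft_disjSum]
          exact fun h' => absurd (h' hg) (by simp)
        · rw [Finset.toLeft_disjSum]
          exact h.lower (Finset.erase_subset _ _) ht
        · intro _
          rw [Finset.toLeft_disjSum]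
          exact h.lower (Finset.union_subset (Finset.erase_subset _ _) hGt) ht
        · refine hsub (fun v hv => ?_) (by rw [hr]; simp)
          refine Finset.mem_erase.2 ⟨?_, hτt hv⟩
          rintro rfl
          exact hgτ hv
        · rw [Finset.card_disjSum, Finset.card_singleton, Finset.card_erase_add_one (hGt hg), hcard]
      · refine ⟨t.disjSum ∅, ⟨by rw [Finset.toRight_disjSum]; simp,
          by rw [Finset.toRight_disjSum]; simp, by rwa [Finset.toLeft_disjSum],
          by rwa [Finset.toLeft_disjSum], by rw [Finset.toRight_disjSum]; simp⟩,
          hsub hτt (by rw [hr]), by rw [Finset.card_disjSum, hcard]; simp⟩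

end

section

variable {V : Type*} [Fintype V] {d : ℕ}

/-- The colouring of the barycentric subdivision by dimension. -/
def rank (V : Type*) {d : ℕ} (hd : 0 < d) (s : Finset V) : Fin d :=
  ⟨(s.card - 1) % d, Nat.mod_lt _ hd⟩

lemma card_le_of_isPure {Δ : AbstractSimplicialComplex V} (hΔ : IsPure Δ d) {s : Finset V}
    (hs : s ∈ Δ.faces) : s.card ≤ d := by
  obtain ⟨σ, hσ, h⟩ := exists_isFacet Δ hs
  rw [← hΔ σ hσ]
  exact Finset.card_le_card h

/-- Let `a` be the largest member of size at most `r`, or empty, and `b` the smallest of size above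
`r + 1`, or a facet containing `a`, which purity makes large enough. Any set of size `r + 1` between
them is comparable with the whole chain. -/
lemma exists_between_chain {Δ : AbstractSimplicialComplex V} (hΔ : IsPure Δ d)
    (hne : Δ.faces.Nonempty) {T : Finset (Finset V)} (hT : T ∈ barycentric (allFaces Δ)) {r : ℕ}
    (hr : r < d) (hno : ∀ s ∈ T, s.card ≠ r + 1) :
    ∃ c ∈ Δ.faces, c.card = r + 1 ∧ ∀ s ∈ T, s ⊆ c ∨ c ⊆ s := by
  have hTf : ∀ s ∈ T, s ∈ Δ.faces := fun s hs =>
    mem_faces_of_mem_allFaces (hT.1 s hs).1 (hT.1 s hs).2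
  obtain ⟨a, ha1, ha2, ha3⟩ : ∃ a : Finset V, a.card ≤ r ∧ (∀ s ∈ T, s.card ≤ r → s ⊆ a) ∧
      (a = ∅ ∨ a ∈ T) := by
    by_cases hex : (T.filter fun s => s.card ≤ r).Nonempty
    · obtain ⟨a, ha, hmax⟩ := Finset.exists_max_image _ Finset.card hex
      rw [Finset.mem_filter] at ha
      refine ⟨a, ha.2, fun s hs hsr => ?_, Or.inr ha.1⟩
      rcases hT.2 s hs a ha.1 with h | h
      · exact h
      · exact (Finset.eq_of_subset_of_card_le h (hmax s (Finset.mem_filter.2 ⟨hs, hsr⟩))).symm.le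
    · refine ⟨∅, by simp, fun s hs hsr => ?_, Or.inl rfl⟩
      exact absurd ⟨s, Finset.mem_filter.2 ⟨hs, hsr⟩⟩ hex
  obtain ⟨b, hb1, hb2, hb3, hb4⟩ : ∃ b ∈ Δ.faces, r + 1 ≤ b.card ∧ a ⊆ b ∧
      ∀ s ∈ T, r + 1 < s.card → b ⊆ s := by
    by_cases hex : (T.filter fun s => r + 1 < s.card).Nonempty
    · obtain ⟨b, hb, hmin⟩ := Finset.exists_min_image _ Finset.card hex
      rw [Finset.mem_filter] at hb
      refine ⟨b, hTf b hb.1, hb.2.le, ?_, fun s hs hsr => ?_⟩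
      · rcases ha3 with rfl | ha3
        · simp
        · rcases hT.2 a ha3 b hb.1 with h | h
          · exact h
          · have := Finset.card_le_card h
            have := hb.2
            omega
      · rcases hT.2 b hb.1 s hs with h | h
        · exact h
        · exact (Finset.eq_of_subset_of_card_le h
            (hmin s (Finset.mem_filter.2 ⟨hs, hsr⟩))).symm.le
    · have hno' : ∀ s ∈ T, r + 1 < s.card → False := fun s hs hsr =>
        hex ⟨s, Finset.mem_filter.2 ⟨hs, hsr⟩⟩
      obtain ⟨s₀, hs₀, has₀⟩ : ∃ s₀ ∈ Δ.faces, a ⊆ s₀ := by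
        rcases ha3 with rfl | ha3
        · obtain ⟨s, hs⟩ := hne
          exact ⟨s, hs, by simp⟩
        · exact ⟨a, hTf a ha3, le_rfl⟩
      obtain ⟨σ, hσ, hs₀σ⟩ := exists_isFacet Δ hs₀
      exact ⟨σ, hσ.1, by rw [hΔ σ hσ]; omega, has₀.trans hs₀σ,
        fun s hs hsr => absurd hsr (hno' s hs)⟩
  obtain ⟨c, hac, hcb, hc⟩ := Finset.exists_subsuperset_card_eq hb3 (by omega : a.card ≤ r + 1) hb2
  refine ⟨c, (Δ.isRelLowerSet_faces hb1).2 hcb (Finset.card_pos.1 (by omega)), hc,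
    fun s hs => ?_⟩
  rcases lt_trichotomy s.card (r + 1) with h | h | h
  · exact Or.inl ((ha2 s hs (by omega)).trans hac)
  · exact absurd h (hno s hs)
  · exact Or.inr (hcb.trans (hb4 s hs h))

/-- The barycentric subdivision of a pure complex is completely balanced. -/
lemma rainbow_barycentric {Δ : AbstractSimplicialComplex V} (hd : 0 < d) (hΔ : IsPure Δ d)
    (hne : Δ.faces.Nonempty) : Rainbow (barycentric (allFaces Δ)) (rank V hd) := by
  classical
  have hcard : ∀ C ∈ barycentric (allFaces Δ), ∀ s ∈ C, 0 < s.card ∧ s.card ≤ d :=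
    fun C hC s hs => ⟨(hC.1 s hs).2.card_pos,
      card_le_of_isPure hΔ (mem_faces_of_mem_allFaces (hC.1 s hs).1 (hC.1 s hs).2)⟩
  have hrank : ∀ C ∈ barycentric (allFaces Δ), ∀ s ∈ C, (rank V hd s : ℕ) = s.card - 1 :=
    fun C hC s hs => by
      have := hcard C hC s hs
      exact Nat.mod_eq_of_lt (by omega)
  have hinj : ∀ C ∈ barycentric (allFaces Δ), Set.InjOn (rank V hd) (C : Set (Finset V)) := by
    intro C hC s hs t ht h
    have h1 := congrArg Fin.val h
    rw [hrank C hC s hs, hrank C hC t ht] at h1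
    have h2 := hcard C hC s hs
    have h3 := hcard C hC t ht
    rcases hC.2 s hs t ht with h4 | h4
    · exact Finset.eq_of_subset_of_card_le h4 (by omega)
    · exact (Finset.eq_of_subset_of_card_le h4 (by omega)).symm
  refine ⟨isLowerSet_barycentric _, ⟨by simp, by simp⟩, hinj, fun C hC => ?_⟩
  obtain ⟨T, hCT, hT⟩ := (Set.toFinite (barycentric (allFaces Δ))).exists_le_maximal hC
  refine ⟨T, hT.1, hCT, ?_⟩
  -- A maximal chain misses no rank, since otherwise a face of that rank could be inserted.
  have himg : T.image (rank V hd) = Finset.univ := by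
    rw [Finset.eq_univ_iff_forall]
    intro r
    by_contra hr
    have hno : ∀ s ∈ T, s.card ≠ (r : ℕ) + 1 := by
      intro s hs hsr
      refine hr (Finset.mem_image.2 ⟨s, hs, Fin.ext ?_⟩)
      rw [hrank T hT.1 s hs, hsr, Nat.add_sub_cancel]
    obtain ⟨c, hc, hcr, hcomp⟩ := exists_between_chain hΔ hne hT.1 r.2 hno
    have hins : insert c T ∈ barycentric (allFaces Δ) := by
      refine ⟨fun s hs => ?_, fun s hs t ht => ?_⟩
      · rcases Finset.mem_insert.1 hs with rfl | hs
        · exact ⟨Or.inr hc, nonempty_of_mem_faces hc⟩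
        · exact hT.1.1 s hs
      · rcases Finset.mem_insert.1 hs with hs | hs <;>
          rcases Finset.mem_insert.1 ht with ht | ht
        · exact Or.inl (hs.trans ht.symm).le
        · rw [hs]
          exact (hcomp t ht).symm
        · rw [ht]
          exact hcomp s hs
        · exact hT.1.2 s hs t ht
    have hcT := hT.2 hins (Finset.subset_insert c T) (Finset.mem_insert_self c T)
    exact hno c hcT hcr
  rw [← Finset.card_image_of_injOn (hinj T hT.1), himg, Finset.card_univ, Fintype.card_fin]

end

end

/-! ### Colour sums under cross-polytopal subdivision. -/

section

open scoped Classical in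
/-- The sum over the faces of a function of their colour set. -/
def colorSum {V : Type*} [Fintype V] {d : ℕ} (K : Set (Finset V)) (κ : V → Fin d)
    (F : Finset (Fin d) → ℝ) : ℝ :=
  ∑ τ with τ ∈ K, F (τ.image κ)

section

variable {V : Type*} {d : ℕ}

lemma image_elim (κ : V → Fin d) (u w : Finset V) [DecidableEq V] :
    (u.disjSum w).image (Sum.elim κ κ) = (u ∪ w).image κ := by
  ext i
  simp only [Finset.mem_image, Finset.mem_union]
  constructor
  · rintro ⟨v | v, hv, rfl⟩
    · exact ⟨v, Or.inl (Finset.inl_mem_disjSum.1 hv), rfl⟩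
    · exact ⟨v, Or.inr (Finset.inr_mem_disjSum.1 hv), rfl⟩
  · rintro ⟨v, hv | hv, rfl⟩
    · exact ⟨Sum.inl v, Finset.inl_mem_disjSum.2 hv, rfl⟩
    · exact ⟨Sum.inr v, Finset.inr_mem_disjSum.2 hv, rfl⟩

lemma sum_powerset_filter_nonempty [DecidableEq V] (s : Finset V) (x : ℝ) :
    ∑ w ∈ s.powerset with w.Nonempty, x = ((2 : ℝ) ^ s.card - 1) * x := by
  have h : (s.powerset.filter fun w => w.Nonempty) = s.powerset.erase ∅ := by
    ext w
    rw [Finset.mem_filter, Finset.mem_erase, Finset.nonempty_iff_ne_empty, and_comm]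
  rw [h, Finset.sum_const, Finset.card_erase_of_mem (Finset.empty_mem_powerset s),
    Finset.card_powerset, nsmul_eq_mul, Nat.cast_sub Nat.one_le_two_pow]
  simp

variable [Fintype V]

lemma sum_finset_sum {A : Type*} [AddCommMonoid A] (p : Finset (V ⊕ V) → Prop) [DecidablePred p]
    (f : Finset (V ⊕ V) → A) :
    ∑ τ with p τ, f τ =
      ∑ x : Finset V × Finset V with p (x.1.disjSum x.2), f (x.1.disjSum x.2) := by
  rw [Finset.sum_filter, Finset.sum_filter]
  refine (Fintype.sum_equiv Finset.sumEquiv.symm.toEquiv _ _ fun x => ?_).symm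
  rfl

-- Fold the new vertices onto their opposites. A face with new vertices becomes some `ρ` with `ρ ∪ G
-- ∈ K`, and comes from a nonempty subset of `ρ ∩ G`, the new side; there are `2 ^ #(ρ ∩ G) - 1` of
-- these. The faces without new vertices are those of `K` not containing `G`, whence the last
-- correction.
open scoped Classical in
lemma colorSum_crossSubdivision [DecidableEq V] {K : Set (Finset V)} (hK : IsLowerSet K)
    (κ : V → Fin d) {G : Finset V} (F : Finset (Fin d) → ℝ) :
    colorSum (crossSubdivision K G) (Sum.elim κ κ) F = colorSum K κ F +
      ∑ ρ : Finset V with ρ ∪ G ∈ K,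
        ((2 : ℝ) ^ (ρ ∩ G).card - 1 - if G ⊆ ρ then 1 else 0) * F (ρ.image κ) := by
  have hmem : ∀ u w : Finset V, u.disjSum w ∈ crossSubdivision K G ↔
      w ⊆ G ∧ Disjoint u w ∧ ¬ G ⊆ u ∧ u ∈ K ∧ (w.Nonempty → u ∪ G ∈ K) := by
    intro u w
    simp only [crossSubdivision, Set.mem_ofPred_eq, Finset.toLeft_disjSum,
      Finset.toRight_disjSum]
  have h1 : ∑ x : Finset V × Finset V with x.1.disjSum x.2 ∈ crossSubdivision K G ∧
      x.2.Nonempty, F ((x.1 ∪ x.2).image κ) =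
      ∑ ρ : Finset V with ρ ∪ G ∈ K, ((2 : ℝ) ^ (ρ ∩ G).card - 1) * F (ρ.image κ) := by
    simp_rw [← sum_powerset_filter_nonempty]
    rw [Finset.sum_sigma']
    refine Finset.sum_nbij' (fun x => ⟨x.1 ∪ x.2, x.2⟩) (fun y => (y.1 \ y.2, y.2)) ?_ ?_ ?_ ?_ ?_
    · rintro ⟨u, w⟩ h
      simp only [Finset.mem_filter, Finset.mem_univ, true_and, hmem, Finset.mem_sigma,
        Finset.mem_powerset] at h ⊢
      obtain ⟨⟨h1, h2, h3, h4, h5⟩, h6⟩ := h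
      refine ⟨?_, Finset.subset_inter Finset.subset_union_right h1, h6⟩
      rw [Finset.union_assoc, Finset.union_eq_right.2 h1]
      exact h5 h6
    · rintro ⟨ρ, w⟩ h
      simp only [Finset.mem_filter, Finset.mem_univ, true_and, hmem, Finset.mem_sigma,
        Finset.mem_powerset] at h ⊢
      obtain ⟨h1, h2, h3⟩ := h
      have h4 : w ⊆ G := h2.trans Finset.inter_subset_right
      have h5 : ρ \ w ∪ G ∈ K := hK (Finset.union_subset_union_left Finset.sdiff_subset) h1
      refine ⟨⟨h4, Finset.sdiff_disjoint, fun h => ?_, hK Finset.subset_union_left h5,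
        fun _ => h5⟩, h3⟩
      obtain ⟨v, hv⟩ := h3
      exact (Finset.mem_sdiff.1 (h (h4 hv))).2 hv
    · rintro ⟨u, w⟩ h
      simp only [Finset.mem_filter, Finset.mem_univ, true_and, hmem] at h
      simp only [Prod.mk.injEq, and_true]
      exact Finset.union_sdiff_cancel_right h.1.2.1
    · rintro ⟨ρ, w⟩ h
      simp only [Finset.mem_filter, Finset.mem_univ, true_and, Finset.mem_sigma,
        Finset.mem_powerset] at h
      simp only [Finset.sdiff_union_of_subset (h.2.1.trans Finset.inter_subset_left)]
    · intros
      rfl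
  have h2 : ∑ x : Finset V × Finset V with x.1.disjSum x.2 ∈ crossSubdivision K G ∧
      ¬ x.2.Nonempty, F ((x.1 ∪ x.2).image κ) =
      ∑ u : Finset V with u ∈ K ∧ ¬ G ⊆ u, F (u.image κ) := by
    refine Finset.sum_nbij' (fun x => x.1) (fun u => (u, ∅)) ?_ ?_ ?_ ?_ ?_
    · rintro ⟨u, w⟩ h
      simp only [Finset.mem_filter, Finset.mem_univ, true_and, hmem] at h ⊢
      exact ⟨h.1.2.2.2.1, h.1.2.2.1⟩
    · intro u h
      simp only [Finset.mem_filter, Finset.mem_univ, true_and, hmem] at h ⊢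
      exact ⟨⟨by simp, by simp, h.2, h.1, by simp⟩, by simp⟩
    · rintro ⟨u, w⟩ h
      simp only [Finset.mem_filter, Finset.mem_univ, true_and,
        Finset.not_nonempty_iff_eq_empty] at h
      simp only [h.2]
    · intros
      rfl
    · rintro ⟨u, w⟩ h
      simp only [Finset.mem_filter, Finset.mem_univ, true_and,
        Finset.not_nonempty_iff_eq_empty] at h
      simp only [h.2, Finset.union_empty]
  have h3 : ∑ ρ : Finset V with ρ ∪ G ∈ K, (if G ⊆ ρ then 1 else 0) * F (ρ.image κ) =
      ∑ ρ : Finset V with ρ ∈ K ∧ G ⊆ ρ, F (ρ.image κ) := by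
    simp_rw [ite_mul, one_mul, zero_mul]
    rw [← Finset.sum_filter, Finset.filter_filter]
    refine Finset.sum_congr (Finset.filter_congr fun ρ _ => ?_) fun _ _ => rfl
    refine and_congr_left fun h => ?_
    rw [Finset.union_eq_left.2 h]
  have h4 : colorSum K κ F = ∑ ρ : Finset V with ρ ∈ K ∧ G ⊆ ρ, F (ρ.image κ) +
      ∑ u : Finset V with u ∈ K ∧ ¬ G ⊆ u, F (u.image κ) := by
    rw [colorSum, ← Finset.sum_filter_add_sum_filter_not _ (fun ρ => G ⊆ ρ),
      Finset.filter_filter, Finset.filter_filter]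
  simp_rw [sub_mul _ (ite _ _ _)]
  rw [Finset.sum_sub_distrib, h3, ← h1, h4, colorSum, sum_finset_sum,
    ← Finset.sum_filter_add_sum_filter_not _ (fun x => x.2.Nonempty), Finset.filter_filter,
    Finset.filter_filter]
  simp_rw [image_elim]
  rw [h2]
  ring

-- As `σ` is a facet, a face joined to the opposite simplex consists of an old part `u` and a new
-- part `w`, both inside `σ`, with `u` disjoint from `w` and `E`. For given `T = u ∪ w` the set `u`
-- is any subset of `T \ E`. The rest of `K` plays no role, which is why `σ` is subdivided first.
open scoped Classical in
lemma sum_union_crossSubdivision [DecidableEq V] {K : Set (Finset V)} {κ : V → Fin d}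
    (hK : Rainbow K κ)
    {σ E : Finset V} (hσ : σ ∈ K) (hcard : σ.card = d) (hE : E ⊆ σ) (hne : E.Nonempty)
    (F : Finset (Fin d) → ℝ) :
    ∑ ρ : Finset (V ⊕ V) with ρ ∪ (∅ : Finset V).disjSum E ∈ crossSubdivision K σ,
      ((2 : ℝ) ^ (ρ ∩ (∅ : Finset V).disjSum E).card - 1 -
        if (∅ : Finset V).disjSum E ⊆ ρ then 1 else 0) * F (ρ.image (Sum.elim κ κ)) =
    ∑ T ∈ σ.powerset, (2 : ℝ) ^ (T \ E).card *
      ((2 : ℝ) ^ (T ∩ E).card - 1 - if E ⊆ T then 1 else 0) * F (T.image κ) := by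
  have hmem : ∀ u w : Finset V, u.disjSum w ∪ (∅ : Finset V).disjSum E ∈ crossSubdivision K σ ↔
      u ⊆ σ ∧ w ⊆ σ ∧ Disjoint u w ∧ Disjoint u E := by
    intro u w
    have e : u.disjSum w ∪ (∅ : Finset V).disjSum E = u.disjSum (w ∪ E) := by
      ext (v | v) <;> simp
    rw [e]
    simp only [crossSubdivision, Set.mem_ofPred_eq, Finset.toLeft_disjSum,
      Finset.toRight_disjSum, Finset.disjoint_union_right]
    constructor
    · rintro ⟨h1, h2, h3, h4, h5⟩
      exact ⟨hK.subset_of_card_eq hcard (h5 (hne.mono Finset.subset_union_right)),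
        Finset.subset_union_left.trans h1, h2⟩
    · rintro ⟨h1, h2, h3, h4⟩
      refine ⟨Finset.union_subset h2 hE, ⟨h3, h4⟩, fun h => ?_, hK.lower h1 hσ, fun _ => ?_⟩
      · obtain ⟨v, hv⟩ := hne
        exact Finset.disjoint_left.1 h4 (h (hE hv)) hv
      · rwa [Finset.union_eq_right.2 h1]
  have hT : ∀ T : Finset V, (2 : ℝ) ^ (T \ E).card *
      ((2 : ℝ) ^ (T ∩ E).card - 1 - if E ⊆ T then 1 else 0) * F (T.image κ) =
      ∑ u ∈ (T \ E).powerset,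
        ((2 : ℝ) ^ (T ∩ E).card - 1 - if E ⊆ T then 1 else 0) * F (T.image κ) := by
    intro T
    rw [Finset.sum_const, Finset.card_powerset, nsmul_eq_mul]
    push_cast
    ring
  simp_rw [hT]
  rw [sum_finset_sum, Finset.sum_sigma']
  refine Finset.sum_nbij' (fun x => ⟨x.1 ∪ x.2, x.1⟩) (fun y => (y.2, y.1 \ y.2)) ?_ ?_ ?_ ?_ ?_
  · rintro ⟨u, w⟩ h
    simp only [Finset.mem_filter, Finset.mem_univ, true_and, hmem, Finset.mem_sigma,
      Finset.mem_powerset] at h ⊢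
    obtain ⟨h1, h2, h3, h4⟩ := h
    exact ⟨Finset.union_subset h1 h2, Finset.subset_sdiff.2 ⟨Finset.subset_union_left, h4⟩⟩
  · rintro ⟨T, u⟩ h
    simp only [Finset.mem_filter, Finset.mem_univ, true_and, hmem, Finset.mem_sigma,
      Finset.mem_powerset] at h ⊢
    obtain ⟨h1, h2⟩ := h
    obtain ⟨h2, h3⟩ := Finset.subset_sdiff.1 h2
    exact ⟨h2.trans h1, Finset.sdiff_subset.trans h1, Finset.disjoint_sdiff, h3⟩
  · rintro ⟨u, w⟩ h
    simp only [Finset.mem_filter, Finset.mem_univ, true_and, hmem] at h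
    simp only [Prod.mk.injEq, true_and]
    exact Finset.union_sdiff_cancel_left h.2.2.1
  · rintro ⟨T, u⟩ h
    simp only [Finset.mem_sigma, Finset.mem_powerset] at h
    simp only [Finset.union_sdiff_of_subset (h.2.trans Finset.sdiff_subset)]
  · rintro ⟨u, w⟩ h
    simp only [Finset.mem_filter, Finset.mem_univ, true_and, hmem] at h
    have e1 : u.disjSum w ∩ (∅ : Finset V).disjSum E = (∅ : Finset V).disjSum (w ∩ E) := by
      ext (v | v) <;> simp
    have e2 : (∅ : Finset V).disjSum E ⊆ u.disjSum w ↔ E ⊆ w := by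
      rw [Finset.subset_iff, Finset.subset_iff]
      simp
    have e3 : (u ∪ w) ∩ E = w ∩ E := by
      rw [Finset.union_inter_distrib_right, Finset.disjoint_iff_inter_eq_empty.1 h.2.2.2,
        Finset.empty_union]
    have e4 : E ⊆ u ∪ w ↔ E ⊆ w :=
      ⟨fun h' v hv => (Finset.mem_union.1 (h' hv)).resolve_left
        fun hu => Finset.disjoint_left.1 h.2.2.2 hu hv,
        fun h' => h'.trans Finset.subset_union_right⟩
    simp only [image_elim, e1, e2, e3, e4, Finset.card_disjSum, Finset.card_empty, zero_add]

end

end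

/-! ### The effect of the second subdivision, by colour sets. -/

section

/-- The contribution of the colour set `S` to the effect of a cross-polytopal subdivision
at a face with colour set `C`. -/
def crossWeight {α : Type*} [DecidableEq α] (C S : Finset α) : ℝ :=
  1 - (if Disjoint S C then 1 else 0) - if C ⊆ S then 1 else 0

/-- Writing the coefficient of `T` as a sum over `S ⊆ T` allows summing over all `T ⊇ S` first, the
form evaluated by `sum_prod_hCoeff`. -/
lemma sum_crossWeight {α : Type*} [DecidableEq α] (C T : Finset α) :
    ∑ S ∈ T.powerset, crossWeight C S =
      (2 : ℝ) ^ (T \ C).card * ((2 : ℝ) ^ (T ∩ C).card - 1 - if C ⊆ T then 1 else 0) := by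
  have h1 : ∑ S ∈ T.powerset, (if Disjoint S C then (1 : ℝ) else 0) = 2 ^ (T \ C).card := by
    have : (T.powerset.filter fun S => Disjoint S C) = (T \ C).powerset := by
      ext S
      simp only [Finset.mem_filter, Finset.mem_powerset, Finset.subset_sdiff]
    rw [Finset.sum_boole, this, Finset.card_powerset]
    push_cast
    rfl
  have h2 : ∑ S ∈ T.powerset, (if C ⊆ S then (1 : ℝ) else 0) =
      if C ⊆ T then 2 ^ (T \ C).card else 0 := by
    have : (T.powerset.filter fun S => C ⊆ S) = Finset.Icc C T := by
      ext S
      simp only [Finset.mem_filter, Finset.mem_powerset, Finset.mem_Icc, and_comm]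
    rw [Finset.sum_boole, this]
    split_ifs with h
    · rw [Finset.card_Icc_finset h, Finset.card_sdiff_of_subset h]
      push_cast
      rfl
    · rw [Finset.Icc_eq_empty h]
      simp
  have h3 : ∑ S ∈ T.powerset, (1 : ℝ) = 2 ^ (T \ C).card * 2 ^ (T ∩ C).card := by
    rw [← pow_add, Finset.card_sdiff_add_card_inter, Finset.sum_const, Finset.card_powerset]
    simp
  simp only [crossWeight]
  rw [Finset.sum_sub_distrib, Finset.sum_sub_distrib, h1, h2, h3]
  split_ifs <;> ring

open scoped Classical in
/-- The effect on colour sums of a second cross-polytopal subdivision, at a face of the simplex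
opposite to the one that was subdivided first. -/
lemma colorSum_crossSubdivision_crossSubdivision {V : Type*} [Fintype V]
    [DecidableEq V] {d : ℕ} {K : Set (Finset V)} {κ : V → Fin d} (hK : Rainbow K κ) {σ : Finset V}
    (hσ : σ ∈ K) (hcard : σ.card = d) {C : Finset (Fin d)} (hC : C.Nonempty) (F : Finset (Fin d) → ℝ) :
    colorSum (crossSubdivision (crossSubdivision K σ)
        ((∅ : Finset V).disjSum (σ.filter fun v => κ v ∈ C)))
        (Sum.elim (Sum.elim κ κ) (Sum.elim κ κ)) F =
      colorSum (crossSubdivision K σ) (Sum.elim κ κ) F +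
        ∑ S, crossWeight C S * ∑ T with S ⊆ T, F T := by
  have himg := hK.image_eq_univ hσ hcard
  have hinj := hK.inj σ hσ
  have hex : ∀ i, ∃ v ∈ σ, κ v = i := fun i => by
    have := Finset.mem_univ i
    rwa [← himg, Finset.mem_image] at this
  set E := σ.filter fun v => κ v ∈ C with hE
  have hne : E.Nonempty := by
    obtain ⟨i, hi⟩ := hC
    obtain ⟨v, hv, rfl⟩ := hex i
    exact ⟨v, Finset.mem_filter.2 ⟨hv, hi⟩⟩
  rw [colorSum_crossSubdivision (isLowerSet_crossSubdivision hK.lower σ),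
    sum_union_crossSubdivision hK hσ hcard (Finset.filter_subset _ _) hne]
  congr 1
  -- `κ` maps the facet `σ` bijectively to the colours, so subsets of `σ` become colour sets and `E`
  -- becomes `C`.
  have h1 : ∑ T ∈ σ.powerset, (2 : ℝ) ^ (T \ E).card *
      ((2 : ℝ) ^ (T ∩ E).card - 1 - if E ⊆ T then 1 else 0) * F (T.image κ) =
      ∑ T : Finset (Fin d), (2 : ℝ) ^ (T \ C).card *
      ((2 : ℝ) ^ (T ∩ C).card - 1 - if C ⊆ T then 1 else 0) * F T := by
    have himE : E.image κ = C := by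
      ext i
      simp only [hE, Finset.mem_image, Finset.mem_filter]
      constructor
      · rintro ⟨v, ⟨_, hv⟩, rfl⟩
        exact hv
      · intro hi
        obtain ⟨v, hv, rfl⟩ := hex i
        exact ⟨v, ⟨hv, hi⟩, rfl⟩
    have hEσ : E ⊆ σ := Finset.filter_subset _ _
    refine Finset.sum_nbij' (fun T => T.image κ) (fun T => σ.filter fun v => κ v ∈ T)
      (fun _ _ => Finset.mem_univ _) (fun T _ => Finset.mem_powerset.2 (Finset.filter_subset _ _))
      ?_ ?_ ?_
    · intro T hT
      rw [Finset.mem_powerset] at hT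
      ext v
      simp only [Finset.mem_filter, Finset.mem_image]
      constructor
      · rintro ⟨hv, w, hw, hwv⟩
        rwa [← hinj (hT hw) hv hwv]
      · exact fun hv => ⟨hT hv, v, hv, rfl⟩
    · intro T _
      ext i
      simp only [Finset.mem_filter, Finset.mem_image]
      constructor
      · rintro ⟨v, ⟨_, hv⟩, rfl⟩
        exact hv
      · intro hi
        obtain ⟨v, hv, rfl⟩ := hex i
        exact ⟨v, ⟨hv, hi⟩, rfl⟩
    · intro T hT
      rw [Finset.mem_powerset] at hT
      have e1 : T.image κ \ C = (T \ E).image κ := by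
        ext i
        simp only [hE, Finset.mem_sdiff, Finset.mem_filter, Finset.mem_image]
        constructor
        · rintro ⟨⟨v, hv, rfl⟩, h⟩
          exact ⟨v, ⟨hv, fun h' => h h'.2⟩, rfl⟩
        · rintro ⟨v, ⟨hv, h⟩, rfl⟩
          exact ⟨⟨v, hv, rfl⟩, fun h' => h ⟨hT hv, h'⟩⟩
      have e2 : T.image κ ∩ C = (T ∩ E).image κ := by
        ext i
        simp only [hE, Finset.mem_inter, Finset.mem_filter, Finset.mem_image]
        constructor
        · rintro ⟨⟨v, hv, rfl⟩, h⟩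
          exact ⟨v, ⟨hv, hT hv, h⟩, rfl⟩
        · rintro ⟨v, ⟨hv, _, h⟩, rfl⟩
          exact ⟨⟨v, hv, rfl⟩, h⟩
      have e3 : C ⊆ T.image κ ↔ E ⊆ T := by
        constructor
        · intro h v hv
          rw [hE, Finset.mem_filter] at hv
          obtain ⟨w, hw, hwv⟩ := Finset.mem_image.1 (h hv.2)
          rwa [← hinj (hT hw) hv.1 hwv]
        · intro h
          rw [← himE]
          exact Finset.image_subset_image h
      rw [e1, e2, Finset.card_image_of_injOn (hinj.mono fun v hv => hT (Finset.sdiff_subset hv)),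
        Finset.card_image_of_injOn (hinj.mono fun v hv => hT (Finset.inter_subset_left hv))]
      simp only [e3]
  rw [h1]
  simp_rw [← sum_crossWeight, Finset.sum_mul, Finset.mul_sum]
  refine Finset.sum_comm' fun T S => ?_
  simp

end

/-! ### Rainbow complexes as balanced complexes on `Fin n`. -/

section

section

variable {U V : Type*} {K : Set (Finset V)} {g : U ↪ V}

/-- The abstract simplicial complex of the nonempty sets mapped to faces of `K`. -/
def comapComplex (hK : IsLowerSet K) (g : U ↪ V) (hg : ∀ u, {g u} ∈ K) :
    AbstractSimplicialComplex U where
  faces := {s | s.Nonempty ∧ s.map g ∈ K}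
  isRelLowerSet_faces := by
    rintro s ⟨hs, hsK⟩
    exact ⟨hs, fun t hts ht => ⟨ht, hK (Finset.map_subset_map.2 hts) hsK⟩⟩
  singleton_mem u := ⟨Finset.singleton_nonempty u, by rw [Finset.map_singleton]; exact hg u⟩

lemma mem_allFaces_comapComplex (hK : IsLowerSet K) (h0 : ∅ ∈ K) (hg : ∀ u, {g u} ∈ K)
    {s : Finset U} : s ∈ allFaces (comapComplex hK g hg) ↔ s.map g ∈ K := by
  constructor
  · rintro (rfl | hs)
    · rwa [Finset.map_empty]
    · exact hs.2
  · intro hs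
    rcases s.eq_empty_or_nonempty with rfl | hne
    · exact Or.inl rfl
    · exact Or.inr ⟨hne, hs⟩

lemma exists_map_eq (hr : ∀ s ∈ K, ∀ v ∈ s, v ∈ Set.range g) {t : Finset V} (ht : t ∈ K) :
    ∃ s : Finset U, s.map g = t := by
  have : t ⊆ Finset.map g (t.preimage g g.injective.injOn) := by
    intro v hv
    obtain ⟨u, rfl⟩ := hr t ht v hv
    exact Finset.mem_map_of_mem g (Finset.mem_preimage.2 hv)
  refine ⟨t.preimage g g.injective.injOn, this.antisymm' fun v hv => ?_⟩
  obtain ⟨u, hu, rfl⟩ := Finset.mem_map.1 hv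
  exact Finset.mem_preimage.1 hu

variable [Fintype U] [Fintype V]

lemma extend_sum (x : U → ℝ) : ∑ v, Function.extend g x 0 v = ∑ u, x u := by
  classical
  rw [← Finset.sum_subset (Finset.subset_univ (Finset.univ.map g)), Finset.sum_map]
  · exact Finset.sum_congr rfl fun u _ => g.injective.extend_apply x 0 u
  · intro v _ hv
    exact Function.extend_apply' (f := g) x 0 v fun ⟨u, hu⟩ => hv (by simp [← hu])

lemma supp_extend (x : U → ℝ) : supp (Function.extend g x 0) = (supp x).map g := by
  ext v
  rw [mem_supp, Finset.mem_map]
  constructor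
  · intro h
    by_cases hv : ∃ u, g u = v
    · obtain ⟨u, rfl⟩ := hv
      rw [g.injective.extend_apply] at h
      exact ⟨u, mem_supp.2 h, rfl⟩
    · exact absurd (Function.extend_apply' (f := g) x 0 v hv) h
  · rintro ⟨u, hu, rfl⟩
    rw [g.injective.extend_apply]
    exact mem_supp.1 hu

lemma nonempty_homeomorph_comapComplex (hK : IsLowerSet K) (h0 : ∅ ∈ K) (hg : ∀ u, {g u} ∈ K)
    (hr : ∀ s ∈ K, ∀ v ∈ s, v ∈ Set.range g) :
    Nonempty (geom (allFaces (comapComplex hK g hg)) ≃ₜ geom K) := by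
  refine nonempty_homeomorph_of_bijOn (isLowerSet_allFaces _)
    (Φ := fun x => Function.extend g x 0) ?_ ⟨?_, ?_, ?_⟩
  · refine continuous_pi fun v => ?_
    by_cases hv : ∃ u, g u = v
    · obtain ⟨u, rfl⟩ := hv
      simp only [g.injective.extend_apply]
      exact continuous_apply u
    · have : (fun x : U → ℝ => Function.extend g x 0 v) = fun _ => 0 := by
        funext x
        exact Function.extend_apply' (f := g) x 0 v hv
      rw [this]
      exact continuous_const
  · rintro x ⟨hx, hxs⟩
    refine ⟨⟨fun v => ?_, ?_⟩, ?_⟩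
    · change 0 ≤ Function.extend g x 0 v
      by_cases hv : ∃ u, g u = v
      · obtain ⟨u, rfl⟩ := hv
        rw [g.injective.extend_apply]
        exact hx.1 u
      · rw [Function.extend_apply' (f := g) x 0 v hv]
        rfl
    · rw [extend_sum]
      exact hx.2
    · rw [supp_extend]
      exact (mem_allFaces_comapComplex hK h0 hg).1 hxs
  · intro x _ y _ hxy
    funext u
    have := congrFun hxy (g u)
    simpa only [g.injective.extend_apply] using this
  · rintro y ⟨hy, hys⟩
    have hext : Function.extend g (y ∘ g) 0 = y := by
      funext v
      by_cases hv : ∃ u, g u = v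
      · obtain ⟨u, rfl⟩ := hv
        rw [g.injective.extend_apply]
        rfl
      · rw [Function.extend_apply' (f := g) (y ∘ g) (0 : V → ℝ) v hv]
        by_contra hne
        exact hv (hr _ hys v (mem_supp.2 fun h => hne h.symm))
    refine ⟨y ∘ g, ⟨⟨fun u => hy.1 (g u), ?_⟩, ?_⟩, hext⟩
    · rw [← extend_sum (g := g), hext]
      exact hy.2
    · rw [mem_allFaces_comapComplex hK h0 hg, ← supp_extend, hext]
      exact hys

end

section

variable {V : Type*} [Fintype V] {d m : ℕ}

lemma colorCount_comp_of_injOn {U W : Type*} [DecidableEq W] {κ : U → W} {s : Finset U}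
    (hκ : Set.InjOn κ s) (π : W → Fin m) (j : Fin m) :
    colorCount (π ∘ κ) s j = colorCount π (s.image κ) j := by
  unfold colorCount
  rw [Finset.filter_image, Finset.card_image_of_injOn (hκ.mono fun v hv =>
    (Finset.mem_filter.1 hv).1)]
  rfl

/-- Merging the colours of a rainbow complex along `π` gives a balanced complex. -/
lemma Rainbow.exists_mem_fineHVectors {K : Set (Finset V)} {κ : V → Fin d} (h : Rainbow K κ)
    (π : Fin d → Fin m) {a : Fin m → ℕ} (hpos : ∀ j, 0 < a j)
    (hπ : ∀ j, colorCount π Finset.univ j = a j) {W : Type*} [Fintype W]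
    {Δ : AbstractSimplicialComplex W} (hΔ : Nonempty (geom K ≃ₜ geom (allFaces Δ))) :
    (fun b : Set.Iic a => colorSum K κ fun T => ∏ i, hCoeff (a i) (b.1 i) (colorCount π T i)) ∈
      fineHVectors Δ a := by
  classical
  -- Every point of the vertex type of an `AbstractSimplicialComplex` is a vertex, so the points of
  -- `V` not used by `K` are dropped.
  let U := {v : V // {v} ∈ K}
  let e : Fin (Fintype.card U) ≃ U := (Fintype.equivFin U).symm
  let g : Fin (Fintype.card U) ↪ V := e.toEmbedding.trans (Function.Embedding.subtype _)
  have hg : ∀ u, {g u} ∈ K := fun u => (e u).2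
  have hr : ∀ s ∈ K, ∀ v ∈ s, v ∈ Set.range g := fun s hs v hv => by
    refine ⟨e.symm ⟨v, h.lower (Finset.singleton_subset_iff.2 hv) hs⟩, ?_⟩
    change ((e (e.symm _) : U) : V) = v
    rw [Equiv.apply_symm_apply]
  have hmem : ∀ {s}, s ∈ allFaces (comapComplex h.lower g hg) ↔ s.map g ∈ K :=
    mem_allFaces_comapComplex h.lower h.empty_mem hg
  have hcount : ∀ s, s.map g ∈ K → ∀ j,
      colorCount (π ∘ κ ∘ g) s j = colorCount π ((s.map g).image κ) j := by
    intro s hs j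
    have hinj : Set.InjOn (κ ∘ g) s := fun x hx y hy hxy => g.injective
      (h.inj _ hs (Finset.mem_map_of_mem g hx) (Finset.mem_map_of_mem g hy) hxy)
    rw [colorCount_comp_of_injOn hinj, Finset.map_eq_image, Finset.image_image]
  have hfull : ∀ s, s.map g ∈ K → (s.map g).card = d → ∀ j,
      colorCount (π ∘ κ ∘ g) s j = a j := by
    intro s hs hc j
    rw [hcount s hs, h.image_eq_univ hs hc, hπ]
  refine ⟨_, comapComplex h.lower g hg, π ∘ κ ∘ g, ⟨?_, ?_⟩, ?_, ?_⟩
  · intro j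
    obtain ⟨t, ht, -, hc⟩ := h.ext ∅ h.empty_mem
    obtain ⟨s, rfl⟩ := exists_map_eq hr ht
    have h1 := hpos j
    rw [← hfull s ht hc j] at h1
    obtain ⟨u, hu⟩ := Finset.card_pos.1 h1
    exact ⟨u, (Finset.mem_filter.1 hu).2⟩
  · intro s hs
    obtain ⟨t, ht, hst, hc⟩ := h.ext _ hs.1.2
    obtain ⟨s', rfl⟩ := exists_map_eq hr ht
    have hle := Finset.map_subset_map.1 hst
    have := hs.2 (y := s') ⟨hs.1.1.mono hle, ht⟩ hle
    rw [hle.antisymm this]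
    exact hfull s' ht hc
  · obtain ⟨f⟩ := nonempty_homeomorph_comapComplex h.lower h.empty_mem hg hr
    obtain ⟨f'⟩ := hΔ
    rw [Homeomorphic, realization_eq_geom, realization_eq_geom]
    exact ⟨f.trans f'⟩
  · funext b
    rw [fineH_eq_sum, colorSum]
    symm
    refine Finset.sum_bij (fun s _ => s.map g) ?_ ?_ ?_ ?_
    · intro s hs
      exact Finset.mem_filter.2 ⟨Finset.mem_univ _, hmem.1 (Finset.mem_filter.1 hs).2⟩
    · intro s _ t _ hst
      exact Finset.map_injective g hst
    · intro t ht
      obtain ⟨s, rfl⟩ := exists_map_eq hr (Finset.mem_filter.1 ht).2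
      exact ⟨s, Finset.mem_filter.2 ⟨Finset.mem_univ _, hmem.2 (Finset.mem_filter.1 ht).2⟩, rfl⟩
    · intro s hs
      have h1 := hcount s (hmem.1 (Finset.mem_filter.1 hs).2)
      simp only [h1]

/-- The faces of a simplex: the coefficients of `hCoeff` detect the type of a colour set. -/
lemma sum_prod_hCoeff {π : Fin d → Fin m} {a : Fin m → ℕ}
    (hπ : ∀ j, colorCount π Finset.univ j = a j) (b : Fin m → ℕ)
    (S : Finset (Fin d)) :
    ∑ T with S ⊆ T, ∏ i, hCoeff (a i) (b i) (colorCount π T i) =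
      if ∀ j, colorCount π S j = b j then 1 else 0 := by
  classical
  have hadd : ∀ X Y : Finset (Fin d), Disjoint X Y → ∀ j,
      colorCount π (X ∪ Y) j = colorCount π X j + colorCount π Y j := by
    intro X Y hXY j
    unfold colorCount
    rw [Finset.filter_union, Finset.card_union_of_disjoint
      (Finset.disjoint_filter_filter hXY)]
  have hcompl : ∀ j, colorCount π Sᶜ j = a j - colorCount π S j := by
    intro j
    have := hadd S Sᶜ disjoint_compl_right j
    rw [Finset.union_compl, hπ] at this
    omega
  -- Write `T = S ∪ R`. The number of `R` giving `T` a fixed type `c` is a product of binomial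
  -- coefficients, so the sum splits by colours and `sum_choose_mul_hCoeff_eq` applies.
  have h1 : ∑ T with S ⊆ T, ∏ i, hCoeff (a i) (b i) (colorCount π T i) =
      ∑ R ∈ Sᶜ.powerset, ∏ i, hCoeff (a i) (b i) (colorCount π S i + colorCount π R i) := by
    refine Finset.sum_nbij' (fun T => T \ S) (fun R => S ∪ R) ?_ ?_ ?_ ?_ ?_
    · intro T _
      rw [Finset.mem_powerset, Finset.subset_compl_iff_disjoint_right]
      exact Finset.sdiff_disjoint
    · intro R _
      simp
    · intro T hT
      exact Finset.union_sdiff_of_subset (Finset.mem_filter.1 hT).2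
    · intro R hR
      rw [Finset.mem_powerset, Finset.subset_compl_iff_disjoint_left] at hR
      exact Finset.union_sdiff_cancel_left hR
    · intro T hT
      refine Finset.prod_congr rfl fun i _ => ?_
      rw [← hadd S (T \ S) Finset.disjoint_sdiff,
        Finset.union_sdiff_of_subset (Finset.mem_filter.1 hT).2]
  have h2 : ∀ R : Finset (Fin d), ∏ i, hCoeff (a i) (b i) (colorCount π S i + colorCount π R i) =
      ∑ c ∈ Finset.Iic b, if ∀ j, colorCount π S j + colorCount π R j = c j then
        ∏ i, hCoeff (a i) (b i) (c i) else 0 := by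
    intro R
    have h3 : ∀ c : Fin m → ℕ, (∀ j, colorCount π S j + colorCount π R j = c j) ↔
        (fun j => colorCount π S j + colorCount π R j) = c := fun c => funext_iff.symm
    simp_rw [h3]
    rw [Finset.sum_ite_eq]
    split_ifs with h4
    · rfl
    · rw [Finset.mem_Iic, Pi.le_def] at h4
      push Not at h4
      obtain ⟨i, hi⟩ := h4
      exact Finset.prod_eq_zero (Finset.mem_univ i) (if_neg (not_le.2 hi))
  have h5 : ∀ c : Fin m → ℕ, ∑ R ∈ Sᶜ.powerset,
      (if ∀ j, colorCount π S j + colorCount π R j = c j then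
        ∏ i, hCoeff (a i) (b i) (c i) else 0) =
      ∏ i, (if colorCount π S i ≤ c i then
        ((a i - colorCount π S i).choose (c i - colorCount π S i) : ℝ) else 0) *
          hCoeff (a i) (b i) (c i) := by
    intro c
    rw [Finset.prod_mul_distrib, ← Finset.sum_filter, Finset.sum_const, nsmul_eq_mul]
    congr 1
    by_cases hc : ∀ i, colorCount π S i ≤ c i
    · rw [Finset.prod_congr rfl fun i _ => if_pos (hc i), ← Nat.cast_prod]
      simp_rw [← hcompl]
      rw [← card_filter_colorCount]
      congr 2
      refine Finset.filter_congr fun R _ => forall_congr' fun j => ?_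
      have := hc j
      omega
    · push Not at hc
      obtain ⟨i, hi⟩ := hc
      rw [Finset.prod_eq_zero (Finset.mem_univ i) (if_neg (not_le.2 hi)),
        Finset.filter_false_of_mem]
      · simp
      · intro R _ h
        have := h i
        omega
  rw [h1]
  simp_rw [h2]
  rw [Finset.sum_comm]
  simp_rw [h5]
  rw [sum_Iic_prod b fun i k => (if colorCount π S i ≤ k then
        ((a i - colorCount π S i).choose (k - colorCount π S i) : ℝ) else 0) *
          hCoeff (a i) (b i) k]
  simp_rw [sum_choose_mul_hCoeff_eq]
  rw [Finset.prod_ite_zero]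
  simp

end

end

/-! ### The target space: dimension, spanning vectors and Möbius inversion. -/

section

section

variable {I : Type*}

/-- The functions that are invariant under `r` and vanish at `z`. -/
def invariantVanishing (r : I → I) (z : I) : Submodule ℝ (I → ℝ) where
  carrier := {h | h z = 0 ∧ ∀ b, h (r b) = h b}
  add_mem' {f g} hf hg := ⟨by simp [hf.1, hg.1], fun b => by simp [hf.2 b, hg.2 b]⟩
  zero_mem' := ⟨rfl, fun _ => rfl⟩
  smul_mem' c f hf := ⟨by simp [hf.1], fun b => by simp [hf.2 b]⟩

variable [DecidableEq I]

/-- The projection onto the functions that are invariant under `r` and vanish at `z`. -/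
def invariantProj (r : I → I) (z : I) : (I → ℝ) →ₗ[ℝ] (I → ℝ) where
  toFun h b := if b = z ∨ b = r z then 0 else (h b + h (r b)) / 2
  map_add' f g := by
    funext b
    simp only [Pi.add_apply]
    split_ifs <;> ring
  map_smul' c f := by
    funext b
    simp only [Pi.smul_apply, smul_eq_mul, RingHom.id_apply]
    split_ifs <;> ring

lemma isProj_invariantProj {r : I → I} (hr : Function.Involutive r) (z : I) :
    LinearMap.IsProj (invariantVanishing r z) (invariantProj r z) where
  map_mem h := by
    refine ⟨by simp [invariantProj], fun b => ?_⟩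
    have e : (r b = z ∨ r b = r z) ↔ (b = z ∨ b = r z) := by
      rw [hr.injective.eq_iff, hr.eq_iff, or_comm]
    simp only [invariantProj, LinearMap.coe_mk, AddHom.coe_mk, e, hr b, add_comm (h (r b))]
  map_id h hh := by
    funext b
    simp only [invariantProj, LinearMap.coe_mk, AddHom.coe_mk]
    split_ifs with hb
    · rcases hb with rfl | rfl
      · exact hh.1.symm
      · rw [hh.2, hh.1]
    · rw [hh.2 b]
      ring

variable [Fintype I]

lemma finrank_invariantVanishing {r : I → I} (hr : Function.Involutive r) {z : I} (hz : r z ≠ z) :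
    (Module.finrank ℝ (invariantVanishing r z) : ℝ) =
      ((Fintype.card I : ℝ) - 2 + (Finset.univ.filter fun b => r b = b).card) / 2 := by
  rw [← (isProj_invariantProj hr z).trace, LinearMap.trace_eq_matrix_trace ℝ (Pi.basisFun ℝ I)]
  -- The trace of a projection is the dimension of its image. The diagonal entry is `0` at `z` and
  -- `r z`, and elsewhere `1` at a fixed point and `1 / 2` otherwise.
  have h1 : ∀ b, (LinearMap.toMatrix (Pi.basisFun ℝ I) (Pi.basisFun ℝ I) (invariantProj r z)).diag b
      = (1 + (if r b = b then 1 else 0) - (if b = z then 1 else 0) -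
          (if b = r z then 1 else 0)) / 2 := by
    intro b
    rw [Matrix.diag_apply, LinearMap.toMatrix_apply]
    simp only [Pi.basisFun_apply, Pi.basisFun_repr, invariantProj, LinearMap.coe_mk, AddHom.coe_mk,
      Pi.single_apply]
    by_cases h1 : b = z
    · subst h1
      simp [hz, hz.symm]
    · by_cases h2 : b = r z
      · subst h2
        rw [hr z]
        simp [hz, hz.symm]
      · simp [h1, h2]
  rw [Matrix.trace, Finset.sum_congr rfl fun b _ => h1 b, ← Finset.sum_div]
  congr 1
  simp only [Finset.sum_sub_distrib, Finset.sum_add_distrib, Finset.sum_boole,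
    Finset.filter_eq' _ z, Finset.filter_eq' _ (r z), Finset.mem_univ, if_true,
    Finset.card_singleton, Finset.sum_const, Finset.card_univ, nsmul_eq_mul]
  push_cast
  ring

/-- Weighting the vector of `b` by `h b / 2` compensates for each orbit being met from both ends,
and gives the right value at fixed points as well. -/
lemma invariantVanishing_le_span {r : I → I} (hr : Function.Involutive r) {z : I}
    {P : Submodule ℝ (I → ℝ)}
    (hP : ∀ b, b ≠ z → b ≠ r z → (Pi.single b 1 + Pi.single (r b) 1 : I → ℝ) ∈ P) :
    invariantVanishing r z ≤ P := by
  intro h hh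
  have h1 : h = ∑ b, (h b / 2) • (Pi.single b 1 + Pi.single (r b) 1 : I → ℝ) := by
    funext c
    have e : ∀ b, (Pi.single (r b) 1 : I → ℝ) c = (Pi.single b 1 : I → ℝ) (r c) := fun b => by
      simp only [Pi.single_apply, hr.eq_iff, eq_comm (a := c)]
    simp only [Finset.sum_apply, Pi.smul_apply, Pi.add_apply, smul_eq_mul, e, mul_add,
      Finset.sum_add_distrib]
    simp [Pi.single_apply]
    rw [hh.2]
    ring
  rw [h1]
  refine P.sum_mem fun b _ => ?_
  by_cases hb : b = z
  · rw [hb, hh.1, zero_div, zero_smul]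
    exact P.zero_mem
  · by_cases hb' : b = r z
    · rw [hb', hh.2, hh.1, zero_div, zero_smul]
      exact P.zero_mem
    · exact P.smul_mem _ (hP b hb hb')

end

/-- Möbius inversion: symmetrized indicators are combinations of the weights `crossWeight C`. -/
lemma sum_crossWeight_compl {α : Type*} [Fintype α] [DecidableEq α] {S : Finset α}
    (hS : S.Nonempty) (X : Finset α) :
    ∑ A ∈ S.powerset, (-1 : ℝ) ^ (S.card - A.card) * crossWeight Aᶜ X =
      -((if X = S then 1 else 0) + if Xᶜ = S then 1 else 0) := by
  have key : ∀ Y : Finset α, ∑ A ∈ S.powerset, (-1 : ℝ) ^ (S.card - A.card) *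
      (if Y ⊆ A then 1 else 0) = if Y = S then 1 else 0 := by
    intro Y
    simp_rw [mul_ite, mul_one, mul_zero]
    rw [← Finset.sum_filter]
    by_cases hY : Y ⊆ S
    · have h1 : ∑ A ∈ S.powerset with Y ⊆ A, (-1 : ℝ) ^ (S.card - A.card) =
          ∑ B ∈ (S \ Y).powerset, 1 ^ B.card * (-1 : ℝ) ^ ((S \ Y).card - B.card) := by
        refine Finset.sum_nbij' (fun A => A \ Y) (fun B => Y ∪ B) ?_ ?_ ?_ ?_ ?_
        · intro A hA
          rw [Finset.mem_filter, Finset.mem_powerset] at hA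
          exact Finset.mem_powerset.2 (Finset.sdiff_subset_sdiff hA.1 le_rfl)
        · intro B hB
          rw [Finset.mem_powerset] at hB
          rw [Finset.mem_filter, Finset.mem_powerset]
          exact ⟨Finset.union_subset hY (hB.trans Finset.sdiff_subset), Finset.subset_union_left⟩
        · intro A hA
          exact Finset.union_sdiff_of_subset (Finset.mem_filter.1 hA).2
        · intro B hB
          rw [Finset.mem_powerset, Finset.subset_sdiff] at hB
          exact Finset.union_sdiff_cancel_left hB.2.symm
        · intro A hA
          rw [Finset.mem_filter, Finset.mem_powerset] at hA
          rw [one_pow, one_mul, Finset.card_sdiff_of_subset hA.2, Finset.card_sdiff_of_subset hY,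
            Nat.sub_sub_sub_cancel_right (Finset.card_le_card hA.2)]
      rw [h1, Finset.sum_pow_mul_eq_add_pow, add_neg_cancel, zero_pow_eq]
      refine if_congr ?_ rfl rfl
      rw [Finset.card_eq_zero, Finset.sdiff_eq_empty_iff_subset]
      exact ⟨hY.antisymm, fun h => h.symm.le⟩
    · rw [if_neg fun h => hY h.le]
      refine Finset.sum_eq_zero fun A hA => ?_
      rw [Finset.mem_filter, Finset.mem_powerset] at hA
      exact absurd (hA.2.trans hA.1) hY
  have hone : ∑ A ∈ S.powerset, (-1 : ℝ) ^ (S.card - A.card) = 0 := by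
    have := key ∅
    rw [if_neg hS.ne_empty.symm] at this
    simpa using this
  -- In this form the alternating sum over `A ⊆ S` turns each containment in `A` into equality with
  -- `S`, and kills the constant because `S` is nonempty.
  have h2 : ∀ A : Finset α, crossWeight Aᶜ X =
      1 - (if X ⊆ A then 1 else 0) - if Xᶜ ⊆ A then 1 else 0 := by
    intro A
    have e1 : Disjoint X Aᶜ ↔ X ⊆ A := by
      rw [disjoint_compl_right_iff]
    have e2 : Aᶜ ⊆ X ↔ Xᶜ ⊆ A := compl_le_iff_compl_le
    simp only [crossWeight, e1, e2]
  simp_rw [h2, mul_sub, mul_one]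
  rw [Finset.sum_sub_distrib, Finset.sum_sub_distrib, key, key, hone]
  ring

section

variable {d m : ℕ}

lemma exists_colorCount_eq {a : Fin m → ℕ} (ha : ∑ j, a j = d) :
    ∃ π : Fin d → Fin m, ∀ j, colorCount π Finset.univ j = a j := by
  subst ha
  refine ⟨fun k => (finSigmaFinEquiv.symm k).1, fun j => ?_⟩
  unfold colorCount
  rw [← Fintype.card_subtype]
  have e : {k // (finSigmaFinEquiv.symm k).1 = j} ≃ Fin (a j) :=
    (finSigmaFinEquiv.symm.subtypeEquiv fun k => Iff.rfl).trans
      (Equiv.sigmaSubtype (β := fun j => Fin (a j)) j)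
  rw [Fintype.card_congr e, Fintype.card_fin]

lemma exists_finset_colorCount {π : Fin d → Fin m} {a : Fin m → ℕ}
    (hπ : ∀ j, colorCount π Finset.univ j = a j) {b : Fin m → ℕ} (hb : b ≤ a) :
    ∃ S, ∀ j, colorCount π S j = b j := by
  classical
  have := card_filter_colorCount π Finset.univ b
  have hpos : 0 < ∏ j, (colorCount π Finset.univ j).choose (b j) :=
    Finset.prod_pos fun j _ => Nat.choose_pos (by rw [hπ]; exact hb j)
  rw [← this] at hpos
  obtain ⟨S, hS⟩ := Finset.card_pos.1 hpos
  exact ⟨S, (Finset.mem_filter.1 hS).2⟩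

end

end

/-! ### The two inclusions and the dimension formula. -/

section

section

variable {m : ℕ}

/-- The involution `b ↦ a - b`. -/
def reverse (a : Fin m → ℕ) (b : Set.Iic a) : Set.Iic a :=
  ⟨fun j => a j - b.1 j, fun j => Nat.sub_le (a j) (b.1 j)⟩

/-- The type of the empty colour set. -/
def zeroType (a : Fin m → ℕ) : Set.Iic a := ⟨0, fun j => Nat.zero_le (a j)⟩

lemma reverse_involutive (a : Fin m → ℕ) : Function.Involutive (reverse a) := by
  intro b
  refine Subtype.ext (funext fun j => ?_)
  exact Nat.sub_sub_self (b.2 j)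

lemma reverse_zeroType_ne {a : Fin m → ℕ} (ha : ∑ j, a j ≠ 0) :
    reverse a (zeroType a) ≠ zeroType a := by
  intro h
  refine ha (Finset.sum_eq_zero fun j _ => ?_)
  exact congrFun (congrArg Subtype.val h) j

lemma card_reverse_fixed (a : Fin m → ℕ) [DecidableEq (Set.Iic a)] :
    (Finset.univ.filter fun b => reverse a b = b).card = if ∀ j, Even (a j) then 1 else 0 := by
  have hfix : ∀ b : Set.Iic a, reverse a b = b ↔ ∀ j, a j = b.1 j + b.1 j := by
    intro b
    rw [Subtype.ext_iff, funext_iff]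
    refine forall_congr' fun j => ?_
    have := b.2 j
    change a j - b.1 j = b.1 j ↔ _
    omega
  split_ifs with h
  · choose c hc using h
    rw [Finset.card_eq_one]
    refine ⟨⟨c, fun j => (Nat.le_add_right _ _).trans (hc j).ge⟩, ?_⟩
    ext b
    rw [Finset.mem_filter, Finset.mem_singleton, hfix, Subtype.ext_iff, funext_iff]
    refine ⟨fun hb j => ?_, fun hb => ⟨Finset.mem_univ _, fun j => ?_⟩⟩
    · have := hb.2 j
      have := hc j
      change b.1 j = c j
      omega
    · rw [hb j]
      exact hc j
  · rw [Finset.card_eq_zero, Finset.filter_eq_empty_iff]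
    intro b _ hb
    exact h fun j => ⟨b.1 j, (hfix b).1 hb j⟩

lemma card_Iic_type (a : Fin m → ℕ) : Fintype.card (Set.Iic a) = ∏ j, (a j + 1) := by
  rw [← Set.toFinset_card, Set.toFinset_Iic, Pi.card_Iic]
  simp

/-- The defect in `fineH_reverse` involves the complex only through its signed face count, a
topological invariant, so it cancels in differences. -/
lemma vectorSpan_fineHVectors_le {V : Type*} [Fintype V] {Δ : AbstractSimplicialComplex V} {d : ℕ}
    (hΔ : IsSemiEulerian Δ d) {a : Fin m → ℕ} (ha : ∑ j, a j = d) :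
    vectorSpan ℝ (fineHVectors Δ a) ≤ invariantVanishing (reverse a) (zeroType a) := by
  rw [vectorSpan_def, Submodule.span_le]
  rintro _ ⟨h₁, ⟨n₁, L₁, φ₁, hb₁, hh₁, rfl⟩, h₂, ⟨n₂, L₂, φ₂, hb₂, hh₂, rfl⟩, rfl⟩
  obtain ⟨e₁, s₁⟩ := starCount_of_homeomorphic hh₁ hΔ
  obtain ⟨e₂, s₂⟩ := starCount_of_homeomorphic hh₂ hΔ
  refine ⟨?_, fun b => ?_⟩
  · exact sub_eq_zero.2 ((fineH_zero L₁ φ₁ a (zeroType a).2).trans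
      (fineH_zero L₂ φ₂ a (zeroType a).2).symm)
  · simp only [vsub_eq_sub, Pi.sub_apply]
    rw [fineH_reverse hb₁.2 ha s₁ b (reverse a b) fun _ => rfl,
      fineH_reverse hb₂.2 ha s₂ b (reverse a b) fun _ => rfl, e₁, e₂]
    ring

lemma colorCount_compl {d : ℕ} (π : Fin d → Fin m) (S : Finset (Fin d)) (j : Fin m) :
    colorCount π Sᶜ j = colorCount π Finset.univ j - colorCount π S j := by
  unfold colorCount
  rw [← Finset.card_sdiff_of_subset (Finset.filter_subset_filter _ (Finset.subset_univ S))]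
  congr 1
  ext i
  simp only [Finset.mem_filter, Finset.mem_compl, Finset.mem_sdiff, Finset.mem_univ, true_and]
  tauto

/-- It suffices to compare one complex, the barycentric subdivision further subdivided at a facet,
with its second subdivisions at the faces of the opposite simplex. -/
lemma le_vectorSpan_fineHVectors {V : Type*} [Fintype V] {Δ : AbstractSimplicialComplex V} {d : ℕ}
    (hd : 0 < d) (hne : Δ.faces.Nonempty) (hpure : IsPure Δ d) {a : Fin m → ℕ}
    (hpos : ∀ j, 0 < a j) (ha : ∑ j, a j = d) :
    invariantVanishing (reverse a) (zeroType a) ≤ vectorSpan ℝ (fineHVectors Δ a) := by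
  classical
  obtain ⟨π, hπ⟩ := exists_colorCount_eq ha
  have hK := rainbow_barycentric hd hpure hne
  obtain ⟨σ, hσ, -, hcard⟩ := hK.ext ∅ hK.empty_mem
  have hσ0 : σ.Nonempty := Finset.card_pos.1 (by omega)
  obtain ⟨f₀⟩ := nonempty_homeomorph_barycentric (isLowerSet_allFaces Δ)
  obtain ⟨f₁⟩ := nonempty_homeomorph_crossSubdivision hK.lower hσ0
  have hK₁ := hK.crossSubdivision hσ0
  set F : Set.Iic a → Finset (Fin d) → ℝ :=
    fun b T => ∏ i, hCoeff (a i) (b.1 i) (colorCount π T i) with hF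
  have h₁ := hK₁.exists_mem_fineHVectors π hpos hπ ⟨f₁.trans f₀⟩
  have hdiff : ∀ C : Finset (Fin d), C.Nonempty →
      (fun b : Set.Iic a => ∑ S, crossWeight C S * if ∀ j, colorCount π S j = b.1 j then 1 else 0) ∈
        vectorSpan ℝ (fineHVectors Δ a) := by
    intro C hC
    have hE : ((∅ : Finset (Finset V)).disjSum (σ.filter fun v => rank V hd v ∈ C)).Nonempty := by
      obtain ⟨i, hi⟩ := hC
      have : i ∈ σ.image (rank V hd) := by
        rw [hK.image_eq_univ hσ hcard]
        exact Finset.mem_univ i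
      obtain ⟨v, hv, rfl⟩ := Finset.mem_image.1 this
      exact ⟨Sum.inr v, Finset.inr_mem_disjSum.2 (Finset.mem_filter.2 ⟨hv, hi⟩)⟩
    obtain ⟨f₂⟩ := nonempty_homeomorph_crossSubdivision hK₁.lower hE
    have h₂ := (hK₁.crossSubdivision hE).exists_mem_fineHVectors π hpos hπ
      ⟨f₂.trans (f₁.trans f₀)⟩
    have h₃ := vsub_mem_vectorSpan ℝ h₂ h₁
    convert h₃ using 1
    funext b
    simp only [vsub_eq_sub, Pi.sub_apply]
    rw [colorSum_crossSubdivision_crossSubdivision hK hσ hcard hC, add_sub_cancel_left]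
    simp only [sum_prod_hCoeff hπ]
  refine invariantVanishing_le_span (reverse_involutive a) fun b hb0 hb1 => ?_
  obtain ⟨S, hS⟩ := exists_finset_colorCount hπ b.2
  have hS0 : S.Nonempty := by
    rw [Finset.nonempty_iff_ne_empty]
    rintro rfl
    refine hb0 (Subtype.ext (funext fun j => ?_))
    rw [← hS j]
    simp [colorCount, zeroType]
  -- Then no `A ⊆ S` is everything, so each colour set `Aᶜ` is nonempty, as the second subdivision
  -- requires.
  have hS1 : S ≠ Finset.univ := by
    rintro rfl
    refine hb1 (Subtype.ext (funext fun j => ?_))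
    rw [← hS j, hπ]
    simp [reverse, zeroType]
  have hmem : ∑ A ∈ S.powerset, (-1 : ℝ) ^ (S.card - A.card) •
      (fun b : Set.Iic a => ∑ X, crossWeight Aᶜ X *
        if ∀ j, colorCount π X j = b.1 j then (1 : ℝ) else 0) ∈
      vectorSpan ℝ (fineHVectors Δ a) := by
    refine Submodule.sum_mem _ fun A hA => Submodule.smul_mem _ _ (hdiff _ ?_)
    rw [Finset.nonempty_iff_ne_empty, Ne, Finset.compl_eq_empty_iff]
    rintro rfl
    exact hS1 (Finset.univ_subset_iff.1 (Finset.mem_powerset.1 hA))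
  have htype : ∀ (X : Finset (Fin d)) (b b' : Set.Iic a), (∀ j, colorCount π X j = b.1 j) →
      ((∀ j, colorCount π X j = b'.1 j) ↔ b' = b) := by
    intro X b b' h
    rw [Subtype.ext_iff, funext_iff]
    refine forall_congr' fun j => ?_
    rw [h j, eq_comm]
  have hSc : ∀ j, colorCount π Sᶜ j = (reverse a b).1 j := by
    intro j
    rw [colorCount_compl, hπ, hS]
    rfl
  -- The Möbius sum yields minus the wanted vector.
  rw [← neg_mem_iff]
  convert hmem using 1
  funext c
  simp only [Finset.sum_apply, Pi.smul_apply, smul_eq_mul, Finset.mul_sum]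
  rw [Finset.sum_comm]
  simp_rw [← mul_assoc, ← Finset.sum_mul, sum_crossWeight_compl hS0, compl_eq_comm (y := S)]
  simp only [neg_mul, add_mul, ite_mul, one_mul, zero_mul, Finset.sum_neg_distrib,
    Finset.sum_add_distrib, Finset.sum_ite_eq, Finset.sum_ite_eq', Finset.mem_univ, if_true,
    htype S b c hS, htype Sᶜ (reverse a b) c hSc, Pi.neg_apply, Pi.add_apply, Pi.single_apply]

end

end

end BalancedComplex

end

open BalancedComplex in
theorem mainTheorem1 {V : Type*} [Fintype V] (Δ : AbstractSimplicialComplex V) (d : ℕ)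
    (hd : 4 ≤ d) (hconn : IsConnected (BalancedComplex.realization Δ))
    (hpure : BalancedComplex.IsPure Δ d) (hΔ : BalancedComplex.IsSemiEulerian Δ d)
    (m : ℕ) (a : Fin m → ℕ) (hpos : ∀ j, 0 < a j) (ha : ∑ j, a j = d) :
    (Module.finrank ℝ (affineSpan ℝ (BalancedComplex.fineHVectors Δ a)).direction : ℚ) =
      if ∀ j, Even (a j) then ((∏ j, ((a j : ℚ) + 1)) - 1) / 2
      else ((∏ j, ((a j : ℚ) + 1)) - 2) / 2 := by
  classical
  have hsum : ∑ j, a j ≠ 0 := by omega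
  have hne : Δ.faces.Nonempty := by
    obtain ⟨x, hx⟩ := hconn.nonempty
    obtain ⟨s, hs, -⟩ := Set.mem_iUnion₂.1 hx
    exact ⟨s, hs⟩
  have hdir : (affineSpan ℝ (fineHVectors Δ a)).direction =
      invariantVanishing (reverse a) (zeroType a) := by
    rw [direction_affineSpan]
    exact (vectorSpan_fineHVectors_le hΔ ha).antisymm
      (le_vectorSpan_fineHVectors (by omega) hne hpure hpos ha)
  have hrank := finrank_invariantVanishing (reverse_involutive a) (reverse_zeroType_ne hsum)
  rw [card_Iic_type, card_reverse_fixed] at hrank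
  rw [hdir, ← Rat.cast_inj (α := ℝ)]
  split_ifs at hrank ⊢ <;>
  · push_cast at hrank ⊢
    rw [hrank]
    ring
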